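/- Let $G\rightrightarrows M$ be a Lie groupoid (smooth finite-dimensional manifolds, source $\alpha$ and target $\beta$ submersions, identity section $\epsilon$, inversion $i$), where $g\in G$ is an arrow from $\alpha(g)$ to $\beta(g)$, the product $gh$ is defined when $\beta(g)=\alpha(h)$, and $l_g(h)=gh$, $r_g(h)=hg$. Its Lie algebroid $AG\to M$ has fibres $A_xG=\ker T_{\epsilon(x)}\alpha$, anchor $T_{\epsilon(x)}\beta$ and the bracket of left-invariant vector fields. Put $V\alpha=\ker T\alpha$ and $V\beta=\ker T\beta$, and consider $$G_\beta\star G_\alpha=\{(g,h,s)\in G^3:\ \beta(g)=\beta(h),\ \alpha(h)=\alpha(s)\},$$ with source $(g,h,s)\mapsto g$, target $(g,h,s)\mapsto s$, identities $(g,g,g)$, product $(g,h,s)(s,h',s')=(g,h's^{-1}h,s')$ and inverse $(g,h,s)^{-1}=(s,gh^{-1}s,g)$. For $\pi=\beta$ or $\pi=\alpha$ consider the prolongation $$\mathcal P^{\pi}G=\{(g,h,s)\in G^3:\ \pi(g)=\alpha(h),\ \beta(h)=\pi(s)\},$$ with source $g$, target $s$, identities $(g,\epsilon(\pi(g)),g)$,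 product $(g,h,s)(s,t,u)=(g,ht,u)$ and inverse $(s,h^{-1},g)$. Let $\mathcal P^{\pi}(AG)\to G$ be the prolongation of the Lie algebroid $AG$ over $\pi$: its fibre at $g$ is $\{(v,X)\in A_{\pi(g)}G\times T_gG:\ T_{\epsilon(\pi(g))}\beta(v)=T_g\pi(X)\}$, its anchor is $(v,X)\mapsto X$, and the bracket of $(\sum_i a_i\,(X_i\circ\pi),V)$ and $(\sum_j c_j\,(Y_j\circ\pi),V')$ is $$\Big(\sum_{i,j}a_ic_j\,([X_i,Y_j]\circ\pi)+\sum_jV(c_j)\,(Y_j\circ\pi)-\sum_iV'(a_i)\,(X_i\circ\pi),\ [V,V']\Big).$$ **Theorem.** The sets $G_\beta\star G_\alpha$, $\mathcal P^\beta G$, $\mathcal P^\alpha G$ are embedded submanifolds of $G^3$, of dimension $3\dim G-2\dim M$ (when nonempty), and are Lie groupoids over $G$ with the structures above. Elements of $A_g(G_\beta\star G_\alpha)$ and $A_g(\mathcal P^\pi G)$ have the form $(0,X,Z)$ and $(0,v,X)$ respectively. The maps $$A_g(G_\beta\star G_\alpha)\to V_g\beta\oplus V_g\alpha,\ (0,X,Z)\mapsto(X,Z-X),\qquad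 A_g(\mathcal P^\pi G)\to\mathcal P^\pi_g(AG),\ (0,v,X)\mapsto(v,X)$$ are isomorphisms of Lie algebroids over the identity of $G$, where $V\beta\oplus V\alpha$ carries the anchor $(X,Y)\mapsto X+Y$ and the bracket transported from $A(G_\beta\star G_\alpha)$. Moreover: 1. The map $\Phi^\beta:G_\beta\star G_\alpha\to\mathcal P^\beta G$, $\Phi^\beta(g,h,s)=(g,h^{-1}s,s)$, is a Lie groupoid isomorphism over the identity of $G$. The induced map $A(\Phi^\beta)=T\Phi^\beta:A(G_\beta\star G_\alpha)\to A(\mathcal P^\beta G)$ is an isomorphism of Lie algebroids, and under the identifications above it is the Lie algebroid isomorphism $V\beta\oplus V\alpha\to\mathcal P^\beta(AG)$, $$A_g(\Phi^\beta)(X_g,Y_g)=\big((T_gl_{g^{-1}})(Y_g),\ X_g+Y_g\big).$$ 2. The map $\Phi^\alpha:G_\beta\star G_\alpha\to\mathcal P^\alpha G$, $\Phi^\alpha(g,h,s)=(g,gh^{-1},s)$, is a Lie groupoid isomorphism over the identity of $G$. The induced map $A(\Phi^\alpha)=T\Phi^\alpha:A(G_\beta\star G_\alpha)\to A(\mathcal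 P^\alpha G)$ is an isomorphism of Lie algebroids, and under the identifications above it is the Lie algebroid isomorphism $V\beta\oplus V\alpha\to\mathcal P^\alpha(AG)$, $$A_g(\Phi^\alpha)(X_g,Y_g)=\big(T_g(i\circ r_{g^{-1}})(X_g),\ X_g+Y_g\big).$$ -/

import Mathlib

open Set Module VectorField
open scoped Manifold ContDiff Topology

noncomputable section

/-! ### Groupoids and Lie groupoids -/

/-- A groupoid `G ⇉ M` over a set `M`: source `src`, target `tgt`, identity section `one`,
inversion `inv` and a multiplication `mul g h`, defined for the composable pairs, that is for
`tgt g = src h`. An element `g` is an arrow from `src g` to `tgt g`. -/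
structure SetGroupoid (M : Type*) (G : Type*) where
  src : G → M
  tgt : G → M
  one : M → G
  inv : G → G
  mul : ∀ g h : G, tgt g = src h → G
  src_one : ∀ x, src (one x) = x
  tgt_one : ∀ x, tgt (one x) = x
  src_inv : ∀ g, src (inv g) = tgt g
  tgt_inv : ∀ g, tgt (inv g) = src g
  src_mul : ∀ g h (c : tgt g = src h), src (mul g h c) = src g
  tgt_mul : ∀ g h (c : tgt g = src h), tgt (mul g h c) = tgt h
  mul_assoc : ∀ g h k (c : tgt g = src h) (d : tgt h = src k),
    mul (mul g h c) k ((tgt_mul g h c).trans d) = mul g (mul h k d) (c.trans (src_mul h k d).symm)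
  one_mul : ∀ g, mul (one (src g)) g (tgt_one _) = g
  mul_one : ∀ g, mul g (one (tgt g)) (src_one _).symm = g
  inv_mul : ∀ g, mul (inv g) g (tgt_inv g) = one (tgt g)
  mul_inv : ∀ g, mul g (inv g) (src_inv g).symm = one (src g)

namespace SetGroupoid

variable {M G H P : Type*}

open Classical in
/-- The multiplication as a function of two arbitrary arrows. Only its values on composable pairs
have a meaning, and only those are ever used. -/
def mulExt (𝒢 : SetGroupoid M G) (g h : G) : G :=
  if c : 𝒢.tgt g = 𝒢.src h then 𝒢.mul g h c else g

/-- The set `G₂` of composable pairs. -/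
def composable (𝒢 : SetGroupoid M G) : Set (G × G) := {p | 𝒢.tgt p.1 = 𝒢.src p.2}

section algebra

variable (𝒢 : SetGroupoid M G)

theorem mul_congr {g g' h h' : G} (hg : g = g') (hh : h = h') (c : 𝒢.tgt g = 𝒢.src h)
    (c' : 𝒢.tgt g' = 𝒢.src h') : 𝒢.mul g h c = 𝒢.mul g' h' c' := by
  subst hg; subst hh; rfl

theorem one_mul' {x : M} {g : G} (c : 𝒢.tgt (𝒢.one x) = 𝒢.src g) : 𝒢.mul (𝒢.one x) g c = g := by
  have hx : x = 𝒢.src g := by rw [← c, 𝒢.tgt_one]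
  subst hx
  exact 𝒢.one_mul g

theorem mul_one' {x : M} {g : G} (c : 𝒢.tgt g = 𝒢.src (𝒢.one x)) : 𝒢.mul g (𝒢.one x) c = g := by
  have hx : x = 𝒢.tgt g := by rw [c, 𝒢.src_one]
  subst hx
  exact 𝒢.mul_one g

theorem inv_mul_cancel_left {g h : G} (c : 𝒢.tgt g = 𝒢.src h)
    (d : 𝒢.tgt (𝒢.inv g) = 𝒢.src (𝒢.mul g h c)) : 𝒢.mul (𝒢.inv g) (𝒢.mul g h c) d = h := by
  rw [← 𝒢.mul_assoc (𝒢.inv g) g h (𝒢.tgt_inv g) c]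
  rw [𝒢.mul_congr (𝒢.inv_mul g) rfl _ ((𝒢.tgt_one _).trans c)]
  exact 𝒢.one_mul' _

theorem mul_inv_cancel_left {g h : G} (c : 𝒢.tgt (𝒢.inv g) = 𝒢.src h)
    (d : 𝒢.tgt g = 𝒢.src (𝒢.mul (𝒢.inv g) h c)) : 𝒢.mul g (𝒢.mul (𝒢.inv g) h c) d = h := by
  rw [← 𝒢.mul_assoc g (𝒢.inv g) h (𝒢.src_inv g).symm c]
  rw [𝒢.mul_congr (𝒢.mul_inv g) rfl _ ((𝒢.tgt_one _).trans ((𝒢.tgt_inv g).symm.trans c))]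
  exact 𝒢.one_mul' _

theorem mul_assoc_four {a b c w : G} (h1 : 𝒢.tgt c = 𝒢.src w)
    (h2 : 𝒢.tgt b = 𝒢.src (𝒢.mul c w h1)) (h3 : 𝒢.tgt a = 𝒢.src (𝒢.mul b (𝒢.mul c w h1) h2))
    (h4 : 𝒢.tgt b = 𝒢.src c) (h5 : 𝒢.tgt a = 𝒢.src (𝒢.mul b c h4))
    (h6 : 𝒢.tgt (𝒢.mul a (𝒢.mul b c h4) h5) = 𝒢.src w) :
    𝒢.mul a (𝒢.mul b (𝒢.mul c w h1) h2) h3 = 𝒢.mul (𝒢.mul a (𝒢.mul b c h4) h5) w h6 := by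
  rw [𝒢.mul_assoc a (𝒢.mul b c h4) w h5 ((𝒢.tgt_mul _ _ _).trans h1)]
  exact 𝒢.mul_congr rfl (𝒢.mul_assoc b c w h4 h1).symm _ _

end algebra

section smooth

variable (EM EG EH : Type*) [NormedAddCommGroup EM] [NormedSpace ℝ EM]
  [NormedAddCommGroup EG] [NormedSpace ℝ EG] [NormedAddCommGroup EH] [NormedSpace ℝ EH]
  [TopologicalSpace M] [ChartedSpace EM M] [TopologicalSpace G] [ChartedSpace EG G]
  [TopologicalSpace H] [ChartedSpace EH H]

/-- A groupoid whose arrows and objects form manifolds (modelled on `EG` and `EM`) is a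
*Lie groupoid* if all structural maps are smooth and source and target are submersions.
The multiplication is smooth on the embedded submanifold `G₂` of `G × G`. -/
structure IsLieGroupoid (𝒢 : SetGroupoid M G) : Prop where
  isSubmersion_src : Manifold.IsSubmersion 𝓘(ℝ, EG) 𝓘(ℝ, EM) ∞ 𝒢.src
  isSubmersion_tgt : Manifold.IsSubmersion 𝓘(ℝ, EG) 𝓘(ℝ, EM) ∞ 𝒢.tgt
  contMDiff_one : ContMDiff 𝓘(ℝ, EM) 𝓘(ℝ, EG) ∞ 𝒢.one
  contMDiff_inv : ContMDiff 𝓘(ℝ, EG) 𝓘(ℝ, EG) ∞ 𝒢.inv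
  contMDiffOn_mul : ContMDiffOn (𝓘(ℝ, EG).prod 𝓘(ℝ, EG)) 𝓘(ℝ, EG) ∞
    (fun p : G × G => 𝒢.mulExt p.1 p.2) 𝒢.composable

/-- `Φ : G → H` is an isomorphism of Lie groupoids over the identity of the common base `M`:
a diffeomorphism that is compatible with all structural maps. -/
structure IsLieGroupoidIso (𝒢 : SetGroupoid M G) (ℋ : SetGroupoid M H) (Φ : G → H) : Prop where
  source : 𝒢.IsLieGroupoid EM EG
  target : ℋ.IsLieGroupoid EM EH
  diffeo : ∃ e : Diffeomorph 𝓘(ℝ, EG) 𝓘(ℝ, EH) G H ∞, ⇑e = Φ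
  src_map : ∀ g, ℋ.src (Φ g) = 𝒢.src g
  tgt_map : ∀ g, ℋ.tgt (Φ g) = 𝒢.tgt g
  one_map : ∀ x, Φ (𝒢.one x) = ℋ.one x
  inv_map : ∀ g, Φ (𝒢.inv g) = ℋ.inv (Φ g)
  mul_map : ∀ g h (c : 𝒢.tgt g = 𝒢.src h),
    ∃ c' : ℋ.tgt (Φ g) = ℋ.src (Φ h), Φ (𝒢.mul g h c) = ℋ.mul (Φ g) (Φ h) c'

end smooth

/-! ### The groupoid `G_β ⋆ G_α` and the prolongations of a groupoid -/

/-- The set `{(g, h, s) | β g = β h, α h = α s}`. -/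
def starSet (𝒢 : SetGroupoid M G) : Set (G × G × G) :=
  {p | 𝒢.tgt p.1 = 𝒢.tgt p.2.1 ∧ 𝒢.src p.2.1 = 𝒢.src p.2.2}

/-- The groupoid `G_β ⋆ G_α ⇉ G`, with the multiplication
`(g, h, s) (s, h', s') = (g, h' s⁻¹ h, s')` and the inversion `(g, h, s)⁻¹ = (s, g h⁻¹ s, g)`. -/
def star (𝒢 : SetGroupoid M G) : SetGroupoid G 𝒢.starSet where
  src p := p.1.1
  tgt p := p.1.2.2
  one g := ⟨(g, g, g), rfl, rfl⟩
  inv p := ⟨(p.1.2.2,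
      𝒢.mul p.1.1 (𝒢.mul (𝒢.inv p.1.2.1) p.1.2.2 ((𝒢.tgt_inv _).trans p.2.2))
        (by rw [𝒢.src_mul, 𝒢.src_inv]; exact p.2.1), p.1.1), by
      constructor <;> simp [𝒢.tgt_mul, 𝒢.src_mul]⟩
  mul p q c := ⟨(p.1.1,
      𝒢.mul q.1.2.1 (𝒢.mul (𝒢.inv p.1.2.2) p.1.2.1 ((𝒢.tgt_inv _).trans p.2.2.symm))
        (by rw [𝒢.src_mul, 𝒢.src_inv, c]; exact q.2.1.symm), q.1.2.2), by
      constructor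
      · simpa [𝒢.tgt_mul] using p.2.1
      · simpa [𝒢.src_mul] using q.2.2⟩
  src_one _ := rfl
  tgt_one _ := rfl
  src_inv _ := rfl
  tgt_inv _ := rfl
  src_mul _ _ _ := rfl
  tgt_mul _ _ _ := rfl
  mul_assoc p q r c d := Subtype.ext (Prod.ext rfl (Prod.ext
    (𝒢.mul_assoc_four (a := r.1.2.1) (b := 𝒢.inv q.1.2.2) (c := q.1.2.1)
      (w := 𝒢.mul (𝒢.inv p.1.2.2) p.1.2.1 ((𝒢.tgt_inv _).trans p.2.2.symm)) _ _ _ _ _ _) rfl))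
  one_mul := by
    rintro ⟨⟨g, h, s⟩, h1, h2⟩
    apply Subtype.ext
    refine Prod.ext rfl (Prod.ext ?_ rfl)
    dsimp only at h1 h2 ⊢
    rw [𝒢.mul_congr rfl (𝒢.inv_mul g) _ (h1.symm.trans (𝒢.src_one _).symm)]
    exact 𝒢.mul_one' _
  mul_one := by
    rintro ⟨⟨g, h, s⟩, h1, h2⟩
    apply Subtype.ext
    refine Prod.ext rfl (Prod.ext ?_ rfl)
    dsimp only at h1 h2 ⊢
    exact 𝒢.mul_inv_cancel_left _ _
  inv_mul := by
    rintro ⟨⟨g, h, s⟩, h1, h2⟩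
    apply Subtype.ext
    refine Prod.ext rfl (Prod.ext ?_ rfl)
    dsimp only at h1 h2 ⊢
    have e := 𝒢.inv_mul_cancel_left (g := g)
      (h := 𝒢.mul (𝒢.inv h) s ((𝒢.tgt_inv _).trans h2))
      (by rw [𝒢.src_mul, 𝒢.src_inv]; exact h1)
      (by rw [𝒢.tgt_inv, 𝒢.src_mul])
    rw [𝒢.mul_congr rfl e _ (by rw [𝒢.src_mul, 𝒢.src_inv])]
    exact 𝒢.mul_inv_cancel_left _ _
  mul_inv := by
    rintro ⟨⟨g, h, s⟩, h1, h2⟩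
    apply Subtype.ext
    refine Prod.ext rfl (Prod.ext ?_ rfl)
    dsimp only at h1 h2 ⊢
    rw [𝒢.mul_assoc g _ _ (by rw [𝒢.src_mul, 𝒢.src_inv]; exact h1)
      (by rw [𝒢.tgt_mul, 𝒢.src_mul, 𝒢.src_inv])]
    rw [𝒢.mul_congr rfl (g' := g) (h' := 𝒢.one (𝒢.tgt h)) _ _ (by rw [𝒢.src_one]; exact h1)]
    · exact 𝒢.mul_one' _
    · rw [𝒢.mul_assoc (𝒢.inv h) s _ ((𝒢.tgt_inv _).trans h2)
        (by rw [𝒢.src_mul, 𝒢.src_inv])]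
      rw [𝒢.mul_congr rfl (𝒢.mul_inv_cancel_left _ _) _ (𝒢.tgt_inv h)]
      exact 𝒢.inv_mul h

/-- The set `{(p, g, p') ∈ P × G × P | π p = α g, β g = π p'}`. -/
def prolongationSet (𝒢 : SetGroupoid M G) (π : P → M) : Set (P × G × P) :=
  {q | π q.1 = 𝒢.src q.2.1 ∧ 𝒢.tgt q.2.1 = π q.2.2}

/-- The prolongation of the groupoid `G ⇉ M` over a map `π : P → M`, a groupoid over `P`. -/
def prolongation (𝒢 : SetGroupoid M G) (π : P → M) : SetGroupoid P (𝒢.prolongationSet π) where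
  src q := q.1.1
  tgt q := q.1.2.2
  one p := ⟨(p, 𝒢.one (π p), p), (𝒢.src_one _).symm, 𝒢.tgt_one _⟩
  inv q := ⟨(q.1.2.2, 𝒢.inv q.1.2.1, q.1.1),
    (q.2.2.symm.trans (𝒢.src_inv _).symm), (𝒢.tgt_inv _).trans q.2.1.symm⟩
  mul q r c := ⟨(q.1.1, 𝒢.mul q.1.2.1 r.1.2.1 (by rw [q.2.2, c, r.2.1]), r.1.2.2),
    q.2.1.trans (𝒢.src_mul _ _ _).symm, (𝒢.tgt_mul _ _ _).trans r.2.2⟩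
  src_one _ := rfl
  tgt_one _ := rfl
  src_inv _ := rfl
  tgt_inv _ := rfl
  src_mul _ _ _ := rfl
  tgt_mul _ _ _ := rfl
  mul_assoc _ _ _ _ _ := Subtype.ext (Prod.ext rfl (Prod.ext (𝒢.mul_assoc _ _ _ _ _) rfl))
  one_mul _ := Subtype.ext (Prod.ext rfl (Prod.ext (𝒢.one_mul' _) rfl))
  mul_one _ := Subtype.ext (Prod.ext rfl (Prod.ext (𝒢.mul_one' _) rfl))
  inv_mul q := Subtype.ext (Prod.ext rfl (Prod.ext
    ((𝒢.inv_mul _).trans (congrArg 𝒢.one q.2.2)) rfl))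
  mul_inv q := Subtype.ext (Prod.ext rfl (Prod.ext
    ((𝒢.mul_inv _).trans (congrArg 𝒢.one q.2.1.symm)) rfl))

/-- `Φ^β : G_β ⋆ G_α → P^β G`, `(g, h, s) ↦ (g, h⁻¹ s, s)`. -/
def Phiβ (𝒢 : SetGroupoid M G) (p : 𝒢.starSet) : 𝒢.prolongationSet 𝒢.tgt :=
  ⟨(p.1.1, 𝒢.mul (𝒢.inv p.1.2.1) p.1.2.2 ((𝒢.tgt_inv _).trans p.2.2), p.1.2.2),
    by rw [𝒢.src_mul, 𝒢.src_inv]; exact p.2.1, 𝒢.tgt_mul _ _ _⟩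

/-- `Φ^α : G_β ⋆ G_α → P^α G`, `(g, h, s) ↦ (g, g h⁻¹, s)`. -/
def Phiα (𝒢 : SetGroupoid M G) (p : 𝒢.starSet) : 𝒢.prolongationSet 𝒢.src :=
  ⟨(p.1.1, 𝒢.mul p.1.1 (𝒢.inv p.1.2.1) (p.2.1.trans (𝒢.src_inv _).symm), p.1.2.2),
    (𝒢.src_mul _ _ _).symm, by rw [𝒢.tgt_mul, 𝒢.tgt_inv]; exact p.2.2⟩

end SetGroupoid

/-! ### Lie algebroids -/

/-- The data of a Lie algebroid over a manifold `N` modelled on `E`: a family `fib x ⊆ Amb x` of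
vector spaces (each given inside an ambient vector space), the notion of a section that is smooth
on a set, an anchor and a bracket. An arbitrary section is a function with values in `Amb`; the
anchor and the bracket are only relevant on `fib` and on smooth sections of `fib`.
The axioms are in `AlgebroidData.IsLieAlgebroid`. -/
structure AlgebroidData.{w} (E : Type*) [NormedAddCommGroup E] [NormedSpace ℝ E]
    (N : Type*) [TopologicalSpace N] [ChartedSpace E N] where
  Amb : N → Type w
  [addCommGroup : ∀ x, AddCommGroup (Amb x)]
  [module : ∀ x, Module ℝ (Amb x)]
  fib : ∀ x, Submodule ℝ (Amb x)
  Smooth : Set N → (∀ x, Amb x) → Prop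
  anchor : ∀ x, Amb x →ₗ[ℝ] TangentSpace 𝓘(ℝ, E) x
  bracket : (∀ x, Amb x) → (∀ x, Amb x) → ∀ x, Amb x

namespace AlgebroidData

attribute [instance] AlgebroidData.addCommGroup AlgebroidData.module

variable {E : Type*} [NormedAddCommGroup E] [NormedSpace ℝ E]
  {N : Type*} [TopologicalSpace N] [ChartedSpace E N]

/-- The derivative of a real function `f` at `x` in the direction of the tangent vector `v`. -/
def dirDeriv (f : N → ℝ) (x : N) (v : TangentSpace 𝓘(ℝ, E) x) : ℝ :=
  mfderiv 𝓘(ℝ, E) 𝓘(ℝ, ℝ) f x v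

/-- `X` is a smooth section over `U` of the bundle with fibres `fib x`. -/
def IsSection (𝒜 : AlgebroidData E N) (U : Set N) (X : ∀ x, 𝒜.Amb x) : Prop :=
  𝒜.Smooth U X ∧ ∀ x ∈ U, X x ∈ 𝒜.fib x

/-- The axioms of a Lie algebroid `(A, ⟦·,·⟧, ρ)` over `N`, in terms of the smooth sections over
the open sets of `N` (the global sections are those over `Set.univ`). The first three say that the
spaces `fib x` form a smooth vector bundle: being a smooth section is a local property, and
there are local frames with respect to which the smooth sections are those with smooth
coefficients. The others say that the anchor is a smooth bundle map to the tangent bundle, that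
the bracket is a Lie bracket on sections (`bracket_congr`: it commutes with restriction to open
sets), and that the Leibniz rule `⟦X, f Y⟧ = f ⟦X, Y⟧ + ρ(X)(f) Y` holds. -/
structure IsLieAlgebroid [IsManifold 𝓘(ℝ, E) ∞ N] (𝒜 : AlgebroidData E N) : Prop where
  mono : ∀ (U V : Set N) (X : ∀ x, 𝒜.Amb x), IsOpen U → IsOpen V → V ⊆ U →
    𝒜.IsSection U X → 𝒜.IsSection V X
  glue : ∀ (U : Set N) (X : ∀ x, 𝒜.Amb x), IsOpen U →
    (∀ x ∈ U, ∃ V, IsOpen V ∧ x ∈ V ∧ 𝒜.IsSection V X) → 𝒜.IsSection U X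
  frame : ∀ x₀ : N, ∃ (U : Set N) (k : ℕ) (e : Fin k → ∀ x, 𝒜.Amb x),
    IsOpen U ∧ x₀ ∈ U ∧ (∀ i, 𝒜.IsSection U (e i)) ∧
    (∀ x ∈ U, LinearIndependent ℝ (fun i => e i x) ∧
      Submodule.span ℝ (Set.range fun i => e i x) = 𝒜.fib x) ∧
    ∀ (V : Set N) (X : ∀ x, 𝒜.Amb x), IsOpen V → V ⊆ U → (∀ x ∈ V, X x ∈ 𝒜.fib x) →
      (𝒜.Smooth V X ↔ ∃ c : Fin k → N → ℝ, (∀ i, ContMDiffOn 𝓘(ℝ, E) 𝓘(ℝ, ℝ) ∞ (c i) V) ∧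
        ∀ x ∈ V, X x = ∑ i, c i x • e i x)
  anchor_smooth : ∀ (U : Set N) (X : ∀ x, 𝒜.Amb x), IsOpen U → 𝒜.IsSection U X →
    ContMDiffOn 𝓘(ℝ, E) 𝓘(ℝ, E).tangent ∞
      (fun x => (⟨x, 𝒜.anchor x (X x)⟩ : TangentBundle 𝓘(ℝ, E) N)) U
  bracket_section : ∀ (U : Set N) (X Y : ∀ x, 𝒜.Amb x), IsOpen U →
    𝒜.IsSection U X → 𝒜.IsSection U Y → 𝒜.IsSection U (𝒜.bracket X Y)
  bracket_congr : ∀ (U : Set N) (X X' Y Y' : ∀ x, 𝒜.Amb x), IsOpen U →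
    𝒜.IsSection U X → 𝒜.IsSection U X' → 𝒜.IsSection U Y → 𝒜.IsSection U Y' →
    (∀ x ∈ U, X x = X' x) → (∀ x ∈ U, Y x = Y' x) →
    ∀ x ∈ U, 𝒜.bracket X Y x = 𝒜.bracket X' Y' x
  bracket_add : ∀ (U : Set N) (X Y Z : ∀ x, 𝒜.Amb x), IsOpen U →
    𝒜.IsSection U X → 𝒜.IsSection U Y → 𝒜.IsSection U Z →
    ∀ x ∈ U, 𝒜.bracket X (fun y => Y y + Z y) x = 𝒜.bracket X Y x + 𝒜.bracket X Z x
  bracket_antisymm : ∀ (U : Set N) (X Y : ∀ x, 𝒜.Amb x), IsOpen U →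
    𝒜.IsSection U X → 𝒜.IsSection U Y → ∀ x ∈ U, 𝒜.bracket X Y x = -𝒜.bracket Y X x
  bracket_jacobi : ∀ (U : Set N) (X Y Z : ∀ x, 𝒜.Amb x), IsOpen U →
    𝒜.IsSection U X → 𝒜.IsSection U Y → 𝒜.IsSection U Z → ∀ x ∈ U,
    𝒜.bracket X (𝒜.bracket Y Z) x + 𝒜.bracket Y (𝒜.bracket Z X) x
      + 𝒜.bracket Z (𝒜.bracket X Y) x = 0
  leibniz : ∀ (U : Set N) (X Y : ∀ x, 𝒜.Amb x) (f : N → ℝ), IsOpen U →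
    𝒜.IsSection U X → 𝒜.IsSection U Y → ContMDiffOn 𝓘(ℝ, E) 𝓘(ℝ, ℝ) ∞ f U → ∀ x ∈ U,
    𝒜.bracket X (fun y => f y • Y y) x = f x • 𝒜.bracket X Y x
      + dirDeriv f x (𝒜.anchor x (X x)) • Y x

/-- The fibrewise linear maps `F x` form an isomorphism of Lie algebroids `𝒜 → ℬ` over the identity
of `N`: an isomorphism of smooth vector bundles compatible with anchors and brackets. -/
structure IsLieAlgebroidIso [IsManifold 𝓘(ℝ, E) ∞ N] (𝒜 ℬ : AlgebroidData E N)
    (F : ∀ x, 𝒜.Amb x →ₗ[ℝ] ℬ.Amb x) : Prop where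
  source : 𝒜.IsLieAlgebroid
  target : ℬ.IsLieAlgebroid
  bijOn : ∀ x, Set.BijOn (F x) (𝒜.fib x) (ℬ.fib x)
  smooth_iff : ∀ (U : Set N) (X : ∀ x, 𝒜.Amb x), IsOpen U → (∀ x ∈ U, X x ∈ 𝒜.fib x) →
    (𝒜.Smooth U X ↔ ℬ.Smooth U (fun x => F x (X x)))
  anchor_map : ∀ x, ∀ v ∈ 𝒜.fib x, ℬ.anchor x (F x v) = 𝒜.anchor x v
  bracket_map : ∀ (U : Set N) (X Y : ∀ x, 𝒜.Amb x), IsOpen U →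
    𝒜.IsSection U X → 𝒜.IsSection U Y → ∀ x ∈ U,
    F x (𝒜.bracket X Y x) = ℬ.bracket (fun y => F y (X y)) (fun y => F y (Y y)) x

/-! ### The prolongation of a Lie algebroid over a fibration -/

section prolongation

variable {EP : Type*} [NormedAddCommGroup EP] [NormedSpace ℝ EP]
  {P : Type*} [TopologicalSpace P] [ChartedSpace EP P]

/-- On the open set `U ⊆ P`, the section `σ` of the pull-back bundle `π^* A` is written as
`σ = ∑ i, a i • (X i ∘ π)`, with smooth functions `a i` on `U` and smooth sections `X i` of `A` over
an open set `O ⊇ π(U)`. -/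
def IsPullbackDecomposition (𝒜 : AlgebroidData E N) (π : P → N) (EP : Type*)
    [NormedAddCommGroup EP] [NormedSpace ℝ EP] [ChartedSpace EP P]
    (U : Set P) (O : Set N) {k : ℕ} (a : Fin k → P → ℝ) (X : Fin k → ∀ x, 𝒜.Amb x)
    (σ : ∀ p, 𝒜.Amb (π p)) : Prop :=
  IsOpen U ∧ IsOpen O ∧ (∀ q ∈ U, π q ∈ O) ∧
  (∀ i, ContMDiffOn 𝓘(ℝ, EP) 𝓘(ℝ, ℝ) ∞ (a i) U) ∧ (∀ i, 𝒜.IsSection O (X i)) ∧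
  ∀ q ∈ U, σ q = ∑ i, a i q • X i (π q)

/-- `b` is the `A`-component at `p` of the bracket of the sections `Z` and `W` of the prolongation:
if `Z = (∑ i, a i • (X i ∘ π), V)` and `W = (∑ j, c j • (Y j ∘ π), V')` near `p`, then
`b = ∑ i j, a i * c j • ⟦X i, Y j⟧ ∘ π + ∑ j, V(c j) • Y j ∘ π - ∑ i, V'(a i) • X i ∘ π` at `p`. -/
def IsProlongationBracketAt (𝒜 : AlgebroidData E N) (π : P → N)
    (Z W : ∀ p, 𝒜.Amb (π p) × TangentSpace 𝓘(ℝ, EP) p) (p : P) (b : 𝒜.Amb (π p)) : Prop :=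
  ∃ (U : Set P) (O : Set N) (k l : ℕ) (a : Fin k → P → ℝ) (X : Fin k → ∀ x, 𝒜.Amb x)
    (c : Fin l → P → ℝ) (Y : Fin l → ∀ x, 𝒜.Amb x), p ∈ U ∧
    𝒜.IsPullbackDecomposition π EP U O a X (fun q => (Z q).1) ∧
    𝒜.IsPullbackDecomposition π EP U O c Y (fun q => (W q).1) ∧
    b = ∑ i, ∑ j, (a i p * c j p) • 𝒜.bracket (X i) (Y j) (π p)
      + ∑ j, dirDeriv (c j) p (Z p).2 • Y j (π p)
      - ∑ i, dirDeriv (a i) p (W p).2 • X i (π p)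

open Classical in
/-- The prolongation `P^π A` of a Lie algebroid `A` over `π : P → N`: its fibre at `p` consists of
the pairs `(a, v)` with `a ∈ A_{π p}`, `v ∈ T_p P` and `ρ a = T_p π v`; the anchor is `(a, v) ↦ v`,
and the bracket is `IsProlongationBracketAt` in the first component (which for smooth sections
determines the value uniquely) and the bracket of vector fields in the second one. -/
def prolongation [IsManifold 𝓘(ℝ, EP) ∞ P] (𝒜 : AlgebroidData E N) (π : P → N) :
    AlgebroidData EP P where
  Amb p := 𝒜.Amb (π p) × TangentSpace 𝓘(ℝ, EP) p
  fib p := {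
    carrier := {z | z.1 ∈ 𝒜.fib (π p) ∧
      𝒜.anchor (π p) z.1 = mfderiv 𝓘(ℝ, EP) 𝓘(ℝ, E) π p z.2}
    add_mem' := fun hz hw => ⟨add_mem hz.1 hw.1, by
      simp only [Prod.fst_add, Prod.snd_add, map_add, hz.2, hw.2]⟩
    zero_mem' := ⟨zero_mem _, by simp⟩
    smul_mem' := fun c _ hz => ⟨Submodule.smul_mem _ c hz.1, by
      simp only [Prod.smul_fst, Prod.smul_snd, map_smul, hz.2]⟩ }
  Smooth U Z :=
    (∀ p ∈ U, ∃ (V : Set P) (O : Set N) (k : ℕ) (a : Fin k → P → ℝ) (X : Fin k → ∀ x, 𝒜.Amb x),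
      p ∈ V ∧ 𝒜.IsPullbackDecomposition π EP V O a X (fun q => (Z q).1)) ∧
    ContMDiffOn 𝓘(ℝ, EP) 𝓘(ℝ, EP).tangent ∞
      (fun q => (⟨q, (Z q).2⟩ : TangentBundle 𝓘(ℝ, EP) P)) U
  anchor _ := LinearMap.snd ℝ _ _
  bracket Z W p :=
    (if h : ∃ b, 𝒜.IsProlongationBracketAt π Z W p b then h.choose else 0,
      mlieBracket 𝓘(ℝ, EP) (fun q => (Z q).2) (fun q => (W q).2) p)

end prolongation

end AlgebroidData

/-! ### The Lie algebroid of a Lie groupoid -/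

namespace SetGroupoid

section lieAlgebroid

variable {M G H P : Type*} (EM EG EH EP : Type*) [NormedAddCommGroup EM] [NormedSpace ℝ EM]
  [NormedAddCommGroup EG] [NormedSpace ℝ EG] [NormedAddCommGroup EH] [NormedSpace ℝ EH]
  [NormedAddCommGroup EP] [NormedSpace ℝ EP]
  [TopologicalSpace M] [ChartedSpace EM M] [TopologicalSpace G] [ChartedSpace EG G]
  [TopologicalSpace H] [ChartedSpace EH H] [TopologicalSpace P] [ChartedSpace EP P]

/-- The derivative at `h` of the left translation `l_g : α⁻¹(β g) → α⁻¹(α g)`, `k ↦ g k`, where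
`α h = β g`. It is the derivative within the fibre `α⁻¹(α h)`, so it is meaningful (and does not
depend on choices) on the tangent space `Ker (T_h α)` of the fibre, where it is used. -/
def leftDeriv (𝒢 : SetGroupoid M G) (g h : G) :
    TangentSpace 𝓘(ℝ, EG) h →L[ℝ] TangentSpace 𝓘(ℝ, EG) (𝒢.mulExt g h) :=
  mfderivWithin 𝓘(ℝ, EG) 𝓘(ℝ, EG) (fun k => 𝒢.mulExt g k) (𝒢.src ⁻¹' {𝒢.src h}) h

/-- The left-invariant vector field `g ↦ (T_{ε(β g)} l_g) (X (β g))` of a section `X` of `AG`. -/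
def leftField (𝒢 : SetGroupoid M G) (X : ∀ x, TangentSpace 𝓘(ℝ, EG) (𝒢.one x)) (g : G) :
    TangentSpace 𝓘(ℝ, EG) g :=
  𝒢.leftDeriv EG g (𝒢.one (𝒢.tgt g)) (X (𝒢.tgt g))

/-- The Lie algebroid `AG` of a Lie groupoid `G ⇉ M`: the fibre at `x` is `Ker (T_{ε x} α)`, the
anchor is `T_{ε x} β`, and the bracket is the one of the left-invariant vector fields. -/
def lieAlgebroid [IsManifold 𝓘(ℝ, EG) ∞ G] (𝒢 : SetGroupoid M G) : AlgebroidData EM M where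
  Amb x := TangentSpace 𝓘(ℝ, EG) (𝒢.one x)
  fib x := LinearMap.ker (mfderiv 𝓘(ℝ, EG) 𝓘(ℝ, EM) 𝒢.src (𝒢.one x)).toLinearMap
  Smooth U X := ContMDiffOn 𝓘(ℝ, EM) 𝓘(ℝ, EG).tangent ∞
    (fun x => (⟨𝒢.one x, X x⟩ : TangentBundle 𝓘(ℝ, EG) G)) U
  anchor x := (mfderiv 𝓘(ℝ, EG) 𝓘(ℝ, EM) 𝒢.tgt (𝒢.one x)).toLinearMap
  bracket X Y x := mlieBracket 𝓘(ℝ, EG) (𝒢.leftField EG X) (𝒢.leftField EG Y) (𝒢.one x)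

/-- The map `A_x(Φ) = T_{ε x} Φ` that a morphism `Φ` over the identity of `M` induces on
the Lie algebroids (so `Φ (ε x)` is the identity at `x` of the second groupoid). -/
def algebroidMap (𝒢 : SetGroupoid M G) (ℋ : SetGroupoid M H) (Φ : G → H) (x : M) :
    TangentSpace 𝓘(ℝ, EG) (𝒢.one x) →ₗ[ℝ] TangentSpace 𝓘(ℝ, EH) (ℋ.one x) :=
  (mfderiv 𝓘(ℝ, EG) 𝓘(ℝ, EH) Φ (𝒢.one x)).toLinearMap

end lieAlgebroid

/-! ### The identifications of the Lie algebroids -/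

section identifications

variable {M G P : Type*} (EM EG EP F : Type*) [NormedAddCommGroup EM] [NormedSpace ℝ EM]
  [NormedAddCommGroup EG] [NormedSpace ℝ EG] [NormedAddCommGroup EP] [NormedSpace ℝ EP]
  [NormedAddCommGroup F] [NormedSpace ℝ F]
  [TopologicalSpace M] [ChartedSpace EM M] [TopologicalSpace G] [ChartedSpace EG G]
  [TopologicalSpace P] [ChartedSpace EP P]

/-- The identification `A_g(G_β ⋆ G_α) ≅ V_g β ⊕ V_g α`. With the elements of the left side written
as `(0, X, Z) ∈ T_g G × T_g G × T_g G`, it is `(0, X, Z) ↦ (X, Z - X)`. -/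
def starIdent (𝒢 : SetGroupoid M G) [ChartedSpace F 𝒢.starSet] (g : G) :
    TangentSpace 𝓘(ℝ, F) (𝒢.star.one g) →ₗ[ℝ]
      TangentSpace 𝓘(ℝ, EG) g × TangentSpace 𝓘(ℝ, EG) g :=
  let dh : TangentSpace 𝓘(ℝ, F) (𝒢.star.one g) →L[ℝ] TangentSpace 𝓘(ℝ, EG) g :=
    mfderiv 𝓘(ℝ, F) 𝓘(ℝ, EG) (fun p : 𝒢.starSet => p.1.2.1) (𝒢.star.one g)
  let ds : TangentSpace 𝓘(ℝ, F) (𝒢.star.one g) →L[ℝ] TangentSpace 𝓘(ℝ, EG) g :=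
    mfderiv 𝓘(ℝ, F) 𝓘(ℝ, EG) (fun p : 𝒢.starSet => p.1.2.2) (𝒢.star.one g)
  dh.toLinearMap.prod (ds.toLinearMap - dh.toLinearMap)

/-- The vector bundle `Vβ ⊕ Vα → G` of pairs of tangent vectors to the fibres of `β` and `α`, with
the anchor `(X, Y) ↦ X + Y` and the bracket of `A(G_β ⋆ G_α)`, transported by `starIdent`. -/
def verticalSum [IsManifold 𝓘(ℝ, EG) ∞ G] (𝒢 : SetGroupoid M G) [ChartedSpace F 𝒢.starSet]
    [IsManifold 𝓘(ℝ, F) ∞ 𝒢.starSet] : AlgebroidData EG G where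
  Amb g := TangentSpace 𝓘(ℝ, EG) g × TangentSpace 𝓘(ℝ, EG) g
  fib g := (LinearMap.ker (mfderiv 𝓘(ℝ, EG) 𝓘(ℝ, EM) 𝒢.tgt g).toLinearMap).prod
    (LinearMap.ker (mfderiv 𝓘(ℝ, EG) 𝓘(ℝ, EM) 𝒢.src g).toLinearMap)
  Smooth U Z :=
    ContMDiffOn 𝓘(ℝ, EG) 𝓘(ℝ, EG).tangent ∞
      (fun g => (⟨g, (Z g).1⟩ : TangentBundle 𝓘(ℝ, EG) G)) U ∧
    ContMDiffOn 𝓘(ℝ, EG) 𝓘(ℝ, EG).tangent ∞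
      (fun g => (⟨g, (Z g).2⟩ : TangentBundle 𝓘(ℝ, EG) G)) U
  anchor _ := LinearMap.fst ℝ _ _ + LinearMap.snd ℝ _ _
  bracket Z W g :=
    let lift (Z : ∀ g : G, TangentSpace 𝓘(ℝ, EG) g × TangentSpace 𝓘(ℝ, EG) g) (k : G) :
        TangentSpace 𝓘(ℝ, F) (𝒢.star.one k) :=
      Function.invFunOn (𝒢.starIdent EG F k) {v | v ∈ (𝒢.star.lieAlgebroid EG F).fib k} (Z k)
    𝒢.starIdent EG F g ((𝒢.star.lieAlgebroid EG F).bracket (lift Z) (lift W) g)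

/-- The identification `A_p(P^π G) ≅ P^π_p(AG)`. With the elements of the left side written as
`(0, v, X) ∈ T_p P × A_{π p} G × T_p P`, it is `(0, v, X) ↦ (v, X)`. -/
def prolongationIdent (𝒢 : SetGroupoid M G) (π : P → M) [ChartedSpace F (𝒢.prolongationSet π)]
    (p : P) :
    TangentSpace 𝓘(ℝ, F) ((𝒢.prolongation π).one p) →ₗ[ℝ]
      TangentSpace 𝓘(ℝ, EG) (𝒢.one (π p)) × TangentSpace 𝓘(ℝ, EP) p :=
  let dg : TangentSpace 𝓘(ℝ, F) ((𝒢.prolongation π).one p) →L[ℝ]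
      TangentSpace 𝓘(ℝ, EG) (𝒢.one (π p)) :=
    mfderiv 𝓘(ℝ, F) 𝓘(ℝ, EG) (fun q : 𝒢.prolongationSet π => q.1.2.1) ((𝒢.prolongation π).one p)
  let dp : TangentSpace 𝓘(ℝ, F) ((𝒢.prolongation π).one p) →L[ℝ] TangentSpace 𝓘(ℝ, EP) p :=
    mfderiv 𝓘(ℝ, F) 𝓘(ℝ, EP) (fun q : 𝒢.prolongationSet π => q.1.2.2) ((𝒢.prolongation π).one p)
  dg.toLinearMap.prod dp.toLinearMap

/-- `(X, Y) ↦ ((T_g l_{g⁻¹}) Y, X + Y)`. -/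
def formulaβ (𝒢 : SetGroupoid M G) (g : G) :
    TangentSpace 𝓘(ℝ, EG) g × TangentSpace 𝓘(ℝ, EG) g →ₗ[ℝ]
      TangentSpace 𝓘(ℝ, EG) (𝒢.one (𝒢.tgt g)) × TangentSpace 𝓘(ℝ, EG) g :=
  let dl : TangentSpace 𝓘(ℝ, EG) g →L[ℝ] TangentSpace 𝓘(ℝ, EG) (𝒢.one (𝒢.tgt g)) :=
    𝒢.leftDeriv EG (𝒢.inv g) g
  (dl.toLinearMap ∘ₗ LinearMap.snd ℝ _ _).prod (LinearMap.fst ℝ _ _ + LinearMap.snd ℝ _ _)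

/-- `(X, Y) ↦ ((T_g (i ∘ r_{g⁻¹})) X, X + Y)`, where `r_{g⁻¹} : k ↦ k g⁻¹` is defined on the fibre
`β⁻¹(β g)` and is differentiated along this fibre. -/
def formulaα (𝒢 : SetGroupoid M G) (g : G) :
    TangentSpace 𝓘(ℝ, EG) g × TangentSpace 𝓘(ℝ, EG) g →ₗ[ℝ]
      TangentSpace 𝓘(ℝ, EG) (𝒢.one (𝒢.src g)) × TangentSpace 𝓘(ℝ, EG) g :=
  let dr : TangentSpace 𝓘(ℝ, EG) g →L[ℝ] TangentSpace 𝓘(ℝ, EG) (𝒢.one (𝒢.src g)) :=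
    mfderivWithin 𝓘(ℝ, EG) 𝓘(ℝ, EG) (fun k => 𝒢.inv (𝒢.mulExt k (𝒢.inv g)))
      (𝒢.tgt ⁻¹' {𝒢.tgt g}) g
  (dr.toLinearMap ∘ₗ LinearMap.fst ℝ _ _).prod (LinearMap.fst ℝ _ _ + LinearMap.snd ℝ _ _)

end identifications

end SetGroupoid

/-! ### Embedded submanifolds of `G × G × G` -/

section submanifold

variable (EM EG : Type*) [NormedAddCommGroup EM] [NormedSpace ℝ EM]
  [NormedAddCommGroup EG] [NormedSpace ℝ EG]

/-- The model space of dimension `3 dim G - 2 dim M` for the submanifolds of `G × G × G` given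
by two equations in `M`. -/
abbrev TripleModel : Type :=
  EuclideanSpace ℝ (Fin (3 * finrank ℝ EG - 2 * finrank ℝ EM))

/-- The manifold structure on the subset `S` of `G × G × G` (with the subspace topology) makes `S` an
embedded submanifold. There is at most one such smooth structure. -/
def IsEmbeddedTriple {G : Type*} [TopologicalSpace G] [ChartedSpace EG G] (S : Set (G × G × G))
    [ChartedSpace (TripleModel EM EG) S] : Prop :=
  Manifold.IsSmoothEmbedding 𝓘(ℝ, TripleModel EM EG)
    (𝓘(ℝ, EG).prod (𝓘(ℝ, EG).prod 𝓘(ℝ, EG))) ∞ (Subtype.val : S → G × G × G)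

end submanifold

end

noncomputable section

/-! ### Lie brackets and related vector fields in normed spaces -/

section normed

variable {E F : Type*} [NormedAddCommGroup E] [NormedSpace ℝ E]
  [NormedAddCommGroup F] [NormedSpace ℝ F]

/-! The proof rests on one transversality argument, one formula for brackets, and one transport
principle.

Each of the three sets is cut out of G³ by two equations between submersions to M. The differential
of these equations is onto already when only the outer entries move. So the implicit function
theorem makes the set an embedded submanifold of the stated dimension, and a dimension count shows
that its tangent vectors are exactly the solutions of the linearized equations
(`IsFibredTriple.exists_isEmbeddedTriple`, `IsFibredTriple.exists_tangent`). A map into such a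
submanifold is smooth once its three entries are. Hence the structure maps are smooth, and so are
Φ^β, Φ^α and their inverses, which take the middle entry k to s k⁻¹ and to k⁻¹ g. The outer
projections are submersions because the linearized equations can be solved one entry after the
other.

The formula is `modelDeriv_fieldBracket_of_related`. If Tf maps V and W to Σ aᵢ (Xᵢ ∘ f) and Σ cⱼ
(Yⱼ ∘ f), differentiate the first relation along W and the second along V and subtract. The second
derivatives of f cancel by symmetry, and Tf[V, W] is left as a combination of the brackets [Xᵢ, Yⱼ]
and of derivatives of the coefficients. The relations are needed only on the image of a map r that
fixes the point and whose derivative fixes V and W there. This freedom matters because a left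
translation lives on a single α-fibre: it is replaced by a smooth extension of the multiplication to
non-composable pairs (`IsLieGroupoid.exists_isLocalMul`), and r retracts onto the fibre. It follows
that brackets of left-invariant fields are left-invariant, so that AG is a Lie algebroid
(`IsLieGroupoid.isLieAlgebroid`); that anchors preserve brackets; and that groupoid isomorphisms
induce algebroid isomorphisms. Applied to the middle projection P^πG → G, which is a morphism over
π, the formula is literally the prolongation bracket
(`IsLieGroupoid.modelDeriv_snd_sectionBracket`). It holds for every decomposition of the sections,
which also settles that the bracket does not depend on the decomposition.

The axioms for Vβ ⊕ Vα and P^π(AG) are never checked directly. A fibrewise bijection that matches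
smooth sections, anchors and brackets transports all axioms
(`AlgebroidData.IsLieAlgebroid.isLieAlgebroidIso`), and the linearized equations provide the
bijection. The formulas for TΦ^β and TΦ^α come from differentiating (h, s) ↦ h⁻¹s and (g, h) ↦ gh⁻¹
at units. That they define algebroid isomorphisms then follows from commuting squares
(`AlgebroidData.IsLieAlgebroidIso.of_comp`). -/

theorem HasFDerivAt.comp_fixedPoint {φ : E → F} {r : E → E} {x : E}
    (hφ : DifferentiableAt ℝ φ x) (hr : DifferentiableAt ℝ r x) (hrx : r x = x) :
    HasFDerivAt (fun y => φ (r y)) ((fderiv ℝ φ x).comp (fderiv ℝ r x)) x := by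
  have := (hrx.symm ▸ hφ : DifferentiableAt ℝ φ (r x)).hasFDerivAt.comp x hr.hasFDerivAt
  rwa [hrx] at this

theorem hasFDerivAt_sum_smul_comp {ι : Type*} [Fintype ι] {f : E → F} {x : E}
    {a : ι → E → ℝ} {X : ι → F → F} (hf : DifferentiableAt ℝ f x)
    (ha : ∀ i, DifferentiableAt ℝ (a i) x) (hX : ∀ i, DifferentiableAt ℝ (X i) (f x)) :
    HasFDerivAt (fun y => ∑ i, a i y • X i (f y))
      (∑ i, (a i x • ((fderiv ℝ (X i) (f x)).comp (fderiv ℝ f x))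
        + (fderiv ℝ (a i) x).smulRight (X i (f x)))) x :=
  HasFDerivAt.fun_sum fun i _ =>
    (ha i).hasFDerivAt.smul ((hX i).hasFDerivAt.comp x hf.hasFDerivAt)

/-- The relation is known only after composition with `r`, so both sides are differentiated as
functions of y through `r y`. The chain rule inserts Dr(x), which disappears in the direction w
because Dr(x)w = w. -/
theorem fderiv_of_related_along {f : E → F} {x : E} (hf : ContDiffAt ℝ 2 f x) {V : E → E}
    (hV : DifferentiableAt ℝ V x) {r : E → E} (hr : DifferentiableAt ℝ r x) (hrx : r x = x)
    {w : E} (hw : fderiv ℝ r x w = w) {Ψ : E → F} (hΨ : DifferentiableAt ℝ Ψ x)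
    (h : ∀ᶠ y in 𝓝 x, fderiv ℝ f (r y) (V (r y)) = Ψ (r y)) :
    fderiv ℝ (fderiv ℝ f) x w (V x) + fderiv ℝ f x (fderiv ℝ V x w) = fderiv ℝ Ψ x w := by
  have hf' : DifferentiableAt ℝ (fderiv ℝ f) x :=
    (hf.fderiv_right (m := 1) (by norm_num)).differentiableAt (by norm_num)
  have h1 := (HasFDerivAt.comp_fixedPoint hf' hr hrx).clm_apply
    (HasFDerivAt.comp_fixedPoint hV hr hrx)
  have h2 : HasFDerivAt (fun y => fderiv ℝ f (r y) (V (r y)))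
      ((fderiv ℝ Ψ x).comp (fderiv ℝ r x)) x :=
    (HasFDerivAt.comp_fixedPoint hΨ hr hrx).congr_of_eventuallyEq h
  have := congrArg (fun L => L w) (h1.unique h2)
  simpa [hrx, hw, add_comm] using this

/-- If the vector fields `V` and `W` are mapped by `f` to combinations of vector fields along
`f`, then so is their Lie bracket. The relation is only needed at the points in the image of `r`. -/
theorem fderiv_lieBracket_of_related {ι κ : Type*} [Fintype ι] [Fintype κ]
    {f : E → F} {x : E} (hf : ContDiffAt ℝ 2 f x) {V W : E → E}
    (hV : DifferentiableAt ℝ V x) (hW : DifferentiableAt ℝ W x)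
    {r : E → E} (hr : DifferentiableAt ℝ r x) (hrx : r x = x)
    (hrV : fderiv ℝ r x (V x) = V x) (hrW : fderiv ℝ r x (W x) = W x)
    {a : ι → E → ℝ} {X : ι → F → F} {c : κ → E → ℝ} {Y : κ → F → F}
    (ha : ∀ i, DifferentiableAt ℝ (a i) x) (hX : ∀ i, DifferentiableAt ℝ (X i) (f x))
    (hc : ∀ i, DifferentiableAt ℝ (c i) x) (hY : ∀ i, DifferentiableAt ℝ (Y i) (f x))
    (h1 : ∀ᶠ y in 𝓝 x, fderiv ℝ f (r y) (V (r y)) = ∑ i, a i (r y) • X i (f (r y)))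
    (h2 : ∀ᶠ y in 𝓝 x, fderiv ℝ f (r y) (W (r y)) = ∑ i, c i (r y) • Y i (f (r y))) :
    fderiv ℝ f x (lieBracket ℝ V W x) =
      ∑ i, ∑ j, (a i x * c j x) • lieBracket ℝ (X i) (Y j) (f x)
        + ∑ j, fderiv ℝ (c j) x (V x) • Y j (f x) - ∑ i, fderiv ℝ (a i) x (W x) • X i (f x) := by
  have hfx : DifferentiableAt ℝ f x := hf.differentiableAt (by norm_num)
  have key1 := hasFDerivAt_sum_smul_comp hfx ha hX
  have key2 := hasFDerivAt_sum_smul_comp hfx hc hY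
  have e1 := fderiv_of_related_along hf hV hr hrx hrW key1.differentiableAt h1
  have e2 := fderiv_of_related_along hf hW hr hrx hrV key2.differentiableAt h2
  rw [key1.fderiv] at e1
  rw [key2.fderiv] at e2
  -- With the second derivative symmetric, its terms in `e1` and `e2` coincide. They drop out of the
  -- difference, which leaves Df applied to DW(V) - DV(W), that is, to the bracket.
  have sym : fderiv ℝ (fderiv ℝ f) x (W x) (V x) = fderiv ℝ (fderiv ℝ f) x (V x) (W x) :=
    (hf.isSymmSndFDerivAt (by simp)).eq _ _
  have v1 := h1.self_of_nhds
  have v2 := h2.self_of_nhds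
  rw [hrx] at v1 v2
  simp only [lieBracket, map_sub]
  simp only [sum_apply, add_apply, smul_apply, ContinuousLinearMap.comp_apply,
    ContinuousLinearMap.smulRight_apply, v1, v2, map_sum, map_smul, Finset.sum_add_distrib,
    Finset.smul_sum, smul_smul] at e1 e2
  rw [sym] at e1
  have e3 := congrArg₂ (· - ·) e2 e1
  simp only [add_sub_add_left_eq_sub] at e3
  rw [e3]
  simp only [smul_sub, Finset.sum_sub_distrib]
  -- One of the two double sums runs over its indices in the opposite order; after the exchange the
  -- terms pair up as DYⱼ(Xᵢ) - DXᵢ(Yⱼ).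
  rw [Finset.sum_comm (f := fun i j => (c i x * a j x) • (fderiv ℝ (Y i) (f x)) (X j (f x)))]
  simp only [mul_comm (c _ x)]
  abel

end normed

end

noncomputable section

/-! ### Derivatives as maps of the model spaces -/

section modelDeriv

variable {E E' E'' H H' H'' : Type*} [NormedAddCommGroup E] [NormedSpace ℝ E]
  [NormedAddCommGroup E'] [NormedSpace ℝ E'] [NormedAddCommGroup E''] [NormedSpace ℝ E'']
  [TopologicalSpace H] [TopologicalSpace H'] [TopologicalSpace H'']
  {M M' M'' : Type*} [TopologicalSpace M] [ChartedSpace H M] [TopologicalSpace M']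
  [ChartedSpace H' M'] [TopologicalSpace M''] [ChartedSpace H'' M'']
  (I : ModelWithCorners ℝ E H) (I' : ModelWithCorners ℝ E' H') (I'' : ModelWithCorners ℝ E'' H'')

/-- The derivative of a map of manifolds, as a linear map between the model vector spaces. -/
def modelDeriv (f : M → M') (x : M) : E →L[ℝ] E' := mfderiv I I' f x

variable {I I' I''}

theorem ContMDiffAt.mdiff {f : M → M'} {x : M} (hf : ContMDiffAt I I' ∞ f x) :
    MDifferentiableAt I I' f x := hf.mdifferentiableAt (by simp)

theorem modelDeriv_comp {g : M' → M''} {f : M → M'} {x : M}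
    (hg : MDifferentiableAt I' I'' g (f x)) (hf : MDifferentiableAt I I' f x) :
    modelDeriv I I'' (fun y => g (f y)) x =
      (modelDeriv I' I'' g (f x)).comp (modelDeriv I I' f x) :=
  mfderiv_comp x hg hf

theorem modelDeriv_comp_apply {g : M' → M''} {f : M → M'} {x : M}
    (hg : MDifferentiableAt I' I'' g (f x)) (hf : MDifferentiableAt I I' f x) (v : E) :
    modelDeriv I I'' (fun y => g (f y)) x v = modelDeriv I' I'' g (f x) (modelDeriv I I' f x v) := by
  rw [modelDeriv_comp hg hf]; rfl

theorem modelDeriv_congr {f g : M → M'} {x : M} (h : f =ᶠ[𝓝 x] g) :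
    modelDeriv I I' f x = modelDeriv I I' g x :=
  h.mfderiv_eq

theorem modelDeriv_id (x : M) : modelDeriv I I (fun y : M => y) x = ContinuousLinearMap.id ℝ E :=
  mfderiv_id

theorem modelDeriv_const (c : M') (x : M) : modelDeriv I I' (fun _ : M => c) x = 0 :=
  mfderiv_const

theorem modelDeriv_of_eventuallyEq_id {f : M → M} {x : M}
    (h : ∀ᶠ y in 𝓝 x, f y = y) : modelDeriv I I f x = ContinuousLinearMap.id ℝ E := by
  rw [modelDeriv_congr (g := fun y => y) h, modelDeriv_id]

theorem modelDeriv_prodMk {f : M → M'} {g : M → M''} {x : M}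
    (hf : MDifferentiableAt I I' f x) (hg : MDifferentiableAt I I'' g x) (v : E) :
    modelDeriv I (I'.prod I'') (fun y => (f y, g y)) x v =
      (modelDeriv I I' f x v, modelDeriv I I'' g x v) := by
  change (mfderiv I (I'.prod I'') (fun y => (f y, g y)) x) v = _
  rw [mfderiv_prodMk hf hg]; rfl

theorem modelDeriv_prod_apply {f : M × M' → M''} {x : M} {y : M'}
    (hf : MDifferentiableAt (I.prod I') I'' f (x, y)) (v : E) (w : E') :
    modelDeriv (I.prod I') I'' f (x, y) (v, w) =
      modelDeriv I I'' (fun z => f (z, y)) x v + modelDeriv I' I'' (fun z => f (x, z)) y w :=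
  mfderiv_prod_eq_add_apply (p := (x, y)) (v := (v, w)) hf

theorem modelDeriv_fst (p : M × M') :
    modelDeriv (I.prod I') I (Prod.fst : M × M' → M) p = ContinuousLinearMap.fst ℝ E E' :=
  mfderiv_fst

theorem modelDeriv_snd (p : M × M') :
    modelDeriv (I.prod I') I' (Prod.snd : M × M' → M') p = ContinuousLinearMap.snd ℝ E E' :=
  mfderiv_snd

theorem modelDeriv_eq_fderiv {f : E → E'} {x : E} :
    modelDeriv 𝓘(ℝ, E) 𝓘(ℝ, E') f x = fderiv ℝ f x := mfderiv_eq_fderiv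

theorem ContMDiffAt.eventually_mdiff [IsManifold I ∞ M] [IsManifold I' ∞ M'] {f : M → M'} {x : M}
    (hf : ContMDiffAt I I' ∞ f x) : ∀ᶠ y in 𝓝 x, MDifferentiableAt I I' f y := by
  have h1 : ContMDiffAt I I' 1 f x := hf.of_le (by simp)
  exact ((contMDiffAt_iff_contMDiffAt_nhds (by simp)).1 h1).mono
    fun y hy => hy.mdifferentiableAt (by simp)

end modelDeriv

/-! ### Smooth vector fields along a map -/

section smoothAlong

variable {E E' E'' F H H' H'' K : Type*} [NormedAddCommGroup E] [NormedSpace ℝ E]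
  [NormedAddCommGroup E'] [NormedSpace ℝ E'] [NormedAddCommGroup E''] [NormedSpace ℝ E'']
  [NormedAddCommGroup F] [NormedSpace ℝ F]
  [TopologicalSpace H] [TopologicalSpace H'] [TopologicalSpace H''] [TopologicalSpace K]
  {M M' M'' P Q : Type*} [TopologicalSpace M] [ChartedSpace H M] [TopologicalSpace M']
  [ChartedSpace H' M'] [TopologicalSpace M''] [ChartedSpace H'' M'']
  [TopologicalSpace P] [ChartedSpace K P]
  (I : ModelWithCorners ℝ E H) (I' : ModelWithCorners ℝ E' H') (I'' : ModelWithCorners ℝ E'' H'')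
  (J : ModelWithCorners ℝ F K)

variable [IsManifold I ∞ M] [IsManifold I' ∞ M'] [IsManifold I'' ∞ M'']

/-- The vectors `v q`, tangent to `M` at `η q`, depend smoothly on `q` at the point `p`. -/
def SmoothAlongAt (η : P → M) (v : P → E) (p : P) : Prop :=
  ContMDiffAt J I.tangent ∞ (fun q => (⟨η q, v q⟩ : TangentBundle I M)) p

variable {I I' I'' J}

/-- In the trivialization of the tangent bundle at η(p), the fibre coordinate of a vector is its
image under the derivative of the preferred chart. This expression is linear in the vector, so sums
and multiples of smooth fields along η are handled in the model space. -/
theorem smoothAlongAt_iff {η : P → M} {v : P → E} {p : P} :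
    SmoothAlongAt I J η v p ↔ ContMDiffAt J I ∞ η p ∧
      ContMDiffAt J 𝓘(ℝ, E) ∞ (fun q => modelDeriv I 𝓘(ℝ, E) (extChartAt I (η p)) (η q) (v q)) p := by
  unfold SmoothAlongAt
  rw [Bundle.contMDiffAt_totalSpace]
  refine and_congr_right fun hη => ?_
  have : ∀ᶠ q in 𝓝 p, η q ∈ (chartAt H (η p)).source :=
    hη.continuousAt (chart_source_mem_nhds H (η p))
  refine Filter.EventuallyEq.contMDiffAt_iff ?_
  filter_upwards [this] with q hq
  have h := TangentBundle.continuousLinearMapAt_trivializationAt (I := I) (x₀ := η p) hq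
  have h' := congrArg (fun L => L (v q)) h
  rw [Bundle.Trivialization.continuousLinearMapAt_apply] at h'
  have hb : η q ∈ (trivializationAt E (TangentSpace I) (η p)).baseSet := by
    simpa using hq
  rw [Bundle.Trivialization.coe_linearMapAt_of_mem _ hb] at h'
  exact h'

namespace SmoothAlongAt

variable {η : P → M} {v w : P → E} {p : P}

theorem base (h : SmoothAlongAt I J η v p) : ContMDiffAt J I ∞ η p := (smoothAlongAt_iff.1 h).1

theorem congr {η' : P → M} {v' : P → E} (h : SmoothAlongAt I J η v p)
    (hη : ∀ᶠ q in 𝓝 p, η' q = η q) (hv : ∀ᶠ q in 𝓝 p, v' q = v q) :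
    SmoothAlongAt I J η' v' p := by
  refine ContMDiffAt.congr_of_eventuallyEq h ?_
  filter_upwards [hη, hv] with q h1 h2
  rw [h1, h2]

theorem add (hv : SmoothAlongAt I J η v p) (hw : SmoothAlongAt I J η w p) :
    SmoothAlongAt I J η (fun q => v q + w q) p := by
  rw [smoothAlongAt_iff] at hv hw ⊢
  simpa only [map_add] using ⟨hv.1, hv.2.add hw.2⟩

theorem sub (hv : SmoothAlongAt I J η v p) (hw : SmoothAlongAt I J η w p) :
    SmoothAlongAt I J η (fun q => v q - w q) p := by
  rw [smoothAlongAt_iff] at hv hw ⊢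
  simpa only [map_sub] using ⟨hv.1, hv.2.sub hw.2⟩

theorem smul {a : P → ℝ} (ha : ContMDiffAt J 𝓘(ℝ, ℝ) ∞ a p) (hv : SmoothAlongAt I J η v p) :
    SmoothAlongAt I J η (fun q => a q • v q) p := by
  rw [smoothAlongAt_iff] at hv ⊢
  simpa only [map_smul] using ⟨hv.1, ha.smul hv.2⟩

theorem zero (hη : ContMDiffAt J I ∞ η p) : SmoothAlongAt I J η (fun _ => 0) p := by
  rw [smoothAlongAt_iff]
  simpa only [map_zero] using ⟨hη, contMDiffAt_const⟩

theorem sum {ι : Type*} [Fintype ι] {v : ι → P → E} (hη : ContMDiffAt J I ∞ η p)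
    (hv : ∀ i, SmoothAlongAt I J η (v i) p) : SmoothAlongAt I J η (fun q => ∑ i, v i q) p := by
  rw [smoothAlongAt_iff]
  simp only [map_sum]
  exact ⟨hη, ContMDiffAt.sum fun i _ => (smoothAlongAt_iff.1 (hv i)).2⟩

theorem comp {K' F' : Type*} [NormedAddCommGroup F'] [NormedSpace ℝ F'] [TopologicalSpace K']
    [TopologicalSpace Q] [ChartedSpace K' Q] {J' : ModelWithCorners ℝ F' K'} {f : Q → P} {q : Q}
    (h : SmoothAlongAt I J η v (f q)) (hf : ContMDiffAt J' J ∞ f q) :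
    SmoothAlongAt I J' (fun x => η (f x)) (fun x => v (f x)) q :=
  ContMDiffAt.comp (I' := J) q h hf

/-- In coordinates, the derivative of f along η is a smooth family of linear maps, since smoothness
of order ∞ survives one differentiation. It is then applied to a smooth family of vectors. -/
theorem map {f : M → M'} (h : SmoothAlongAt I J η v p) (hf : ContMDiffAt I I' ∞ f (η p)) :
    SmoothAlongAt I' J (fun q => f (η q)) (fun q => modelDeriv I I' f (η q) (v q)) p := by
  have hϕ := (ContMDiffAt.mfderiv_const (m := ∞) hf (by simp)).comp p h.base
  exact ContMDiffAt.clm_apply_of_inCoordinates (ϕ := fun q => mfderiv I I' f (η q)) hϕ h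
    (hf.comp p h.base)

theorem prodMk {η' : P → M'} {v' : P → E'} (h : SmoothAlongAt I J η v p)
    (h' : SmoothAlongAt I' J η' v' p) :
    SmoothAlongAt (I.prod I') J (fun q => (η q, η' q)) (fun q => (v q, v' q)) p :=
  (contMDiff_equivTangentBundleProd_symm (n := ∞) (I := I) (M := M) (I' := I') (M' := M')
    |>.contMDiffAt).comp p (ContMDiffAt.prodMk h h')

theorem of_model {η v : P → E} (hη : ContMDiffAt J 𝓘(ℝ, E) ∞ η p)
    (hv : ContMDiffAt J 𝓘(ℝ, E) ∞ v p) : SmoothAlongAt 𝓘(ℝ, E) J η v p := by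
  rw [smoothAlongAt_iff]
  refine ⟨hη, hv.congr_of_eventuallyEq (.of_forall fun q => ?_)⟩
  simp only [extChartAt_model_space_eq_id]
  exact congrArg (fun L => L (v q)) (modelDeriv_id (I := 𝓘(ℝ, E)) (η q))

theorem model {η v : P → E} (h : SmoothAlongAt 𝓘(ℝ, E) J η v p) :
    ContMDiffAt J 𝓘(ℝ, E) ∞ v p := by
  refine (smoothAlongAt_iff.1 h).2.congr_of_eventuallyEq (.of_forall fun q => ?_)
  simp only [extChartAt_model_space_eq_id]
  exact congrArg (fun L => L (v q)) (modelDeriv_id (I := 𝓘(ℝ, E)) (η q)).symm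

theorem mdiff {V : M → E} {x : M} (h : SmoothAlongAt I I (fun y => y) V x) :
    MDifferentiableAt I I.tangent (fun y => (⟨y, V y⟩ : TangentBundle I M)) x :=
  ContMDiffAt.mdiff h

end SmoothAlongAt

end smoothAlong

end

noncomputable section

/-! ### Lie brackets of related vector fields on manifolds -/

section fieldBracket

variable {E F F' : Type*} [NormedAddCommGroup E] [NormedSpace ℝ E]
  [NormedAddCommGroup F] [NormedSpace ℝ F] [NormedAddCommGroup F'] [NormedSpace ℝ F']
  {M N : Type*} [TopologicalSpace M] [ChartedSpace E M] [IsManifold 𝓘(ℝ, E) ∞ M]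
  [TopologicalSpace N] [ChartedSpace F N] [IsManifold 𝓘(ℝ, F) ∞ N]

omit [IsManifold 𝓘(ℝ, E) ∞ M] in
variable (E) in
/-- The Lie bracket of vector fields, which are given as functions with values in the model
space. -/
def fieldBracket (V W : M → E) : M → E := mlieBracket 𝓘(ℝ, E) (M := M) V W

variable (E) in
/-- The vector field `V` in the preferred chart at `x`. -/
def coordField (x : M) (V : M → E) : E → E :=
  mpullbackWithin 𝓘(ℝ, E) 𝓘(ℝ, E) (extChartAt 𝓘(ℝ, E) x).symm V (range 𝓘(ℝ, E))

theorem mdifferentiableAt_extChartAt_self {x z : M} (hz : z ∈ (extChartAt 𝓘(ℝ, E) x).source) :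
    MDifferentiableAt 𝓘(ℝ, E) 𝓘(ℝ, E) (extChartAt 𝓘(ℝ, E) x) z :=
  mdifferentiableAt_extChartAt (by rwa [extChartAt_source] at hz)

theorem modelDeriv_extChartAt_self (x : M) :
    modelDeriv 𝓘(ℝ, E) 𝓘(ℝ, E) (extChartAt 𝓘(ℝ, E) x) x = ContinuousLinearMap.id ℝ E :=
  mfderiv_extChartAt_self

/-- The field is pulled back with the inverse of the derivative of the inverse chart. The two chart
derivatives are inverse to each other on either side, so this inverse is the derivative of the
chart. -/
theorem coordField_apply {x z : M} (hz : z ∈ (extChartAt 𝓘(ℝ, E) x).source) (V : M → E) :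
    coordField E x V (extChartAt 𝓘(ℝ, E) x z) =
      modelDeriv 𝓘(ℝ, E) 𝓘(ℝ, E) (extChartAt 𝓘(ℝ, E) x) z (V z) := by
  have h1 := mfderiv_extChartAt_comp_mfderivWithin_extChartAt_symm' (I := 𝓘(ℝ, E)) hz
  have h2 := mfderivWithin_extChartAt_symm_comp_mfderiv_extChartAt' (I := 𝓘(ℝ, E)) hz
  have h3 : (extChartAt 𝓘(ℝ, E) x).symm (extChartAt 𝓘(ℝ, E) x z) = z :=
    (extChartAt 𝓘(ℝ, E) x).left_inv hz
  have key : ∀ (A B : E →L[ℝ] E), A.comp B = ContinuousLinearMap.id ℝ E →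
      B.comp A = ContinuousLinearMap.id ℝ E → B.inverse = A := fun A B h h' =>
    ContinuousLinearMap.inverse_eq h' h
  refine (congrArg (fun L : E →L[ℝ] E => L (V _)) (key _ _ h1 h2)).trans ?_
  change modelDeriv 𝓘(ℝ, E) 𝓘(ℝ, E) (extChartAt 𝓘(ℝ, E) x) z (V _) = _
  rw [h3]

/-- The manifold bracket is the coordinate bracket pulled back by the preferred chart at x. At x
itself that chart has the identity as its derivative, so no correction appears. -/
theorem fieldBracket_eq_coord (V W : M → E) (x : M) :
    fieldBracket E V W x = lieBracket ℝ (coordField E x V) (coordField E x W)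
      (extChartAt 𝓘(ℝ, E) x x) := by
  have h : (mfderiv 𝓘(ℝ, E) 𝓘(ℝ, E) (extChartAt 𝓘(ℝ, E) x) x : E →L[ℝ] E).inverse
      = ContinuousLinearMap.id ℝ E :=
    (congrArg ContinuousLinearMap.inverse (modelDeriv_extChartAt_self (E := E) x)).trans
      ContinuousLinearMap.inverse_id
  refine (congrArg (fun L : E →L[ℝ] E => L _) h).trans ?_
  have hs : (extChartAt 𝓘(ℝ, E) x).symm ⁻¹' univ ∩ range 𝓘(ℝ, E) = univ := by simp
  change lieBracketWithin ℝ (coordField E x V) (coordField E x W) _ _ = _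
  rw [hs, lieBracketWithin_univ]

theorem SmoothAlongAt.differentiableAt_coordField [CompleteSpace E] {V : M → E} {x : M}
    (hV : SmoothAlongAt 𝓘(ℝ, E) 𝓘(ℝ, E) (fun y => y) V x) :
    DifferentiableAt ℝ (coordField E x V) (extChartAt 𝓘(ℝ, E) x x) := by
  have h := (mdifferentiableWithinAt_univ.2 hV.mdiff)
    |>.differentiableWithinAt_mpullbackWithin_vectorField
  have hs : (extChartAt 𝓘(ℝ, E) x).symm ⁻¹' univ ∩ range 𝓘(ℝ, E) = univ := by simp
  rw [hs] at h
  exact differentiableWithinAt_univ.1 h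

theorem mdifferentiableAt_comp_extChartAt_symm {x z : M} (hz : z ∈ (extChartAt 𝓘(ℝ, E) x).source)
    {h : M → F} (hh : MDifferentiableAt 𝓘(ℝ, E) 𝓘(ℝ, F) h z) :
    DifferentiableAt ℝ (fun y => h ((extChartAt 𝓘(ℝ, E) x).symm y)) (extChartAt 𝓘(ℝ, E) x z) := by
  rw [← mdifferentiableAt_iff_differentiableAt]
  have h1 := mdifferentiableWithinAt_extChartAt_symm (I := 𝓘(ℝ, E))
    ((extChartAt 𝓘(ℝ, E) x).map_source hz)
  rw [modelWithCornersSelf_coe, range_id, mdifferentiableWithinAt_univ] at h1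
  have h3 : (extChartAt 𝓘(ℝ, E) x).symm (extChartAt 𝓘(ℝ, E) x z) = z :=
    (extChartAt 𝓘(ℝ, E) x).left_inv hz
  exact MDifferentiableAt.comp (I' := 𝓘(ℝ, E)) _ (h3.symm ▸ hh) h1

theorem fderiv_comp_extChartAt_symm {x z : M} (hz : z ∈ (extChartAt 𝓘(ℝ, E) x).source)
    {h : M → F} (hh : MDifferentiableAt 𝓘(ℝ, E) 𝓘(ℝ, F) h z) (v : E) :
    fderiv ℝ (fun y => h ((extChartAt 𝓘(ℝ, E) x).symm y)) (extChartAt 𝓘(ℝ, E) x z)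
      (modelDeriv 𝓘(ℝ, E) 𝓘(ℝ, E) (extChartAt 𝓘(ℝ, E) x) z v) =
      modelDeriv 𝓘(ℝ, E) 𝓘(ℝ, F) h z v := by
  rw [← modelDeriv_eq_fderiv, ← modelDeriv_comp_apply
    (g := fun y => h ((extChartAt 𝓘(ℝ, E) x).symm y)) (f := extChartAt 𝓘(ℝ, E) x)
    (mdifferentiableAt_iff_differentiableAt.2 (mdifferentiableAt_comp_extChartAt_symm hz hh))
    (mdifferentiableAt_extChartAt_self hz)]
  refine congrArg (fun L : E →L[ℝ] F => L v) (modelDeriv_congr ?_)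
  filter_upwards [(isOpen_extChartAt_source (I := 𝓘(ℝ, E)) x).mem_nhds hz] with y hy
  rw [(extChartAt 𝓘(ℝ, E) x).left_inv hy]

theorem fderiv_comp_extChartAt_symm_self {x : M}
    {h : M → F} (hh : MDifferentiableAt 𝓘(ℝ, E) 𝓘(ℝ, F) h x) (v : E) :
    fderiv ℝ (fun y => h ((extChartAt 𝓘(ℝ, E) x).symm y)) (extChartAt 𝓘(ℝ, E) x x) v =
      modelDeriv 𝓘(ℝ, E) 𝓘(ℝ, F) h x v := by
  have := fderiv_comp_extChartAt_symm (mem_extChartAt_source x) hh v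
  rwa [modelDeriv_extChartAt_self] at this

/-- A relation of vector fields, written in charts. -/
theorem coordField_related {ι : Type*} [Fintype ι]
    {f : M → N} {x : M} (hf : ContMDiffAt 𝓘(ℝ, E) 𝓘(ℝ, F) ∞ f x) {V : M → E}
    {r : M → M} (hr : ContinuousAt r x) (hrx : r x = x)
    {a : ι → M → ℝ} {X : ι → N → F}
    (h : ∀ᶠ y in 𝓝 x, modelDeriv 𝓘(ℝ, E) 𝓘(ℝ, F) f (r y) (V (r y)) =
      ∑ i, a i (r y) • X i (f (r y))) :
    ∀ᶠ y in 𝓝 (extChartAt 𝓘(ℝ, E) x x),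
      fderiv ℝ (fun y => extChartAt 𝓘(ℝ, F) (f x) (f ((extChartAt 𝓘(ℝ, E) x).symm y)))
        (extChartAt 𝓘(ℝ, E) x (r ((extChartAt 𝓘(ℝ, E) x).symm y)))
        (coordField E x V (extChartAt 𝓘(ℝ, E) x (r ((extChartAt 𝓘(ℝ, E) x).symm y)))) =
        ∑ i, a i ((extChartAt 𝓘(ℝ, E) x).symm
            (extChartAt 𝓘(ℝ, E) x (r ((extChartAt 𝓘(ℝ, E) x).symm y)))) •
          coordField F (f x) (X i) (extChartAt 𝓘(ℝ, F) (f x) (f ((extChartAt 𝓘(ℝ, E) x).symm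
            (extChartAt 𝓘(ℝ, E) x (r ((extChartAt 𝓘(ℝ, E) x).symm y)))))) := by
  set φ := extChartAt 𝓘(ℝ, E) x with hφ
  set ψ := extChartAt 𝓘(ℝ, F) (f x) with hψ
  have hx : x ∈ φ.source := mem_extChartAt_source x
  have hφx : φ.symm (φ x) = x := φ.left_inv hx
  have symm_cont : Filter.Tendsto φ.symm (𝓝 (φ x)) (𝓝 x) := by
    have := continuousAt_extChartAt_symm (I := 𝓘(ℝ, E)) x
    rwa [ContinuousAt, ← hφ, hφx] at this
  have hrc : Filter.Tendsto r (𝓝 x) (𝓝 x) := by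
    have := hr; rwa [ContinuousAt, hrx] at this
  have s1 : ∀ᶠ y in 𝓝 x, y ∈ φ.source := extChartAt_source_mem_nhds (I := 𝓘(ℝ, E)) x
  have s2 : ∀ᶠ y in 𝓝 x, f y ∈ ψ.source :=
    hf.continuousAt (extChartAt_source_mem_nhds (I := 𝓘(ℝ, F)) (f x))
  filter_upwards [symm_cont.eventually h, symm_cont.eventually (hrc.eventually s1),
    symm_cont.eventually (hrc.eventually s2),
    symm_cont.eventually (hrc.eventually hf.eventually_mdiff)] with y hy h1 h2 h3
  have hfr := (mdifferentiableAt_extChartAt_self h2).comp _ h3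
  rw [coordField_apply h1, fderiv_comp_extChartAt_symm (h := fun z => ψ (f z)) h1 hfr,
    modelDeriv_comp_apply (mdifferentiableAt_extChartAt_self h2) h3, hy, φ.left_inv h1, map_sum]
  refine Finset.sum_congr rfl fun i _ => ?_
  rw [map_smul, coordField_apply h2]

/-- The central bracket formula. It is the vector space statement `fderiv_lieBracket_of_related`
written in the preferred charts at x and f(x). General coefficients are needed for the prolongation
bracket, and the map r for fields that are related only along a fibre. -/
theorem modelDeriv_fieldBracket_of_related [CompleteSpace E] [CompleteSpace F]
    {ι κ : Type*} [Fintype ι] [Fintype κ]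
    {f : M → N} {x : M} (hf : ContMDiffAt 𝓘(ℝ, E) 𝓘(ℝ, F) ∞ f x) {V W : M → E}
    (hV : SmoothAlongAt 𝓘(ℝ, E) 𝓘(ℝ, E) (fun y => y) V x)
    (hW : SmoothAlongAt 𝓘(ℝ, E) 𝓘(ℝ, E) (fun y => y) W x)
    {r : M → M} (hr : MDifferentiableAt 𝓘(ℝ, E) 𝓘(ℝ, E) r x) (hrx : r x = x)
    (hrV : modelDeriv 𝓘(ℝ, E) 𝓘(ℝ, E) r x (V x) = V x)
    (hrW : modelDeriv 𝓘(ℝ, E) 𝓘(ℝ, E) r x (W x) = W x)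
    {a : ι → M → ℝ} {X : ι → N → F} {c : κ → M → ℝ} {Y : κ → N → F}
    (ha : ∀ i, MDifferentiableAt 𝓘(ℝ, E) 𝓘(ℝ, ℝ) (a i) x)
    (hX : ∀ i, SmoothAlongAt 𝓘(ℝ, F) 𝓘(ℝ, F) (fun y => y) (X i) (f x))
    (hc : ∀ i, MDifferentiableAt 𝓘(ℝ, E) 𝓘(ℝ, ℝ) (c i) x)
    (hY : ∀ i, SmoothAlongAt 𝓘(ℝ, F) 𝓘(ℝ, F) (fun y => y) (Y i) (f x))
    (h1 : ∀ᶠ y in 𝓝 x, modelDeriv 𝓘(ℝ, E) 𝓘(ℝ, F) f (r y) (V (r y)) =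
      ∑ i, a i (r y) • X i (f (r y)))
    (h2 : ∀ᶠ y in 𝓝 x, modelDeriv 𝓘(ℝ, E) 𝓘(ℝ, F) f (r y) (W (r y)) =
      ∑ i, c i (r y) • Y i (f (r y))) :
    modelDeriv 𝓘(ℝ, E) 𝓘(ℝ, F) f x (fieldBracket E V W x) =
      ∑ i, ∑ j, (a i x * c j x) • fieldBracket F (X i) (Y j) (f x)
        + ∑ j, modelDeriv 𝓘(ℝ, E) 𝓘(ℝ, ℝ) (c j) x (V x) • Y j (f x)
        - ∑ i, modelDeriv 𝓘(ℝ, E) 𝓘(ℝ, ℝ) (a i) x (W x) • X i (f x) := by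
  set φ := extChartAt 𝓘(ℝ, E) x with hφ
  set ψ := extChartAt 𝓘(ℝ, F) (f x) with hψ
  have hx : x ∈ φ.source := mem_extChartAt_source x
  have hxψ : f x ∈ ψ.source := mem_extChartAt_source (f x)
  have hφx : φ.symm (φ x) = x := φ.left_inv hx
  have symm_cont : Filter.Tendsto φ.symm (𝓝 (φ x)) (𝓝 x) := by
    have := continuousAt_extChartAt_symm (I := 𝓘(ℝ, E)) x
    rwa [ContinuousAt, ← hφ, hφx] at this
  have hψf : MDifferentiableAt 𝓘(ℝ, E) 𝓘(ℝ, F) (fun z => ψ (f z)) x :=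
    (mdifferentiableAt_extChartAt_self hxψ).comp x hf.mdiff
  have e1 : fderiv ℝ (fun y => ψ (f (φ.symm y))) (φ x) (fieldBracket E V W x) =
      modelDeriv 𝓘(ℝ, E) 𝓘(ℝ, F) f x (fieldBracket E V W x) := by
    rw [fderiv_comp_extChartAt_symm_self (h := fun z => ψ (f z)) hψf, modelDeriv_comp_apply
      (mdifferentiableAt_extChartAt_self hxψ) hf.mdiff, modelDeriv_extChartAt_self]
    rfl
  have er (v : E) : fderiv ℝ (fun y => φ (r (φ.symm y))) (φ x) v =
      modelDeriv 𝓘(ℝ, E) 𝓘(ℝ, E) r x v := by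
    have hφr : MDifferentiableAt 𝓘(ℝ, E) 𝓘(ℝ, E) φ (r x) := by
      rw [hrx]; exact mdifferentiableAt_extChartAt_self hx
    rw [fderiv_comp_extChartAt_symm_self (h := fun z => φ (r z)) (hφr.comp x hr), modelDeriv_comp_apply hφr hr, hrx,
      modelDeriv_extChartAt_self]
    rfl
  have hVx : coordField E x V (φ x) = V x := by
    rw [hφ, coordField_apply hx, modelDeriv_extChartAt_self]; rfl
  have hWx : coordField E x W (φ x) = W x := by
    rw [hφ, coordField_apply hx, modelDeriv_extChartAt_self]; rfl
  have hfx : ψ (f (φ.symm (φ x))) = ψ (f x) := by rw [hφx]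
  have fld (Z : N → F) : coordField F (f x) Z (ψ (f x)) = Z (f x) := by
    rw [hψ, coordField_apply hxψ, modelDeriv_extChartAt_self]; rfl
  -- All data are conjugated by the charts φ and ψ; the role of r is played by φ ∘ r ∘ φ⁻¹. Both
  -- charts have identity derivative at their centres, so the coordinate fields take the original
  -- values there.
  have main := fderiv_lieBracket_of_related (ι := ι) (κ := κ)
    (f := fun y => ψ (f (φ.symm y))) (x := φ x) ?_
    hV.differentiableAt_coordField hW.differentiableAt_coordField
    (r := fun y => φ (r (φ.symm y))) ?_ (by rw [hφx, hrx]) (by rw [er, hVx, hrV])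
    (by rw [er, hWx, hrW]) (a := fun i y => a i (φ.symm y)) (X := fun i => coordField F (f x) (X i))
    (c := fun i y => c i (φ.symm y)) (Y := fun i => coordField F (f x) (Y i))
    (fun i => mdifferentiableAt_comp_extChartAt_symm hx (ha i))
    (fun i => hfx ▸ (hX i).differentiableAt_coordField)
    (fun i => mdifferentiableAt_comp_extChartAt_symm hx (hc i))
    (fun i => hfx ▸ (hY i).differentiableAt_coordField) 
    (coordField_related hf hr.continuousAt hrx h1) (coordField_related hf hr.continuousAt hrx h2)
  · rw [← fieldBracket_eq_coord, e1] at main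
    rw [main]
    simp only [hVx, hWx, hφx, fld]
    refine congrArg₂ _ (congrArg₂ _ ?_ ?_) ?_
    · refine Finset.sum_congr rfl fun i _ => Finset.sum_congr rfl fun j _ => ?_
      rw [fieldBracket_eq_coord]
    · exact Finset.sum_congr rfl fun j _ => by rw [fderiv_comp_extChartAt_symm_self (hc j)]
    · exact Finset.sum_congr rfl fun j _ => by rw [fderiv_comp_extChartAt_symm_self (ha j)]
  · have h : ContDiffWithinAt ℝ ∞ (fun y => ψ (f (φ.symm y))) (range 𝓘(ℝ, E)) (φ x) :=
      (contMDiffAt_iff.1 hf).2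
    rw [modelWithCornersSelf_coe, range_id, contDiffWithinAt_univ] at h
    exact h.of_le (WithTop.coe_le_coe.2 le_top : ((2 : ℕ∞) : WithTop ℕ∞) ≤ ((⊤ : ℕ∞) : WithTop ℕ∞))
  · have hφr : MDifferentiableAt 𝓘(ℝ, E) 𝓘(ℝ, E) φ (r x) := by
      rw [hrx]; exact mdifferentiableAt_extChartAt_self hx
    exact mdifferentiableAt_comp_extChartAt_symm (h := fun z => φ (r z)) hx (hφr.comp x hr)

/-- If `f` maps `V` and `W` to `X` and `Y`, then it maps `[V, W]` to `[X, Y]`. The relation is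
only needed at the points in the image of `r`. -/
theorem modelDeriv_fieldBracket_of_related_along [CompleteSpace E] [CompleteSpace F]
    {f : M → N} {x : M} (hf : ContMDiffAt 𝓘(ℝ, E) 𝓘(ℝ, F) ∞ f x) {V W : M → E} {X Y : N → F}
    (hV : SmoothAlongAt 𝓘(ℝ, E) 𝓘(ℝ, E) (fun y => y) V x)
    (hW : SmoothAlongAt 𝓘(ℝ, E) 𝓘(ℝ, E) (fun y => y) W x)
    (hX : SmoothAlongAt 𝓘(ℝ, F) 𝓘(ℝ, F) (fun y => y) X (f x))
    (hY : SmoothAlongAt 𝓘(ℝ, F) 𝓘(ℝ, F) (fun y => y) Y (f x))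
    {r : M → M} (hr : MDifferentiableAt 𝓘(ℝ, E) 𝓘(ℝ, E) r x) (hrx : r x = x)
    (hrV : modelDeriv 𝓘(ℝ, E) 𝓘(ℝ, E) r x (V x) = V x)
    (hrW : modelDeriv 𝓘(ℝ, E) 𝓘(ℝ, E) r x (W x) = W x)
    (h1 : ∀ᶠ y in 𝓝 x, modelDeriv 𝓘(ℝ, E) 𝓘(ℝ, F) f (r y) (V (r y)) = X (f (r y)))
    (h2 : ∀ᶠ y in 𝓝 x, modelDeriv 𝓘(ℝ, E) 𝓘(ℝ, F) f (r y) (W (r y)) = Y (f (r y))) :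
    modelDeriv 𝓘(ℝ, E) 𝓘(ℝ, F) f x (fieldBracket E V W x) = fieldBracket F X Y (f x) := by
  -- Sums with one term and constant coefficient 1: the terms that differentiate coefficients
  -- vanish.
  have := modelDeriv_fieldBracket_of_related (ι := Unit) (κ := Unit) hf hV hW hr hrx hrV hrW
    (a := fun _ _ => 1) (c := fun _ _ => 1) (X := fun _ => X) (Y := fun _ => Y)
    (fun _ => mdifferentiableAt_const) (fun _ => hX) (fun _ => mdifferentiableAt_const)
    (fun _ => hY) (by simpa using h1) (by simpa using h2)
  simpa [modelDeriv_const] using this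

end fieldBracket

end

noncomputable section

/-! ### Charts from the inverse function theorem -/

section charts

variable {E E' E₂ K : Type*} [NormedAddCommGroup E] [NormedSpace ℝ E]
  [NormedAddCommGroup E'] [NormedSpace ℝ E'] [NormedAddCommGroup E₂] [NormedSpace ℝ E₂]
  [NormedAddCommGroup K] [NormedSpace ℝ K]
  {N N' : Type*} [TopologicalSpace N] [ChartedSpace E N]
  [TopologicalSpace N'] [ChartedSpace E' N']

/-- The inverse function theorem, with its domain shrunk to an open set on which f is smooth and its
derivative stays invertible. Invertible maps form an open set, so this is possible, and the inverse
is then smooth on the whole target rather than at a single point. -/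
theorem exists_openPartialHomeomorph_contDiffOn [CompleteSpace E] {f : E → E} {a : E}
    (hf : ∀ᶠ y in 𝓝 a, ContDiffAt ℝ ∞ f y) {L : E ≃L[ℝ] E} (hL : HasFDerivAt f (L : E →L[ℝ] E) a) :
    ∃ g : OpenPartialHomeomorph E E, a ∈ g.source ∧ (∀ y ∈ g.source, g y = f y) ∧
      ContDiffOn ℝ ∞ g g.source ∧ ContDiffOn ℝ ∞ g.symm g.target := by
  have ha := hf.self_of_nhds
  let g₀ := ha.toOpenPartialHomeomorph f hL (by simp)
  have hg₀ : ∀ y, g₀ y = f y := fun y => by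
    rw [ContDiffAt.toOpenPartialHomeomorph_coe]
  have hcont : ContinuousAt (fderiv ℝ f) a :=
    (ha.fderiv_right (m := 0) (by simp)).continuousAt
  have hinv : ∀ᶠ y in 𝓝 a, fderiv ℝ f y ∈ range ((↑) : (E ≃L[ℝ] E) → E →L[ℝ] E) := by
    apply hcont.eventually_mem
    rw [hL.fderiv]
    exact ContinuousLinearEquiv.nhds L
  obtain ⟨W, hW, hWo, haW⟩ := eventually_nhds_iff.1 (hf.and hinv)
  let g := g₀.restrOpen W hWo
  have hsource : ∀ y ∈ g.source, y ∈ W := fun y hy => by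
    rw [OpenPartialHomeomorph.restrOpen_source] at hy; exact hy.2
  have hgf : (g : E → E) = f := funext hg₀
  refine ⟨g, ?_, fun y _ => hg₀ y, ?_, ?_⟩
  · rw [OpenPartialHomeomorph.restrOpen_source]
    exact ⟨ha.mem_toOpenPartialHomeomorph_source hL (by simp), haW⟩
  · intro y hy
    rw [hgf]
    exact (hW y (hsource y hy)).1.contDiffWithinAt
  · intro b hb
    have hb' := hsource _ (g.map_target hb)
    obtain ⟨L', hL'⟩ := (hW _ hb').2
    refine (g.contDiffAt_symm hb (f₀' := L') ?_ ?_).contDiffWithinAt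
    · rw [hgf, hL']
      exact ((hW _ hb').1.differentiableAt (by simp)).hasFDerivAt
    · rw [hgf]
      exact (hW _ hb').1

/-- The inverse function theorem is applied to Θ read in the preferred chart at x. Composing the
result with that chart gives a map that is smooth together with its inverse, hence a chart of the
maximal atlas. -/
theorem exists_mem_maximalAtlas_of_modelDeriv_equiv [CompleteSpace E] [IsManifold 𝓘(ℝ, E) ∞ N]
    {Θ : N → E} {x : N} (hΘ : ∀ᶠ y in 𝓝 x, ContMDiffAt 𝓘(ℝ, E) 𝓘(ℝ, E) ∞ Θ y) (L : E ≃L[ℝ] E)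
    (hL : modelDeriv 𝓘(ℝ, E) 𝓘(ℝ, E) Θ x = L) :
    ∃ e ∈ IsManifold.maximalAtlas 𝓘(ℝ, E) ∞ N, x ∈ e.source ∧ ∀ y ∈ e.source, e y = Θ y := by
  set φ := chartAt E x with hφ
  have hx : x ∈ φ.source := mem_chart_source E x
  have hφx : φ.symm (φ x) = x := φ.left_inv hx
  have hsymm : ContinuousAt φ.symm (φ x) := φ.continuousAt_symm (φ.map_source hx)
  have hsm : ∀ y ∈ φ.target, ContMDiffAt 𝓘(ℝ, E) 𝓘(ℝ, E) ∞ φ.symm y := fun y hy =>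
    contMDiffAt_symm_of_mem_maximalAtlas (IsManifold.chart_mem_maximalAtlas x) hy
  have h1 : ∀ᶠ y in 𝓝 (φ x), ContDiffAt ℝ ∞ (fun z => Θ (φ.symm z)) y := by
    have h2 : ∀ᶠ y in 𝓝 (φ x), ContMDiffAt 𝓘(ℝ, E) 𝓘(ℝ, E) ∞ Θ (φ.symm y) := by
      apply hsymm.eventually; rwa [hφx]
    filter_upwards [h2, φ.open_target.mem_nhds (φ.map_source hx)] with y hy hy'
    exact contMDiffAt_iff_contDiffAt.1 (hy.comp y (hsm y hy'))
  have h3 : HasFDerivAt (fun z => Θ (φ.symm z)) (L : E →L[ℝ] E) (φ x) := by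
    have := (h1.self_of_nhds.differentiableAt (by simp)).hasFDerivAt
    convert this using 1
    ext v
    have := fderiv_comp_extChartAt_symm_self (x := x) hΘ.self_of_nhds.mdiff v
    rw [hL] at this
    exact this.symm
  obtain ⟨g, hg, hgf, hg1, hg2⟩ := exists_openPartialHomeomorph_contDiffOn h1 h3
  refine ⟨φ.trans g, ?_, ?_, ?_⟩
  · apply OpenPartialHomeomorph.mem_maximalAtlas_of_contMDiffOn
    · exact (contMDiffOn_iff_contDiffOn.2 hg1).comp
        ((contMDiffOn_of_mem_maximalAtlas (IsManifold.chart_mem_maximalAtlas x)).mono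
          (fun y hy => (OpenPartialHomeomorph.trans_source φ g ▸ hy).1))
        (fun y hy => (OpenPartialHomeomorph.trans_source φ g ▸ hy).2)
    · exact (contMDiffOn_symm_of_mem_maximalAtlas (IsManifold.chart_mem_maximalAtlas x)).comp
        ((contMDiffOn_iff_contDiffOn.2 hg2).mono
          (fun y hy => (OpenPartialHomeomorph.trans_target φ g ▸ hy).1))
        (fun y hy => (OpenPartialHomeomorph.trans_target φ g ▸ hy).2)
  · rw [OpenPartialHomeomorph.trans_source]; exact ⟨hx, hg⟩
  · intro y hy
    rw [OpenPartialHomeomorph.trans_source] at hy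
    rw [OpenPartialHomeomorph.trans_apply, hgf _ hy.2]
    exact congrArg Θ (φ.left_inv hy.1)

/-- A map to a vector space with surjective derivative is a coordinate projection in some chart. -/
theorem exists_chart_of_surjective [FiniteDimensional ℝ E] [IsManifold 𝓘(ℝ, E) ∞ N]
    (T : E ≃L[ℝ] E₂ × K) {F : N → E₂} {x : N}
    (hF : ∀ᶠ y in 𝓝 x, ContMDiffAt 𝓘(ℝ, E) 𝓘(ℝ, E₂) ∞ F y)
    (hs : Function.Surjective (modelDeriv 𝓘(ℝ, E) 𝓘(ℝ, E₂) F x)) :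
    ∃ e ∈ IsManifold.maximalAtlas 𝓘(ℝ, E) ∞ N, x ∈ e.source ∧
      ∀ y ∈ e.source, (T (e y)).1 = F y := by
  have : CompleteSpace E := FiniteDimensional.complete ℝ E
  set A := modelDeriv 𝓘(ℝ, E) 𝓘(ℝ, E₂) F x with hA
  have : FiniteDimensional ℝ (E₂ × K) := T.toLinearEquiv.finiteDimensional
  have : FiniteDimensional ℝ E₂ :=
    FiniteDimensional.of_surjective (LinearMap.fst ℝ E₂ K) LinearMap.fst_surjective
  have : FiniteDimensional ℝ K :=
    FiniteDimensional.of_surjective (LinearMap.snd ℝ E₂ K) LinearMap.snd_surjective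
  -- Rank and nullity: A is onto `E₂` and E ≅ E₂ × K, so the kernel of A has the dimension of K.
  have hdim : finrank ℝ (LinearMap.ker A.toLinearMap) = finrank ℝ K := by
    have h1 := LinearMap.finrank_range_add_finrank_ker A.toLinearMap
    have h2 : finrank ℝ (LinearMap.range A.toLinearMap) = finrank ℝ E₂ := by
      rw [LinearMap.range_eq_top.2 hs, finrank_top]
    have h3 := T.toLinearEquiv.finrank_eq
    rw [Module.finrank_prod] at h3
    omega
  -- P projects E onto the kernel of A, and B identifies that kernel with K. Hence (A, B) is
  -- injective. It is the derivative at x of (F, B ∘ φ), which therefore provides the required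
  -- coordinates.
  obtain ⟨P, hP⟩ := LinearMap.exists_leftInverse_of_injective
    (LinearMap.ker A.toLinearMap).subtype (Submodule.ker_subtype _)
  let ι := LinearEquiv.ofFinrankEq _ _ hdim
  let B : E →L[ℝ] K := LinearMap.toContinuousLinearMap (ι.toLinearMap ∘ₗ P)
  let Λ : E →ₗ[ℝ] E := T.symm.toLinearEquiv.toLinearMap ∘ₗ (A.toLinearMap.prod B.toLinearMap)
  have hΛ : Function.Injective Λ := by
    rw [← LinearMap.ker_eq_bot, LinearMap.ker_eq_bot']
    intro v hv
    have hv' : (A v, B v) = 0 := T.symm.injective (by simpa [Λ] using hv)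
    have hv1 : A v = 0 := congrArg Prod.fst hv'
    have hv2 : ι (P v) = 0 := congrArg Prod.snd hv'
    have hv3 : P v = ⟨v, hv1⟩ := LinearMap.congr_fun hP ⟨v, hv1⟩
    have hv4 : P v = 0 := by simpa using hv2
    rw [hv3] at hv4
    exact congrArg Subtype.val hv4
  let Λe : E ≃L[ℝ] E := (LinearEquiv.ofInjectiveEndo Λ hΛ).toContinuousLinearEquiv
  let φ := chartAt E x
  let Θ : N → E := fun y => T.symm (F y, B (φ y))
  have hφ : ∀ y ∈ φ.source, ContMDiffAt 𝓘(ℝ, E) 𝓘(ℝ, E) ∞ φ y := fun y hy =>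
    contMDiffAt_of_mem_maximalAtlas (IsManifold.chart_mem_maximalAtlas x) hy
  have hTs {y : N} (h : ContMDiffAt 𝓘(ℝ, E) 𝓘(ℝ, E₂) ∞ F y) (hy : y ∈ φ.source) :
      ContMDiffAt 𝓘(ℝ, E) 𝓘(ℝ, E₂ × K) ∞ (fun y => (F y, B (φ y))) y :=
    h.prodMk_space (B.contDiff.contMDiff.contMDiffAt.comp y (hφ y hy))
  have hΘ : ∀ᶠ y in 𝓝 x, ContMDiffAt 𝓘(ℝ, E) 𝓘(ℝ, E) ∞ Θ y := by
    filter_upwards [hF, chart_source_mem_nhds E x] with y h1 h2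
    exact T.symm.contDiff.contMDiff.contMDiffAt.comp y (hTs h1 h2)
  have hx := mem_chart_source E x
  have hL : modelDeriv 𝓘(ℝ, E) 𝓘(ℝ, E) Θ x = Λe := by
    ext v
    have e1 : modelDeriv 𝓘(ℝ, E) 𝓘(ℝ, E) Θ x v =
        T.symm (modelDeriv 𝓘(ℝ, E) 𝓘(ℝ, E₂ × K) (fun y => (F y, B (φ y))) x v) := by
      rw [modelDeriv_comp_apply (I' := 𝓘(ℝ, E₂ × K)) (g := T.symm)
        T.symm.contDiff.contMDiff.contMDiffAt.mdiff (hTs hF.self_of_nhds hx).mdiff,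
        modelDeriv_eq_fderiv, T.symm.fderiv]
      rfl
    have e2 : modelDeriv 𝓘(ℝ, E) 𝓘(ℝ, E₂ × K) (fun y => (F y, B (φ y))) x v = (A v, B v) := by
      have hB : MDifferentiableAt 𝓘(ℝ, E) 𝓘(ℝ, K) (fun y => B (φ y)) x :=
        (B.contDiff.contMDiff.contMDiffAt.comp x (hφ x hx)).mdiff
      rw [modelWithCornersSelf_prod, ← chartedSpaceSelf_prod,
        modelDeriv_prodMk hF.self_of_nhds.mdiff hB,
        modelDeriv_comp_apply (I' := 𝓘(ℝ, E)) (g := B) B.contDiff.contMDiff.contMDiffAt.mdiff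
          (hφ x hx).mdiff, modelDeriv_eq_fderiv, B.fderiv]
      have : modelDeriv 𝓘(ℝ, E) 𝓘(ℝ, E) φ x = ContinuousLinearMap.id ℝ E :=
        modelDeriv_extChartAt_self x
      rw [this]
      rfl
    rw [e1, e2]
    rfl
  obtain ⟨e, he, hxe, h⟩ := exists_mem_maximalAtlas_of_modelDeriv_equiv hΘ Λe hL
  refine ⟨e, he, hxe, fun y hy => ?_⟩
  rw [h y hy]
  simp [Θ]

end charts

end

noncomputable section

/-! ### Submersions and immersions -/

section submersion

variable {E F : Type*} [NormedAddCommGroup E] [NormedSpace ℝ E]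
  [NormedAddCommGroup F] [NormedSpace ℝ F]
  {N Q : Type*} [TopologicalSpace N] [ChartedSpace E N]
  [TopologicalSpace Q] [ChartedSpace F Q]

theorem modelDeriv_chart_symm_apply [IsManifold 𝓘(ℝ, E) ∞ N] {e : OpenPartialHomeomorph N E}
    (he : e ∈ IsManifold.maximalAtlas 𝓘(ℝ, E) ∞ N) {x : N} (hx : x ∈ e.source) (v : E) :
    modelDeriv 𝓘(ℝ, E) 𝓘(ℝ, E) e.symm (e x) (modelDeriv 𝓘(ℝ, E) 𝓘(ℝ, E) e x v) = v := by
  rw [← modelDeriv_comp_apply (contMDiffAt_symm_of_mem_maximalAtlas he (e.map_source hx)).mdiff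
    (contMDiffAt_of_mem_maximalAtlas he hx).mdiff, modelDeriv_of_eventuallyEq_id]
  · rfl
  · filter_upwards [e.open_source.mem_nhds hx] with y hy using e.left_inv hy

theorem modelDeriv_chart_apply_symm [IsManifold 𝓘(ℝ, E) ∞ N] {e : OpenPartialHomeomorph N E}
    (he : e ∈ IsManifold.maximalAtlas 𝓘(ℝ, E) ∞ N) {x : N} (hx : x ∈ e.source) (v : E) :
    modelDeriv 𝓘(ℝ, E) 𝓘(ℝ, E) e x (modelDeriv 𝓘(ℝ, E) 𝓘(ℝ, E) e.symm (e x) v) = v := by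
  have h : MDifferentiableAt 𝓘(ℝ, E) 𝓘(ℝ, E) e (e.symm (e x)) := by
    rw [e.left_inv hx]; exact (contMDiffAt_of_mem_maximalAtlas he hx).mdiff
  have := modelDeriv_comp_apply h
    (contMDiffAt_symm_of_mem_maximalAtlas he (e.map_source hx)).mdiff v
  rw [e.left_inv hx] at this
  rw [← this, modelDeriv_of_eventuallyEq_id]
  · rfl
  · filter_upwards [e.open_target.mem_nhds (e.map_source hx)] with y hy using e.right_inv hy

/-- Charts `e` and `ψ` in which `f` is a linear projection. -/
structure SubmersionChart.{u, v, w, z} (E : Type u) (F : Type v) [NormedAddCommGroup E]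
    [NormedSpace ℝ E] [NormedAddCommGroup F] [NormedSpace ℝ F]
    {N : Type w} {Q : Type z} [TopologicalSpace N] [ChartedSpace E N]
    [TopologicalSpace Q] [ChartedSpace F Q] (f : N → Q) (x : N) where
  K : Type u
  [normedAddCommGroup : NormedAddCommGroup K]
  [normedSpace : NormedSpace ℝ K]
  e : OpenPartialHomeomorph N E
  ψ : OpenPartialHomeomorph Q F
  T : E ≃L[ℝ] F × K
  e_mem : e ∈ IsManifold.maximalAtlas 𝓘(ℝ, E) ∞ N
  ψ_mem : ψ ∈ IsManifold.maximalAtlas 𝓘(ℝ, F) ∞ Q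
  mem_source : x ∈ e.source
  map_source : ∀ y ∈ e.source, f y ∈ ψ.source
  proj : ∀ y ∈ e.source, (T (e y)).1 = ψ (f y)

attribute [instance] SubmersionChart.normedAddCommGroup SubmersionChart.normedSpace

variable {f : N → Q}

theorem Manifold.IsSubmersion.exists_chart (h : Manifold.IsSubmersion 𝓘(ℝ, E) 𝓘(ℝ, F) ∞ f) (x : N) :
    Nonempty (SubmersionChart E F f x) := by
  have hx := h.isSubmersionAt x
  refine ⟨{ K := hx.complement, e := hx.domChart, ψ := hx.codChart, T := hx.equiv
            e_mem := hx.domChart_mem_maximalAtlas, ψ_mem := hx.codChart_mem_maximalAtlas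
            mem_source := hx.mem_domChart_source
            map_source := hx.source_subset_preimage_source
            proj := fun y hy => ?_ }⟩
  have hm : hx.domChart y ∈ (hx.domChart.extend 𝓘(ℝ, E)).target := by
    simpa using hx.domChart.map_source hy
  have := hx.writtenInCharts hm
  simp only [Function.comp_apply, OpenPartialHomeomorph.extend_coe,
    OpenPartialHomeomorph.extend_coe_symm, modelWithCornersSelf_coe,
    modelWithCornersSelf_coe_symm, id] at this
  rw [hx.domChart.left_inv hy] at this
  exact this.symm

namespace SubmersionChart

variable {x : N} (c : SubmersionChart E F f x)

theorem modelDeriv_proj [IsManifold 𝓘(ℝ, E) ∞ N] [IsManifold 𝓘(ℝ, F) ∞ Q] {y : N}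
    (hy : y ∈ c.e.source) (hf : MDifferentiableAt 𝓘(ℝ, E) 𝓘(ℝ, F) f y) (v : E) :
    (c.T (modelDeriv 𝓘(ℝ, E) 𝓘(ℝ, E) c.e y v)).1 =
      modelDeriv 𝓘(ℝ, F) 𝓘(ℝ, F) c.ψ (f y) (modelDeriv 𝓘(ℝ, E) 𝓘(ℝ, F) f y v) := by
  have he := (contMDiffAt_of_mem_maximalAtlas c.e_mem hy).mdiff
  have hψ := (contMDiffAt_of_mem_maximalAtlas c.ψ_mem (c.map_source y hy)).mdiff
  let P : E →L[ℝ] F := (ContinuousLinearMap.fst ℝ F c.K).comp (c.T : E →L[ℝ] F × c.K)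
  have h1 := modelDeriv_comp_apply (g := P) P.contDiff.contMDiff.contMDiffAt.mdiff he v
  rw [modelDeriv_eq_fderiv, P.fderiv] at h1
  rw [← modelDeriv_comp_apply hψ hf]
  refine h1.symm.trans (congrArg (fun L : E →L[ℝ] F => L v) (modelDeriv_congr ?_))
  filter_upwards [c.e.open_source.mem_nhds hy] with z hz using c.proj z hz

/-- The arrow near `x` over `m` that has the same coordinates along the fibre as `y`. -/
def lift (p : N × Q) : N := c.e.symm (c.T.symm (c.ψ p.2, (c.T (c.e p.1)).2))

theorem lift_self {y : N} (hy : y ∈ c.e.source) : c.lift (y, f y) = y := by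
  unfold lift
  rw [← c.proj y hy, Prod.mk.eta, c.T.symm_apply_apply, c.e.left_inv hy]

/-- The points where the lift is defined. -/
def dom : Set (N × Q) :=
  {p | p.1 ∈ c.e.source ∧ p.2 ∈ c.ψ.source ∧ c.T.symm (c.ψ p.2, (c.T (c.e p.1)).2) ∈ c.e.target}

theorem mem_dom {y : N} (hy : y ∈ c.e.source) : (y, f y) ∈ c.dom := by
  refine ⟨hy, c.map_source y hy, ?_⟩
  rw [← c.proj y hy, Prod.mk.eta, c.T.symm_apply_apply]
  exact c.e.map_source hy

theorem dom_mem_nhds {p : N × Q} (hp : p ∈ c.dom) : c.dom ∈ 𝓝 p := by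
  have h1 : ContinuousAt (fun p : N × Q => c.T.symm (c.ψ p.2, (c.T (c.e p.1)).2)) p := by
    have a1 : ContinuousAt (fun p : N × Q => c.e p.1) p :=
      (c.e.continuousAt hp.1).comp continuousAt_fst
    have a2 : ContinuousAt (fun p : N × Q => c.ψ p.2) p :=
      ContinuousAt.comp (f := Prod.snd) (c.ψ.continuousAt hp.2.1) continuousAt_snd
    exact c.T.symm.continuous.continuousAt.comp
      (a2.prodMk (continuous_snd.continuousAt.comp (c.T.continuous.continuousAt.comp a1)))
  filter_upwards [continuousAt_fst (c.e.open_source.mem_nhds hp.1),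
    continuousAt_snd (c.ψ.open_source.mem_nhds hp.2.1),
    h1 (c.e.open_target.mem_nhds hp.2.2)] with q h2 h3 h4 using ⟨h2, h3, h4⟩

theorem apply_lift {p : N × Q} (hp : p ∈ c.dom) : f (c.lift p) = p.2 := by
  have h1 : c.lift p ∈ c.e.source := c.e.map_target hp.2.2
  apply c.ψ.injOn (c.map_source _ h1) hp.2.1
  rw [← c.proj _ h1]
  unfold lift
  rw [c.e.right_inv hp.2.2, c.T.apply_symm_apply]

theorem contMDiffAt_lift [IsManifold 𝓘(ℝ, E) ∞ N] [IsManifold 𝓘(ℝ, F) ∞ Q] {p : N × Q}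
    (hp : p ∈ c.dom) : ContMDiffAt (𝓘(ℝ, E).prod 𝓘(ℝ, F)) 𝓘(ℝ, E) ∞ c.lift p := by
  have a1 : ContMDiffAt (𝓘(ℝ, E).prod 𝓘(ℝ, F)) 𝓘(ℝ, E) ∞ (fun p : N × Q => c.e p.1) p :=
    (contMDiffAt_of_mem_maximalAtlas c.e_mem hp.1).comp p contMDiffAt_fst
  have a2 : ContMDiffAt (𝓘(ℝ, E).prod 𝓘(ℝ, F)) 𝓘(ℝ, F) ∞ (fun p : N × Q => c.ψ p.2) p :=
    ContMDiffAt.comp (f := Prod.snd) p (contMDiffAt_of_mem_maximalAtlas c.ψ_mem hp.2.1)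
      contMDiffAt_snd
  have a3 : ContMDiffAt (𝓘(ℝ, E).prod 𝓘(ℝ, F)) 𝓘(ℝ, c.K) ∞
      (fun p : N × Q => (c.T (c.e p.1)).2) p :=
    (((ContinuousLinearMap.snd ℝ F c.K).comp
      (c.T : E →L[ℝ] F × c.K)).contDiff.contMDiff.contMDiffAt).comp p a1
  exact (contMDiffAt_symm_of_mem_maximalAtlas c.e_mem hp.2.2).comp p
    ((c.T.symm.contDiff.contMDiff.contMDiffAt).comp p (a2.prodMk_space a3))

end SubmersionChart

/-- In adapted charts f is a linear projection, so a tangent vector is lifted by giving it zero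
component along the fibre. -/
theorem Manifold.IsSubmersion.modelDeriv_surjective [IsManifold 𝓘(ℝ, E) ∞ N]
    [IsManifold 𝓘(ℝ, F) ∞ Q] (h : Manifold.IsSubmersion 𝓘(ℝ, E) 𝓘(ℝ, F) ∞ f) (x : N) :
    Function.Surjective (modelDeriv 𝓘(ℝ, E) 𝓘(ℝ, F) f x) := by
  obtain ⟨c⟩ := h.exists_chart x
  intro w
  refine ⟨modelDeriv 𝓘(ℝ, E) 𝓘(ℝ, E) c.e.symm (c.e x)
    (c.T.symm (modelDeriv 𝓘(ℝ, F) 𝓘(ℝ, F) c.ψ (f x) w, 0)), ?_⟩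
  have h1 := c.modelDeriv_proj c.mem_source (h.contMDiff.contMDiffAt).mdiff
    (modelDeriv 𝓘(ℝ, E) 𝓘(ℝ, E) c.e.symm (c.e x)
    (c.T.symm (modelDeriv 𝓘(ℝ, F) 𝓘(ℝ, F) c.ψ (f x) w, 0)))
  rw [modelDeriv_chart_apply_symm c.e_mem c.mem_source, c.T.apply_symm_apply] at h1
  have h2 := congrArg (modelDeriv 𝓘(ℝ, F) 𝓘(ℝ, F) c.ψ.symm (c.ψ (f x))) h1
  rw [modelDeriv_chart_symm_apply c.ψ_mem (c.map_source x c.mem_source),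
    modelDeriv_chart_symm_apply c.ψ_mem (c.map_source x c.mem_source)] at h2
  exact h2.symm

/-- `exists_chart_of_surjective` is applied to f followed by a chart of Q. The complement K is the
same at all points; only the splitting of E may vary with the point. -/
theorem isSubmersion_of_surjective [FiniteDimensional ℝ E] [IsManifold 𝓘(ℝ, E) ∞ N]
    [IsManifold 𝓘(ℝ, F) ∞ Q] {K : Type*} [NormedAddCommGroup K] [NormedSpace ℝ K]
    (hT : N → E ≃L[ℝ] F × K) (hf : ContMDiff 𝓘(ℝ, E) 𝓘(ℝ, F) ∞ f)
    (hs : ∀ x, Function.Surjective (modelDeriv 𝓘(ℝ, E) 𝓘(ℝ, F) f x)) :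
    Manifold.IsSubmersion 𝓘(ℝ, E) 𝓘(ℝ, F) ∞ f := by
  apply Manifold.IsSubmersionOfComplement.isSubmersion (F := K)
  intro x
  have hψ := IsManifold.chart_mem_maximalAtlas (I := 𝓘(ℝ, F)) (n := ∞) (f x)
  have h1 : ∀ᶠ y in 𝓝 x, ContMDiffAt 𝓘(ℝ, E) 𝓘(ℝ, F) ∞ (fun y => chartAt F (f x) (f y)) y := by
    filter_upwards [hf.continuous.continuousAt (chart_source_mem_nhds F (f x))] with y hy
    exact (contMDiffAt_of_mem_maximalAtlas hψ hy).comp y hf.contMDiffAt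
  obtain ⟨e, he, hx, h⟩ := exists_chart_of_surjective (hT x) h1 (by
    intro w
    obtain ⟨u, hu⟩ := hs x (modelDeriv 𝓘(ℝ, F) 𝓘(ℝ, F) (chartAt F (f x)).symm
      (chartAt F (f x) (f x)) w)
    refine ⟨u, ?_⟩
    rw [modelDeriv_comp_apply (contMDiffAt_of_mem_maximalAtlas hψ (mem_chart_source F (f x))).mdiff
      hf.contMDiffAt.mdiff, hu, modelDeriv_chart_apply_symm hψ (mem_chart_source F (f x))])
  refine Manifold.IsSubmersionAtOfComplement.mk_of_continuousAt hf.continuous.continuousAt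
    (hT x) e (chartAt F (f x)) hx (mem_chart_source F (f x)) he hψ ?_
  intro y hy
  have hy' : y ∈ e.target := by simpa using hy
  have := h _ (e.map_target hy')
  rw [e.right_inv hy'] at this
  exact this.symm

/-- A submersion has local smooth lifts `L (y, q)` of `q` that fix the points `y` over `q`. -/
theorem Manifold.IsSubmersion.exists_lift [IsManifold 𝓘(ℝ, E) ∞ N] [IsManifold 𝓘(ℝ, F) ∞ Q]
    (hf : Manifold.IsSubmersion 𝓘(ℝ, E) 𝓘(ℝ, F) ∞ f) (x : N) :
    ∃ L : N × Q → N, ContMDiffAt (𝓘(ℝ, E).prod 𝓘(ℝ, F)) 𝓘(ℝ, E) ∞ L (x, f x) ∧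
      (∀ᶠ p in 𝓝 (x, f x), f (L p) = p.2) ∧ ∀ᶠ y in 𝓝 x, L (y, f y) = y := by
  obtain ⟨c⟩ := hf.exists_chart x
  refine ⟨c.lift, c.contMDiffAt_lift (c.mem_dom c.mem_source), ?_, ?_⟩
  · filter_upwards [c.dom_mem_nhds (c.mem_dom c.mem_source)] with p hp using c.apply_lift hp
  · filter_upwards [c.e.open_source.mem_nhds c.mem_source] with y hy using c.lift_self hy

/-- A submersion has local smooth retractions onto its fibres. -/
theorem Manifold.IsSubmersion.exists_retraction [IsManifold 𝓘(ℝ, E) ∞ N] [IsManifold 𝓘(ℝ, F) ∞ Q]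
    (hf : Manifold.IsSubmersion 𝓘(ℝ, E) 𝓘(ℝ, F) ∞ f) (x : N) :
    ∃ r : N → N, ContMDiffAt 𝓘(ℝ, E) 𝓘(ℝ, E) ∞ r x ∧ r x = x ∧ (∀ᶠ y in 𝓝 x, f (r y) = f x) ∧
      ∀ v, modelDeriv 𝓘(ℝ, E) 𝓘(ℝ, F) f x v = 0 → modelDeriv 𝓘(ℝ, E) 𝓘(ℝ, E) r x v = v := by
  obtain ⟨L, hL, hLf, hLx⟩ := hf.exists_lift x
  -- Lifting the constant value f(x) moves every nearby y into the fibre of x along the chart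
  -- coordinates.
  refine ⟨fun y => L (y, f x), ?_, hLx.self_of_nhds, ?_, fun v hv => ?_⟩
  · exact ContMDiffAt.comp (g := L) (f := fun y => (y, f x)) (I' := 𝓘(ℝ, E).prod 𝓘(ℝ, F)) x hL
      (contMDiffAt_id.prodMk contMDiffAt_const)
  · have : ContinuousAt (fun y : N => (y, f x)) x := by fun_prop
    exact this.eventually hLf
  -- The map y ↦ L(y, f(y)) is locally the identity. For vertical v the second argument does not
  -- contribute to its derivative, which therefore equals that of y ↦ L(y, f(x)).
  · have h1 : modelDeriv 𝓘(ℝ, E) 𝓘(ℝ, E) (fun y => L (y, f y)) x v = v := by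
      rw [modelDeriv_of_eventuallyEq_id hLx]; rfl
    rw [modelDeriv_comp_apply (I' := 𝓘(ℝ, E).prod 𝓘(ℝ, F)) (f := fun y => (y, f y)) hL.mdiff
      (mdifferentiableAt_id.prodMk hf.contMDiff.contMDiffAt.mdiff),
      modelDeriv_prodMk (f := fun y => y) mdifferentiableAt_id hf.contMDiff.contMDiffAt.mdiff, hv,
      modelDeriv_prod_apply hL.mdiff, map_zero, add_zero] at h1
    rwa [show modelDeriv 𝓘(ℝ, E) 𝓘(ℝ, E) (fun y : N => y) x v = v by
      rw [modelDeriv_id]; rfl] at h1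

/-- The derivative along a fibre of `f` of a map `φ` that is defined on the fibre is the derivative
of any extension of `φ`. -/
theorem mfderivWithin_fibre [IsManifold 𝓘(ℝ, E) ∞ N] [IsManifold 𝓘(ℝ, F) ∞ Q]
    (hf : Manifold.IsSubmersion 𝓘(ℝ, E) 𝓘(ℝ, F) ∞ f)
    {E' H' N' : Type*} [NormedAddCommGroup E'] [NormedSpace ℝ E'] [TopologicalSpace H']
    [TopologicalSpace N'] [ChartedSpace H' N'] {I' : ModelWithCorners ℝ E' H'}
    {φ φ' : N → N'} {x : N} (hφ' : MDifferentiableAt 𝓘(ℝ, E) I' φ' x)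
    (h : ∀ᶠ y in 𝓝 x, f y = f x → φ y = φ' y) {v : E}
    (hv : modelDeriv 𝓘(ℝ, E) 𝓘(ℝ, F) f x v = 0) :
    (mfderivWithin 𝓘(ℝ, E) I' φ (f ⁻¹' {f x}) x : E →L[ℝ] E') v =
      modelDeriv 𝓘(ℝ, E) I' φ' x v := by
  obtain ⟨r, hrs, hrx, hrf, hr⟩ := hf.exists_retraction x
  have hrv := hr v hv
  set S := f ⁻¹' {f x} with hS
  have hxS : x ∈ S := rfl
  have hφS : φ =ᶠ[𝓝[S] x] φ' := eventually_nhdsWithin_iff.2 h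
  have hφd : MDifferentiableWithinAt 𝓘(ℝ, E) I' φ S x :=
    hφ'.mdifferentiableWithinAt.congr_of_eventuallyEq hφS (h.self_of_nhds rfl)
  obtain ⟨A, hA⟩ : ∃ A : E →L[ℝ] E', A = mfderivWithin 𝓘(ℝ, E) I' φ S x := ⟨_, rfl⟩
  rw [← hA]
  have h1 : HasMFDerivWithinAt 𝓘(ℝ, E) I' φ S (r x) A := by
    rw [hrx, hA]; exact hφd.hasMFDerivWithinAt
  have h2 : HasMFDerivWithinAt 𝓘(ℝ, E) 𝓘(ℝ, E) r (r ⁻¹' S) x (mfderiv 𝓘(ℝ, E) 𝓘(ℝ, E) r x) :=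
    hrs.mdiff.hasMFDerivAt.hasMFDerivWithinAt
  -- Since r maps a whole neighbourhood into the fibre, the derivative within the fibre, composed
  -- with Tr, is a genuine derivative at x. This compares it with φ' ∘ r, and Tr fixes v.
  have h3 := (HasMFDerivWithinAt.comp x h1 h2 subset_rfl).hasMFDerivAt hrf
  have hφ'r : MDifferentiableAt 𝓘(ℝ, E) I' φ' (r x) := by rw [hrx]; exact hφ'
  have h4 : modelDeriv 𝓘(ℝ, E) I' (fun y => φ' (r y)) x =
      A.comp (modelDeriv 𝓘(ℝ, E) 𝓘(ℝ, E) r x) := by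
    refine (modelDeriv_congr (g := fun y => φ (r y)) ?_).trans h3.mfderiv
    have hrc : Filter.Tendsto r (𝓝 x) (𝓝 x) := by
      have := hrs.continuousAt; rwa [ContinuousAt, hrx] at this
    filter_upwards [hrf, hrc.eventually h] with y h5 h6
    exact (h6 h5).symm
  have h5 := congrArg (fun L => L v) h4
  rw [modelDeriv_comp hφ'r hrs.mdiff, ContinuousLinearMap.comp_apply, hrv, hrx] at h5
  rw [h5]
  exact congrArg A hrv.symm

/-- Two maps that agree on a fibre of `f` have the same derivative along the fibre. -/
theorem modelDeriv_eq_of_fibre [IsManifold 𝓘(ℝ, E) ∞ N] [IsManifold 𝓘(ℝ, F) ∞ Q]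
    (hf : Manifold.IsSubmersion 𝓘(ℝ, E) 𝓘(ℝ, F) ∞ f)
    {E' H' N' : Type*} [NormedAddCommGroup E'] [NormedSpace ℝ E'] [TopologicalSpace H']
    [TopologicalSpace N'] [ChartedSpace H' N'] {I' : ModelWithCorners ℝ E' H'}
    {φ φ' : N → N'} {x : N} (hφ : MDifferentiableAt 𝓘(ℝ, E) I' φ x)
    (hφ' : MDifferentiableAt 𝓘(ℝ, E) I' φ' x)
    (h : ∀ᶠ y in 𝓝 x, f y = f x → φ y = φ' y) {v : E}
    (hv : modelDeriv 𝓘(ℝ, E) 𝓘(ℝ, F) f x v = 0) :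
    modelDeriv 𝓘(ℝ, E) I' φ x v = modelDeriv 𝓘(ℝ, E) I' φ' x v :=
  (mfderivWithin_fibre hf hφ (.of_forall fun _ _ => rfl) hv).symm.trans
    (mfderivWithin_fibre hf hφ' h hv)

end submersion

section immersion

variable {E F H : Type*} [NormedAddCommGroup E] [NormedSpace ℝ E]
  [NormedAddCommGroup F] [NormedSpace ℝ F] [TopologicalSpace H] {J : ModelWithCorners ℝ F H}
  {S N : Type*} [TopologicalSpace S] [ChartedSpace E S]
  [TopologicalSpace N] [ChartedSpace H N]

/-- An immersion has local smooth left inverses. -/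
theorem Manifold.IsImmersion.exists_leftInverse {f : S → N}
    (h : Manifold.IsImmersion 𝓘(ℝ, E) J ∞ f) (x : S) :
    ∃ ρ : N → S, ContMDiffAt J 𝓘(ℝ, E) ∞ ρ (f x) ∧ ∀ᶠ y in 𝓝 x, ρ (f y) = y := by
  have hx := h.isImmersionAt x
  let P : F →L[ℝ] E := (ContinuousLinearMap.fst ℝ E hx.complement).comp
    (hx.equiv.symm : F →L[ℝ] E × hx.complement)
  -- In the charts of an immersion f is u ↦ (u, 0), so the projection P recovers u.
  have key : ∀ y ∈ hx.domChart.source, P (hx.codChart.extend J (f y)) = hx.domChart y := by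
    intro y hy
    have hm : hx.domChart y ∈ (hx.domChart.extend 𝓘(ℝ, E)).target := by
      simpa using hx.domChart.map_source hy
    have := hx.writtenInCharts hm
    simp only [Function.comp_apply, OpenPartialHomeomorph.extend_coe_symm,
      modelWithCornersSelf_coe_symm, id] at this
    rw [hx.domChart.left_inv hy] at this
    rw [this]
    simp [P]
  refine ⟨fun y => hx.domChart.symm (P (hx.codChart.extend J y)), ?_, ?_⟩
  · have h1 : ContMDiffAt J 𝓘(ℝ, F) ∞ (hx.codChart.extend J) (f x) :=
      (hx.codChart.contMDiffOn_extend hx.codChart_mem_maximalAtlas).contMDiffAt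
        (hx.codChart.open_source.mem_nhds hx.mem_codChart_source)
    have h2 : ContMDiffAt 𝓘(ℝ, E) 𝓘(ℝ, E) ∞ hx.domChart.symm (P (hx.codChart.extend J (f x))) := by
      rw [key x hx.mem_domChart_source]
      exact contMDiffAt_symm_of_mem_maximalAtlas hx.domChart_mem_maximalAtlas
        (hx.domChart.map_source hx.mem_domChart_source)
    exact h2.comp (f x) (P.contDiff.contMDiff.contMDiffAt.comp (f x) h1)
  · filter_upwards [hx.domChart.open_source.mem_nhds hx.mem_domChart_source] with y hy
    rw [key y hy, hx.domChart.left_inv hy]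

end immersion

end

noncomputable section

/-! ### Submanifolds given by slice charts -/

section slice

variable {E E₁ E₂ : Type*} [NormedAddCommGroup E] [NormedSpace ℝ E]
  [NormedAddCommGroup E₁] [NormedSpace ℝ E₁] [NormedAddCommGroup E₂] [NormedSpace ℝ E₂]
  {N : Type*} [TopologicalSpace N] {S : Set N}

open Classical in
/-- The chart of `S` that is induced by a chart `e` of `N` in which `S` is a linear subspace. -/
def sliceChart (T : E ≃L[ℝ] E₂ × E₁) (e : OpenPartialHomeomorph N E) (x : S)
    (he : ∀ y ∈ e.source, y ∈ S ↔ (T (e y)).1 = 0) : OpenPartialHomeomorph S E₁ where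
  toFun s := (T (e s)).2
  invFun u := if h : T.symm (0, u) ∈ e.target then
    ⟨e.symm (T.symm (0, u)), (he _ (e.map_target h)).2 (by rw [e.right_inv h]; simp)⟩ else x
  source := Subtype.val ⁻¹' e.source
  target := {u | T.symm (0, u) ∈ e.target}
  map_source' s hs := by
    have h1 : ((0 : E₂), (T (e s)).2) = T (e s) := Prod.ext ((he _ hs).1 s.2).symm rfl
    simp only [mem_ofPred_eq, h1, T.symm_apply_apply]
    exact e.map_source hs
  map_target' u hu := by
    simp only [mem_ofPred_eq] at hu
    simpa only [hu, dite_true, mem_preimage] using e.map_target hu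
  left_inv' s hs := by
    have h1 : ((0 : E₂), (T (e s)).2) = T (e s) := Prod.ext ((he _ hs).1 s.2).symm rfl
    have h2 : T.symm (0, (T (e s)).2) ∈ e.target := by
      rw [h1, T.symm_apply_apply]; exact e.map_source hs
    rw [dif_pos h2]
    apply Subtype.ext
    simp only [h1, T.symm_apply_apply]
    exact e.left_inv hs
  right_inv' u hu := by
    simp only [mem_ofPred_eq] at hu
    simp only [hu, dite_true, e.right_inv hu, T.apply_symm_apply]
  open_source := e.open_source.preimage continuous_subtype_val
  open_target := e.open_target.preimage (by fun_prop)
  continuousOn_toFun := by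
    have h1 : ContinuousOn (fun s : S => e s) (Subtype.val ⁻¹' e.source) :=
      e.continuousOn.comp continuous_subtype_val.continuousOn fun _ h => h
    exact (continuous_snd.comp T.continuous).comp_continuousOn h1
  continuousOn_invFun := by
    rw [Topology.IsInducing.subtypeVal.continuousOn_iff]
    have h1 : ContinuousOn (fun u : E₁ => e.symm (T.symm (0, u)))
        {u | T.symm (0, u) ∈ e.target} :=
      e.continuousOn_symm.comp (Continuous.continuousOn (by fun_prop)) fun _ h => h
    refine h1.congr fun u hu => ?_
    simp only [mem_ofPred_eq] at hu
    simp only [Function.comp_apply, hu, dite_true]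

theorem val_sliceChart_symm (T : E ≃L[ℝ] E₂ × E₁) (e : OpenPartialHomeomorph N E) (x : S)
    (he : ∀ y ∈ e.source, y ∈ S ↔ (T (e y)).1 = 0) {u : E₁}
    (hu : u ∈ (sliceChart T e x he).target) :
    (((sliceChart T e x he).symm u : S) : N) = e.symm (T.symm (0, u)) := by
  have hu' : T.symm (0, u) ∈ e.target := hu
  change (((sliceChart T e x he).toPartialEquiv.invFun u : S) : N) = _
  simp only [sliceChart, hu', dite_true]

variable [ChartedSpace E N]

/-- A subset with slice charts is an embedded submanifold. -/
theorem exists_isSmoothEmbedding_of_slice [IsManifold 𝓘(ℝ, E) ∞ N]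
    (h : ∀ x ∈ S, ∃ (T : E ≃L[ℝ] E₂ × E₁), ∃ e ∈ IsManifold.maximalAtlas 𝓘(ℝ, E) ∞ N,
      x ∈ e.source ∧ ∀ y ∈ e.source, y ∈ S ↔ (T (e y)).1 = 0) :
    ∃ (_ : ChartedSpace E₁ S) (_ : IsManifold 𝓘(ℝ, E₁) ∞ S),
      Manifold.IsSmoothEmbedding 𝓘(ℝ, E₁) 𝓘(ℝ, E) ∞ (Subtype.val : S → N) := by
  choose T' e' he' hx' hS' using h
  let T (x : S) := T' x x.2
  let e (x : S) := e' x x.2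
  have he (x : S) : e x ∈ IsManifold.maximalAtlas 𝓘(ℝ, E) ∞ N := he' x x.2
  have hx (x : S) : (x : N) ∈ (e x).source := hx' x x.2
  have hS (x : S) : ∀ y ∈ (e x).source, y ∈ S ↔ (T x (e x y)).1 = 0 := hS' x x.2
  let ch (x : S) := sliceChart (T x) (e x) x (hS x)
  let _ : ChartedSpace E₁ S :=
    { atlas := range ch
      chartAt := ch
      mem_chart_source := fun x => hx x
      chart_mem_atlas := fun x => mem_range_self x }
  have hM : IsManifold 𝓘(ℝ, E₁) ∞ S := by
    apply isManifold_of_contDiffOn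
    rintro _ _ ⟨x, rfl⟩ ⟨y, rfl⟩
    simp only [modelWithCornersSelf_coe, modelWithCornersSelf_coe_symm, range_id, preimage_id,
      inter_univ, Function.comp_id, Function.id_comp]
    intro u hu
    rw [OpenPartialHomeomorph.trans_source] at hu
    have hu1 : u ∈ (ch x).target := hu.1
    have hv := val_sliceChart_symm (T x) (e x) x (hS x) hu1
    have hu2 : (e x).symm ((T x).symm (0, u)) ∈ (e y).source := by
      rw [← hv]; exact hu.2
    -- A transition map between slice charts is an ambient transition map, restricted to the slice 0
    -- × E₁ and projected to E₁.
    have hi : ContDiffAt ℝ ∞ (fun u : E₁ => (T x).symm ((0 : E₂), u)) u :=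
      (T x).symm.contDiff.contDiffAt.comp u (contDiffAt_const.prodMk contDiffAt_id)
    have h1 : ContDiffAt ℝ ∞ (fun w => (e y) ((e x).symm w)) ((T x).symm (0, u)) :=
      contMDiffAt_iff_contDiffAt.1 ((contMDiffAt_of_mem_maximalAtlas (he y) hu2).comp _
        (contMDiffAt_symm_of_mem_maximalAtlas (he x) hu1))
    have h2 : ContDiffAt ℝ ∞
        (fun u : E₁ => (T y ((e y) ((e x).symm ((T x).symm (0, u))))).2) u :=
      (contDiff_snd.comp (T y).contDiff).contDiffAt.comp u (ContDiffAt.comp (g := fun w => (e y) ((e x).symm w))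
          (f := fun u : E₁ => (T x).symm ((0 : E₂), u)) u h1 hi)
    refine h2.contDiffWithinAt.congr_of_mem (fun w hw => ?_) hu
    rw [OpenPartialHomeomorph.trans_source] at hw
    change (T y (e y ((ch x).symm w : S))).2 = _
    rw [val_sliceChart_symm (T x) (e x) x (hS x) hw.1]
  refine ⟨inferInstance, hM, ?_, Topology.IsEmbedding.subtypeVal⟩
  apply Manifold.IsImmersionOfComplement.isImmersion (F := E₂)
  intro x
  -- The normal form of an immersion is u ↦ (u, 0), whereas T lists the equations first; this
  -- accounts for the exchange of factors.
  refine Manifold.IsImmersionAtOfComplement.mk_of_continuousAt continuous_subtype_val.continuousAt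
    ((ContinuousLinearEquiv.prodComm ℝ E₁ E₂).trans (T x).symm) (ch x) (e x) (hx x) (hx x)
    (IsManifold.chart_mem_maximalAtlas x) (he x) ?_
  intro u hu
  have hu' : u ∈ (ch x).target := by simpa using hu
  change e x ((ch x).symm u : S) = (T x).symm (0, u)
  rw [val_sliceChart_symm (T x) (e x) x (hS x) hu']
  exact (e x).right_inv hu'

/-- A chart in which F is a linear projection becomes a slice chart once it is restricted to an open
set on which S is the zero set of F. -/
theorem exists_isSmoothEmbedding_of_surjective [FiniteDimensional ℝ E] [IsManifold 𝓘(ℝ, E) ∞ N]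
    (h : ∀ x ∈ S, Nonempty (E ≃L[ℝ] E₂ × E₁) ∧ ∃ F : N → E₂,
      (∀ᶠ y in 𝓝 x, ContMDiffAt 𝓘(ℝ, E) 𝓘(ℝ, E₂) ∞ F y) ∧
      Function.Surjective (modelDeriv 𝓘(ℝ, E) 𝓘(ℝ, E₂) F x) ∧ ∀ᶠ y in 𝓝 x, y ∈ S ↔ F y = 0) :
    ∃ (_ : ChartedSpace E₁ S) (_ : IsManifold 𝓘(ℝ, E₁) ∞ S),
      Manifold.IsSmoothEmbedding 𝓘(ℝ, E₁) 𝓘(ℝ, E) ∞ (Subtype.val : S → N) := by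
  apply exists_isSmoothEmbedding_of_slice (E₂ := E₂)
  intro x hx
  obtain ⟨⟨T⟩, F, hF, hs, hS⟩ := h x hx
  obtain ⟨e, he, hxe, hy⟩ := exists_chart_of_surjective T hF hs
  obtain ⟨U, hU, hUo, hxU⟩ := eventually_nhds_iff.1 hS
  refine ⟨T, e.restr U, ?_, ?_, ?_⟩
  · exact restr_mem_maximalAtlas _ he hUo
  · simpa [hUo.interior_eq] using ⟨hxe, hxU⟩
  · intro y hy'
    have hy'' : y ∈ e.source ∩ U := by simpa [hUo.interior_eq] using hy'
    rw [hU y hy''.2]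
    have := hy y hy''.1
    rw [← this]
    rfl

end slice

end

noncomputable section

/-! ### Maps into embedded submanifolds -/

section embedded

variable {F E H : Type*} [NormedAddCommGroup F] [NormedSpace ℝ F]
  [NormedAddCommGroup E] [NormedSpace ℝ E] [TopologicalSpace H] {J : ModelWithCorners ℝ E H}
  {N : Type*} [TopologicalSpace N] [ChartedSpace H N] {S : Set N} [ChartedSpace F S]
  {E' H' P : Type*} [NormedAddCommGroup E'] [NormedSpace ℝ E'] [TopologicalSpace H']
  {I : ModelWithCorners ℝ E' H'} [TopologicalSpace P] [ChartedSpace H' P]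

namespace Manifold.IsSmoothEmbedding

theorem exists_leftInverse (h : IsSmoothEmbedding 𝓘(ℝ, F) J ∞ (Subtype.val : S → N)) (x : S) :
    ∃ ρ : N → S, ContMDiffAt J 𝓘(ℝ, F) ∞ ρ x ∧ ∀ᶠ y : S in 𝓝 x, ρ y = y :=
  h.isImmersion.exists_leftInverse x

/-- S carries the subspace topology, so f is continuous. Near the given point f is then the
composition of its smooth ambient version with a smooth local left inverse ρ of the inclusion. -/
theorem contMDiffWithinAt_of_val (h : IsSmoothEmbedding 𝓘(ℝ, F) J ∞ (Subtype.val : S → N))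
    {f : P → S} {s : Set P} {x : P} (hf : ContMDiffWithinAt I J ∞ (fun p => (f p : N)) s x) :
    ContMDiffWithinAt I 𝓘(ℝ, F) ∞ f s x := by
  obtain ⟨ρ, hρ, hρf⟩ := h.exists_leftInverse (f x)
  have hc : ContinuousWithinAt f s x :=
    Topology.IsInducing.subtypeVal.continuousWithinAt_iff.2 hf.continuousWithinAt
  have h1 : ContMDiffWithinAt I 𝓘(ℝ, F) ∞ (fun p => ρ (f p)) s x := hρ.comp_contMDiffWithinAt x hf
  exact h1.congr_of_eventuallyEq ((hc.eventually hρf).mono fun y hy => hy.symm)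
    hρf.self_of_nhds.symm

theorem contMDiffAt_of_val (h : IsSmoothEmbedding 𝓘(ℝ, F) J ∞ (Subtype.val : S → N))
    {f : P → S} {x : P} (hf : ContMDiffAt I J ∞ (fun p => (f p : N)) x) :
    ContMDiffAt I 𝓘(ℝ, F) ∞ f x :=
  h.contMDiffWithinAt_of_val hf

theorem contMDiffAt_val (h : IsSmoothEmbedding 𝓘(ℝ, F) J ∞ (Subtype.val : S → N)) (x : S) :
    ContMDiffAt 𝓘(ℝ, F) J ∞ (Subtype.val : S → N) x := h.isImmersion.contMDiff x

theorem modelDeriv_val_injective (h : IsSmoothEmbedding 𝓘(ℝ, F) J ∞ (Subtype.val : S → N)) (x : S) :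
    Function.Injective (modelDeriv 𝓘(ℝ, F) J (Subtype.val : S → N) x) := by
  obtain ⟨ρ, hρ, hρf⟩ := h.exists_leftInverse x
  refine Function.LeftInverse.injective (g := modelDeriv J 𝓘(ℝ, F) ρ x) fun v => ?_
  rw [← modelDeriv_comp_apply hρ.mdiff (h.contMDiffAt_val x).mdiff,
    modelDeriv_of_eventuallyEq_id hρf]
  rfl

/-- The derivative of the local left inverse ρ recovers a tangent vector of S from its ambient
image. Push-forward by ρ preserves smoothness along a map. -/
theorem smoothAlongAt_of_val [IsManifold 𝓘(ℝ, F) ∞ S] [IsManifold J ∞ N]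
    (h : IsSmoothEmbedding 𝓘(ℝ, F) J ∞ (Subtype.val : S → N)) {η : P → S} {v : P → F} {p : P}
    (hv : SmoothAlongAt J I (fun q => (η q : N))
      (fun q => modelDeriv 𝓘(ℝ, F) J (Subtype.val : S → N) (η q) (v q)) p) :
    SmoothAlongAt 𝓘(ℝ, F) I η v p := by
  obtain ⟨ρ, hρ, hρf⟩ := h.exists_leftInverse (η p)
  have hη : ContinuousAt η p := (h.contMDiffAt_of_val hv.base).continuousAt
  refine (hv.map hρ).congr ((hη.eventually hρf).mono fun y hy => hy.symm) ?_
  filter_upwards [hη.eventually hρf.eventually_nhds,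
    hv.base.continuousAt.eventually hρ.eventually_mdiff] with q h1 h2
  rw [← modelDeriv_comp_apply h2 (h.contMDiffAt_val _).mdiff, modelDeriv_of_eventuallyEq_id h1]
  rfl

end Manifold.IsSmoothEmbedding

end embedded

end

noncomputable section

/-! ### Submanifolds of `G × G × G` given by two equations in `M` -/

section triple

variable {EM EG M G : Type*} [NormedAddCommGroup EM] [NormedSpace ℝ EM]
  [NormedAddCommGroup EG] [NormedSpace ℝ EG]
  [TopologicalSpace M] [ChartedSpace EM M] [TopologicalSpace G] [ChartedSpace EG G]

theorem modelDeriv_sub {E E' H N : Type*} [NormedAddCommGroup E] [NormedSpace ℝ E]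
    [NormedAddCommGroup E'] [NormedSpace ℝ E'] [TopologicalSpace H] {J : ModelWithCorners ℝ E H}
    [TopologicalSpace N] [ChartedSpace H N] {f g : N → E'} {x : N}
    (hf : MDifferentiableAt J 𝓘(ℝ, E') f x) (hg : MDifferentiableAt J 𝓘(ℝ, E') g x) (v : E) :
    modelDeriv J 𝓘(ℝ, E') (fun y => f y - g y) x v =
      modelDeriv J 𝓘(ℝ, E') f x v - modelDeriv J 𝓘(ℝ, E') g x v :=
  congrArg (fun L : E →L[ℝ] E' => L v) (mfderiv_sub hf hg)

variable (EM EG) in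
/-- The equations `p g = q h`, `p' h = q' s` for triples `(g, h, s)`, with submersions `p`, `q`, `p'`
and `q'`, define the set `S`. -/
structure IsFibredTriple (p q p' q' : G → M) (S : Set (G × G × G)) : Prop where
  fst_left : Manifold.IsSubmersion 𝓘(ℝ, EG) 𝓘(ℝ, EM) ∞ p
  fst_right : Manifold.IsSubmersion 𝓘(ℝ, EG) 𝓘(ℝ, EM) ∞ q
  snd_left : Manifold.IsSubmersion 𝓘(ℝ, EG) 𝓘(ℝ, EM) ∞ p'
  snd_right : Manifold.IsSubmersion 𝓘(ℝ, EG) 𝓘(ℝ, EM) ∞ q'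
  mem_iff : ∀ t, t ∈ S ↔ p t.1 = q t.2.1 ∧ p' t.2.1 = q' t.2.2

/-- The model with corners of `G × G × G`. -/
abbrev tripleI (EG : Type*) [NormedAddCommGroup EG] [NormedSpace ℝ EG] :=
  𝓘(ℝ, EG).prod (𝓘(ℝ, EG).prod 𝓘(ℝ, EG))

theorem contMDiff_triple_fst : ContMDiff (tripleI EG) 𝓘(ℝ, EG) ∞ (fun t : G × G × G => t.1) :=
  contMDiff_fst

theorem contMDiff_triple_snd : ContMDiff (tripleI EG) 𝓘(ℝ, EG) ∞ (fun t : G × G × G => t.2.1) :=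
  contMDiff_fst.comp contMDiff_snd

theorem contMDiff_triple_thd : ContMDiff (tripleI EG) 𝓘(ℝ, EG) ∞ (fun t : G × G × G => t.2.2) :=
  contMDiff_snd.comp contMDiff_snd

theorem modelDeriv_triple_fst (t : G × G × G) (v : EG × EG × EG) :
    modelDeriv (tripleI EG) 𝓘(ℝ, EG) (fun t : G × G × G => t.1) t v = v.1 := by
  change modelDeriv (tripleI EG) 𝓘(ℝ, EG) Prod.fst t v = v.1
  rw [modelDeriv_fst]; rfl

theorem modelDeriv_triple_snd (t : G × G × G) (v : EG × EG × EG) :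
    modelDeriv (tripleI EG) 𝓘(ℝ, EG) (fun t : G × G × G => t.2.1) t v = v.2.1 := by
  rw [modelDeriv_comp_apply (g := Prod.fst) (I' := 𝓘(ℝ, EG).prod 𝓘(ℝ, EG)) (f := Prod.snd)
    contMDiffAt_fst.mdiff contMDiffAt_snd.mdiff, modelDeriv_snd, modelDeriv_fst]; rfl

theorem modelDeriv_triple_thd (t : G × G × G) (v : EG × EG × EG) :
    modelDeriv (tripleI EG) 𝓘(ℝ, EG) (fun t : G × G × G => t.2.2) t v = v.2.2 := by
  rw [modelDeriv_comp_apply (g := Prod.snd) (I' := 𝓘(ℝ, EG).prod 𝓘(ℝ, EG)) (f := Prod.snd)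
    contMDiffAt_snd.mdiff contMDiffAt_snd.mdiff, modelDeriv_snd, modelDeriv_snd]; rfl

variable [IsManifold 𝓘(ℝ, EM) ∞ M] [IsManifold 𝓘(ℝ, EG) ∞ G]

theorem finrank_le_of_isSubmersion [FiniteDimensional ℝ EG] {p : G → M}
    (hp : Manifold.IsSubmersion 𝓘(ℝ, EG) 𝓘(ℝ, EM) ∞ p) (g : G) : finrank ℝ EM ≤ finrank ℝ EG :=
  LinearMap.finrank_le_finrank_of_surjective
    (f := (modelDeriv 𝓘(ℝ, EG) 𝓘(ℝ, EM) p g).toLinearMap) (hp.modelDeriv_surjective g)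

namespace IsFibredTriple

variable {p q p' q' : G → M} {S : Set (G × G × G)}

/-- Near a point of S both sides of each equation lie in a common chart of M, so the equations can
be written as vanishing differences of coordinates. The chart is injective on its source, hence no
points are gained. -/
theorem exists_equation (h : IsFibredTriple EM EG p q p' q' S) {x : G × G × G} (hx : x ∈ S) :
    ∃ F : G × G × G → EM × EM,
      (∀ᶠ y in 𝓝 x, ContMDiffAt (tripleI EG) 𝓘(ℝ, EM × EM) ∞ F y) ∧
      Function.Surjective (modelDeriv (tripleI EG) 𝓘(ℝ, EM × EM) F x) ∧
      ∀ᶠ y in 𝓝 x, y ∈ S ↔ F y = 0 := by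
  obtain ⟨h1, h2⟩ := (h.mem_iff x).1 hx
  set ψ := chartAt EM (p x.1) with hψ
  set ψ' := chartAt EM (p' x.2.1) with hψ'
  have mψ : ψ ∈ IsManifold.maximalAtlas 𝓘(ℝ, EM) ∞ M := IsManifold.chart_mem_maximalAtlas _
  have mψ' : ψ' ∈ IsManifold.maximalAtlas 𝓘(ℝ, EM) ∞ M := IsManifold.chart_mem_maximalAtlas _
  have cp := h.fst_left.contMDiff.comp (contMDiff_triple_fst (EG := EG) (G := G))
  have cq := h.fst_right.contMDiff.comp (contMDiff_triple_snd (EG := EG) (G := G))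
  have cp' := h.snd_left.contMDiff.comp (contMDiff_triple_snd (EG := EG) (G := G))
  have cq' := h.snd_right.contMDiff.comp (contMDiff_triple_thd (EG := EG) (G := G))
  have sp : p x.1 ∈ ψ.source := mem_chart_source EM _
  have sq : q x.2.1 ∈ ψ.source := h1 ▸ sp
  have sp' : p' x.2.1 ∈ ψ'.source := mem_chart_source EM _
  have sq' : q' x.2.2 ∈ ψ'.source := h2 ▸ sp'
  have ev : ∀ᶠ y : G × G × G in 𝓝 x, p y.1 ∈ ψ.source ∧ q y.2.1 ∈ ψ.source ∧
      p' y.2.1 ∈ ψ'.source ∧ q' y.2.2 ∈ ψ'.source := by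
    filter_upwards [cp.continuous.continuousAt (ψ.open_source.mem_nhds sp),
      cq.continuous.continuousAt (ψ.open_source.mem_nhds sq),
      cp'.continuous.continuousAt (ψ'.open_source.mem_nhds sp'),
      cq'.continuous.continuousAt (ψ'.open_source.mem_nhds sq')] with y a b c d
    exact ⟨a, b, c, d⟩
  have key : ∀ y : G × G × G, (p y.1 ∈ ψ.source ∧ q y.2.1 ∈ ψ.source ∧
      p' y.2.1 ∈ ψ'.source ∧ q' y.2.2 ∈ ψ'.source) →
      ContMDiffAt (tripleI EG) 𝓘(ℝ, EM) ∞ (fun y => ψ (p y.1)) y ∧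
      ContMDiffAt (tripleI EG) 𝓘(ℝ, EM) ∞ (fun y => ψ (q y.2.1)) y ∧
      ContMDiffAt (tripleI EG) 𝓘(ℝ, EM) ∞ (fun y => ψ' (p' y.2.1)) y ∧
      ContMDiffAt (tripleI EG) 𝓘(ℝ, EM) ∞ (fun y => ψ' (q' y.2.2)) y := fun y hy =>
    ⟨(contMDiffAt_of_mem_maximalAtlas mψ hy.1).comp y cp.contMDiffAt,
      (contMDiffAt_of_mem_maximalAtlas mψ hy.2.1).comp y cq.contMDiffAt,
      (contMDiffAt_of_mem_maximalAtlas mψ' hy.2.2.1).comp y cp'.contMDiffAt,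
      (contMDiffAt_of_mem_maximalAtlas mψ' hy.2.2.2).comp y cq'.contMDiffAt⟩
  refine ⟨fun y => (ψ (p y.1) - ψ (q y.2.1), ψ' (p' y.2.1) - ψ' (q' y.2.2)), ?_, ?_, ?_⟩
  · filter_upwards [ev] with y hy
    obtain ⟨a, b, c, d⟩ := key y hy
    exact (a.sub b).prodMk_space (c.sub d)
  · obtain ⟨a, b, c, d⟩ := key x ⟨sp, sq, sp', sq'⟩
    rw [modelWithCornersSelf_prod, ← chartedSpaceSelf_prod]
    rintro ⟨u, w⟩
    obtain ⟨X, hX⟩ := h.fst_left.modelDeriv_surjective x.1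
      (modelDeriv 𝓘(ℝ, EM) 𝓘(ℝ, EM) ψ.symm (ψ (p x.1)) u)
    obtain ⟨Z, hZ⟩ := h.snd_right.modelDeriv_surjective x.2.2
      (modelDeriv 𝓘(ℝ, EM) 𝓘(ℝ, EM) ψ'.symm (ψ' (q' x.2.2)) (-w))
    -- Only g and s move, so each equation sees a single variable. The sign of w compensates for q'
    -- entering the second difference with a minus.
    refine ⟨(X, 0, Z), ?_⟩
    have dψ := (contMDiffAt_of_mem_maximalAtlas mψ sp).mdiff
    have dψq := (contMDiffAt_of_mem_maximalAtlas mψ sq).mdiff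
    have dψp' := (contMDiffAt_of_mem_maximalAtlas mψ' sp').mdiff
    have dψ' := (contMDiffAt_of_mem_maximalAtlas mψ' sq').mdiff
    rw [modelDeriv_prodMk (a.sub b).mdiff (c.sub d).mdiff, modelDeriv_sub a.mdiff b.mdiff,
      modelDeriv_sub c.mdiff d.mdiff,
      modelDeriv_comp_apply (f := fun y : G × G × G => p y.1) dψ cp.contMDiffAt.mdiff,
      modelDeriv_comp_apply (f := fun y : G × G × G => q y.2.1) dψq cq.contMDiffAt.mdiff,
      modelDeriv_comp_apply (f := fun y : G × G × G => p' y.2.1) dψp' cp'.contMDiffAt.mdiff,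
      modelDeriv_comp_apply (f := fun y : G × G × G => q' y.2.2) dψ' cq'.contMDiffAt.mdiff,
      modelDeriv_comp_apply (f := fun y : G × G × G => y.1) h.fst_left.contMDiff.contMDiffAt.mdiff
        contMDiff_triple_fst.contMDiffAt.mdiff,
      modelDeriv_comp_apply (f := fun y : G × G × G => y.2.1)
        h.fst_right.contMDiff.contMDiffAt.mdiff contMDiff_triple_snd.contMDiffAt.mdiff,
      modelDeriv_comp_apply (f := fun y : G × G × G => y.2.1)
        h.snd_left.contMDiff.contMDiffAt.mdiff contMDiff_triple_snd.contMDiffAt.mdiff,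
      modelDeriv_comp_apply (f := fun y : G × G × G => y.2.2)
        h.snd_right.contMDiff.contMDiffAt.mdiff contMDiff_triple_thd.contMDiffAt.mdiff,
      modelDeriv_triple_fst, modelDeriv_triple_snd, modelDeriv_triple_thd, hX, hZ,
      modelDeriv_chart_apply_symm mψ sp, modelDeriv_chart_apply_symm mψ' sq']
    simp only [map_zero, sub_zero, zero_sub, neg_neg]
  · filter_upwards [ev] with y hy
    rw [h.mem_iff, Prod.ext_iff]
    simp only [Prod.fst_zero, Prod.snd_zero, sub_eq_zero]
    exact and_congr (ψ.injOn.eq_iff hy.1 hy.2.1).symm (ψ'.injOn.eq_iff hy.2.2.1 hy.2.2.2).symm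

/-- A submersion forces dim M ≤ dim G, so the truncated subtraction in the dimension of the model is
a true one. -/
theorem nonempty_equiv [FiniteDimensional ℝ EM] [FiniteDimensional ℝ EG]
    (h : IsFibredTriple EM EG p q p' q' S) (x : G × G × G) :
    Nonempty ((EG × EG × EG) ≃L[ℝ] (EM × EM) × TripleModel EM EG) := by
  have := finrank_le_of_isSubmersion h.fst_left x.1
  refine ⟨ContinuousLinearEquiv.ofFinrankEq ?_⟩
  simp only [Module.finrank_prod, finrank_euclideanSpace_fin]
  omega

/-- The second factor has the dimension of a fibre of the projection to an outer entry: 2 dim G - 2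
dim M. -/
theorem nonempty_equiv_fibre (h : IsFibredTriple EM EG p q p' q' S) [FiniteDimensional ℝ EG] (x : S) :
    Nonempty (TripleModel EM EG ≃L[ℝ]
      EG × EuclideanSpace ℝ (Fin (2 * finrank ℝ EG - 2 * finrank ℝ EM))) := by
  have := finrank_le_of_isSubmersion h.fst_left x.1.1
  refine ⟨ContinuousLinearEquiv.ofFinrankEq ?_⟩
  simp only [Module.finrank_prod, finrank_euclideanSpace_fin]
  omega

theorem exists_isEmbeddedTriple [FiniteDimensional ℝ EM] [FiniteDimensional ℝ EG]
    (h : IsFibredTriple EM EG p q p' q' S) :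
    ∃ (_ : ChartedSpace (TripleModel EM EG) S) (_ : IsManifold 𝓘(ℝ, TripleModel EM EG) ∞ S),
      IsEmbeddedTriple EM EG S := by
  -- The slice construction expects a manifold modelled on one vector space. The iterated product
  -- model of G³ is therefore identified with the model on `EG × EG × EG`.
  let _ : ChartedSpace (EG × EG × EG) (G × G × G) :=
    prodChartedSpace EG G (ModelProd EG EG) (G × G)
  have hI : tripleI EG = 𝓘(ℝ, EG × EG × EG) := by
    rw [modelWithCornersSelf_prod, modelWithCornersSelf_prod]
  have : IsManifold 𝓘(ℝ, EG × EG × EG) ∞ (G × G × G) := by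
    rw [← hI]; exact inferInstanceAs (IsManifold (tripleI EG) ∞ (G × G × G))
  have := exists_isSmoothEmbedding_of_surjective (E := EG × EG × EG) (E₁ := TripleModel EM EG)
    (E₂ := EM × EM) (S := S) (fun x hx => ⟨h.nonempty_equiv x, by
      rw [← hI]; exact h.exists_equation hx⟩)
  rw [← hI] at this
  exact this

end IsFibredTriple

end triple

end

/-! ### Tangent spaces and outer projections of the submanifolds of G × G × G. -/

noncomputable section

section embeddedTriple

variable {EM EG M G : Type*} [NormedAddCommGroup EM] [NormedSpace ℝ EM]
  [NormedAddCommGroup EG] [NormedSpace ℝ EG]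
  [TopologicalSpace M] [ChartedSpace EM M] [TopologicalSpace G] [ChartedSpace EG G]
  {S : Set (G × G × G)} [ChartedSpace (TripleModel EM EG) S]

namespace IsEmbeddedTriple

theorem contMDiff_val (h : IsEmbeddedTriple EM EG S) :
    ContMDiff 𝓘(ℝ, TripleModel EM EG) (tripleI EG) ∞ (Subtype.val : S → G × G × G) :=
  h.isImmersion.contMDiff

theorem contMDiff_fst (h : IsEmbeddedTriple EM EG S) :
    ContMDiff 𝓘(ℝ, TripleModel EM EG) 𝓘(ℝ, EG) ∞ (fun t : S => t.1.1) :=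
  contMDiff_triple_fst.comp h.contMDiff_val

theorem contMDiff_snd (h : IsEmbeddedTriple EM EG S) :
    ContMDiff 𝓘(ℝ, TripleModel EM EG) 𝓘(ℝ, EG) ∞ (fun t : S => t.1.2.1) :=
  contMDiff_triple_snd.comp h.contMDiff_val

theorem contMDiff_thd (h : IsEmbeddedTriple EM EG S) :
    ContMDiff 𝓘(ℝ, TripleModel EM EG) 𝓘(ℝ, EG) ∞ (fun t : S => t.1.2.2) :=
  contMDiff_triple_thd.comp h.contMDiff_val

theorem modelDeriv_val (h : IsEmbeddedTriple EM EG S) (x : S) (v : TripleModel EM EG) :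
    modelDeriv 𝓘(ℝ, TripleModel EM EG) (tripleI EG) (Subtype.val : S → G × G × G) x v =
      (modelDeriv 𝓘(ℝ, TripleModel EM EG) 𝓘(ℝ, EG) (fun t : S => t.1.1) x v,
        modelDeriv 𝓘(ℝ, TripleModel EM EG) 𝓘(ℝ, EG) (fun t : S => t.1.2.1) x v,
        modelDeriv 𝓘(ℝ, TripleModel EM EG) 𝓘(ℝ, EG) (fun t : S => t.1.2.2) x v) := by
  have hv := (h.contMDiff_val x).mdiff
  rw [modelDeriv_comp_apply (f := (Subtype.val : S → G × G × G)) (g := fun t => t.1)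
      contMDiff_triple_fst.contMDiffAt.mdiff hv,
    modelDeriv_comp_apply (f := (Subtype.val : S → G × G × G)) (g := fun t => t.2.1)
      contMDiff_triple_snd.contMDiffAt.mdiff hv,
    modelDeriv_comp_apply (f := (Subtype.val : S → G × G × G)) (g := fun t => t.2.2)
      contMDiff_triple_thd.contMDiffAt.mdiff hv,
    modelDeriv_triple_fst, modelDeriv_triple_snd, modelDeriv_triple_thd]

theorem modelDeriv_ext (h : IsEmbeddedTriple EM EG S) {x : S} {v w : TripleModel EM EG}
    (h1 : modelDeriv 𝓘(ℝ, TripleModel EM EG) 𝓘(ℝ, EG) (fun t : S => t.1.1) x v =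
      modelDeriv 𝓘(ℝ, TripleModel EM EG) 𝓘(ℝ, EG) (fun t : S => t.1.1) x w)
    (h2 : modelDeriv 𝓘(ℝ, TripleModel EM EG) 𝓘(ℝ, EG) (fun t : S => t.1.2.1) x v =
      modelDeriv 𝓘(ℝ, TripleModel EM EG) 𝓘(ℝ, EG) (fun t : S => t.1.2.1) x w)
    (h3 : modelDeriv 𝓘(ℝ, TripleModel EM EG) 𝓘(ℝ, EG) (fun t : S => t.1.2.2) x v =
      modelDeriv 𝓘(ℝ, TripleModel EM EG) 𝓘(ℝ, EG) (fun t : S => t.1.2.2) x w) : v = w := by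
  apply h.modelDeriv_val_injective x
  exact (h.modelDeriv_val x v).trans ((Prod.ext h1 (Prod.ext h2 h3)).trans
    (h.modelDeriv_val x w).symm)

section maps

variable {E' H' P : Type*} [NormedAddCommGroup E'] [NormedSpace ℝ E'] [TopologicalSpace H']
  {I : ModelWithCorners ℝ E' H'} [TopologicalSpace P] [ChartedSpace H' P]

theorem contMDiffWithinAt (h : IsEmbeddedTriple EM EG S) {f : P → S} {s : Set P} {x : P}
    (h1 : ContMDiffWithinAt I 𝓘(ℝ, EG) ∞ (fun y => (f y).1.1) s x)
    (h2 : ContMDiffWithinAt I 𝓘(ℝ, EG) ∞ (fun y => (f y).1.2.1) s x)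
    (h3 : ContMDiffWithinAt I 𝓘(ℝ, EG) ∞ (fun y => (f y).1.2.2) s x) :
    ContMDiffWithinAt I 𝓘(ℝ, TripleModel EM EG) ∞ f s x :=
  h.contMDiffWithinAt_of_val (h1.prodMk (h2.prodMk h3))

theorem contMDiff (h : IsEmbeddedTriple EM EG S) {f : P → S}
    (h1 : ContMDiff I 𝓘(ℝ, EG) ∞ (fun y => (f y).1.1))
    (h2 : ContMDiff I 𝓘(ℝ, EG) ∞ (fun y => (f y).1.2.1))
    (h3 : ContMDiff I 𝓘(ℝ, EG) ∞ (fun y => (f y).1.2.2)) :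
    ContMDiff I 𝓘(ℝ, TripleModel EM EG) ∞ f :=
  fun x => h.contMDiffWithinAt (h1 x) (h2 x) (h3 x)

theorem smoothAlongAt [IsManifold 𝓘(ℝ, TripleModel EM EG) ∞ S] [IsManifold 𝓘(ℝ, EG) ∞ G]
    (h : IsEmbeddedTriple EM EG S) {η : P → S} {v : P → TripleModel EM EG} {x : P}
    (h1 : SmoothAlongAt 𝓘(ℝ, EG) I (fun y => (η y).1.1) (fun y =>
      modelDeriv 𝓘(ℝ, TripleModel EM EG) 𝓘(ℝ, EG) (fun t : S => t.1.1) (η y) (v y)) x)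
    (h2 : SmoothAlongAt 𝓘(ℝ, EG) I (fun y => (η y).1.2.1) (fun y =>
      modelDeriv 𝓘(ℝ, TripleModel EM EG) 𝓘(ℝ, EG) (fun t : S => t.1.2.1) (η y) (v y)) x)
    (h3 : SmoothAlongAt 𝓘(ℝ, EG) I (fun y => (η y).1.2.2) (fun y =>
      modelDeriv 𝓘(ℝ, TripleModel EM EG) 𝓘(ℝ, EG) (fun t : S => t.1.2.2) (η y) (v y)) x) :
    SmoothAlongAt 𝓘(ℝ, TripleModel EM EG) I η v x :=
  h.smoothAlongAt_of_val ((h1.prodMk (h2.prodMk h3)).congr (.of_forall fun _ => rfl)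
    (.of_forall fun y => h.modelDeriv_val (η y) (v y)))

end maps

end IsEmbeddedTriple

namespace IsFibredTriple

variable {p q p' q' : G → M}

theorem modelDeriv_fst_eq (h : IsFibredTriple EM EG p q p' q' S) (hS : IsEmbeddedTriple EM EG S)
    (x : S) (v : TripleModel EM EG) :
    modelDeriv 𝓘(ℝ, EG) 𝓘(ℝ, EM) p x.1.1
        (modelDeriv 𝓘(ℝ, TripleModel EM EG) 𝓘(ℝ, EG) (fun t : S => t.1.1) x v) =
      modelDeriv 𝓘(ℝ, EG) 𝓘(ℝ, EM) q x.1.2.1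
        (modelDeriv 𝓘(ℝ, TripleModel EM EG) 𝓘(ℝ, EG) (fun t : S => t.1.2.1) x v) := by
  rw [← modelDeriv_comp_apply h.fst_left.contMDiff.contMDiffAt.mdiff (hS.contMDiff_fst x).mdiff,
    ← modelDeriv_comp_apply h.fst_right.contMDiff.contMDiffAt.mdiff (hS.contMDiff_snd x).mdiff]
  exact congrArg (fun L : TripleModel EM EG →L[ℝ] EM => L v)
    (modelDeriv_congr (.of_forall fun t => ((h.mem_iff _).1 t.2).1))

theorem modelDeriv_snd_eq (h : IsFibredTriple EM EG p q p' q' S) (hS : IsEmbeddedTriple EM EG S)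
    (x : S) (v : TripleModel EM EG) :
    modelDeriv 𝓘(ℝ, EG) 𝓘(ℝ, EM) p' x.1.2.1
        (modelDeriv 𝓘(ℝ, TripleModel EM EG) 𝓘(ℝ, EG) (fun t : S => t.1.2.1) x v) =
      modelDeriv 𝓘(ℝ, EG) 𝓘(ℝ, EM) q' x.1.2.2
        (modelDeriv 𝓘(ℝ, TripleModel EM EG) 𝓘(ℝ, EG) (fun t : S => t.1.2.2) x v) := by
  rw [← modelDeriv_comp_apply h.snd_left.contMDiff.contMDiffAt.mdiff (hS.contMDiff_snd x).mdiff,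
    ← modelDeriv_comp_apply h.snd_right.contMDiff.contMDiffAt.mdiff (hS.contMDiff_thd x).mdiff]
  exact congrArg (fun L : TripleModel EM EG →L[ℝ] EM => L v)
    (modelDeriv_congr (.of_forall fun t => ((h.mem_iff _).1 t.2).2))

variable [IsManifold 𝓘(ℝ, EM) ∞ M] [IsManifold 𝓘(ℝ, EG) ∞ G]
  [FiniteDimensional ℝ EM] [FiniteDimensional ℝ EG]

/-- The tangent vectors of `S` are given by the linearized equations. -/
theorem exists_tangent (h : IsFibredTriple EM EG p q p' q' S) (hS : IsEmbeddedTriple EM EG S)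
    (x : S) {X Y Z : EG}
    (h1 : modelDeriv 𝓘(ℝ, EG) 𝓘(ℝ, EM) p x.1.1 X = modelDeriv 𝓘(ℝ, EG) 𝓘(ℝ, EM) q x.1.2.1 Y)
    (h2 : modelDeriv 𝓘(ℝ, EG) 𝓘(ℝ, EM) p' x.1.2.1 Y = modelDeriv 𝓘(ℝ, EG) 𝓘(ℝ, EM) q' x.1.2.2 Z) :
    ∃ v : TripleModel EM EG,
      modelDeriv 𝓘(ℝ, TripleModel EM EG) 𝓘(ℝ, EG) (fun t : S => t.1.1) x v = X ∧
      modelDeriv 𝓘(ℝ, TripleModel EM EG) 𝓘(ℝ, EG) (fun t : S => t.1.2.1) x v = Y ∧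
      modelDeriv 𝓘(ℝ, TripleModel EM EG) 𝓘(ℝ, EG) (fun t : S => t.1.2.2) x v = Z := by
  let dp := (modelDeriv 𝓘(ℝ, EG) 𝓘(ℝ, EM) p x.1.1).toLinearMap
  let dq := (modelDeriv 𝓘(ℝ, EG) 𝓘(ℝ, EM) q x.1.2.1).toLinearMap
  let dp' := (modelDeriv 𝓘(ℝ, EG) 𝓘(ℝ, EM) p' x.1.2.1).toLinearMap
  let dq' := (modelDeriv 𝓘(ℝ, EG) 𝓘(ℝ, EM) q' x.1.2.2).toLinearMap
  let A : TripleModel EM EG →ₗ[ℝ] EG × EG × EG := (modelDeriv 𝓘(ℝ, TripleModel EM EG) (tripleI EG)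
    (Subtype.val : S → G × G × G) x).toLinearMap
  let L : EG × EG × EG →ₗ[ℝ] EM × EM :=
    (dp ∘ₗ LinearMap.fst ℝ _ _ - dq ∘ₗ LinearMap.fst ℝ _ _ ∘ₗ LinearMap.snd ℝ _ _).prod
    (dp' ∘ₗ LinearMap.fst ℝ _ _ ∘ₗ LinearMap.snd ℝ _ _ -
      dq' ∘ₗ LinearMap.snd ℝ _ _ ∘ₗ LinearMap.snd ℝ _ _)
  have hL : Function.Surjective L := by
    rintro ⟨u, w⟩
    obtain ⟨a, ha⟩ := h.fst_left.modelDeriv_surjective x.1.1 u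
    obtain ⟨b, hb⟩ := h.snd_right.modelDeriv_surjective x.1.2.2 (-w)
    refine ⟨(a, 0, b), ?_⟩
    simp [L, dp, dq, dp', dq', ha, hb]
  have hA : Function.Injective A := hS.modelDeriv_val_injective x
  have hle : LinearMap.range A ≤ LinearMap.ker L := by
    rintro _ ⟨v, rfl⟩
    rw [LinearMap.mem_ker]
    have : A v = _ := hS.modelDeriv_val x v
    rw [this]
    exact Prod.ext (sub_eq_zero.2 (h.modelDeriv_fst_eq hS x v))
      (sub_eq_zero.2 (h.modelDeriv_snd_eq hS x v))
  -- Tangent vectors satisfy the linearized equations, which gives one inclusion. Both spaces have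
  -- dimension 3 dim G - 2 dim M, because A is injective and L is onto; so they are equal.
  have hdim : finrank ℝ (LinearMap.range A) = finrank ℝ (LinearMap.ker L) := by
    have e1 := LinearMap.finrank_range_of_inj hA
    have e2 := LinearMap.finrank_range_add_finrank_ker L
    rw [LinearMap.range_eq_top.2 hL, finrank_top] at e2
    simp only [Module.finrank_prod] at e2
    rw [e1, finrank_euclideanSpace_fin]
    omega
  have hmem : (X, Y, Z) ∈ LinearMap.range A := by
    rw [Submodule.eq_of_le_of_finrank_eq hle hdim, LinearMap.mem_ker]
    exact Prod.ext (sub_eq_zero.2 h1) (sub_eq_zero.2 h2)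
  obtain ⟨v, hv⟩ := hmem
  have hv' := (hS.modelDeriv_val x v).symm.trans hv
  exact ⟨v, congrArg Prod.fst hv', congrArg (fun t => t.2.1) hv', congrArg (fun t => t.2.2) hv'⟩

/-- Given the first entry X of a tangent vector, the linearized equations are solved successively
for the second and the third entry, as q and q' are submersions. -/
theorem isSubmersion_fst [IsManifold 𝓘(ℝ, TripleModel EM EG) ∞ S]
    (h : IsFibredTriple EM EG p q p' q' S) (hS : IsEmbeddedTriple EM EG S) :
    Manifold.IsSubmersion 𝓘(ℝ, TripleModel EM EG) 𝓘(ℝ, EG) ∞ (fun t : S => t.1.1) := by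
  refine isSubmersion_of_surjective (fun x => (h.nonempty_equiv_fibre x).some) hS.contMDiff_fst ?_
  intro x X
  obtain ⟨Y, hY⟩ := h.fst_right.modelDeriv_surjective x.1.2.1
    (modelDeriv 𝓘(ℝ, EG) 𝓘(ℝ, EM) p x.1.1 X)
  obtain ⟨Z, hZ⟩ := h.snd_right.modelDeriv_surjective x.1.2.2
    (modelDeriv 𝓘(ℝ, EG) 𝓘(ℝ, EM) p' x.1.2.1 Y)
  obtain ⟨v, hv, -⟩ := h.exists_tangent hS x hY.symm hZ.symm
  exact ⟨v, hv⟩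

theorem isSubmersion_thd [IsManifold 𝓘(ℝ, TripleModel EM EG) ∞ S]
    (h : IsFibredTriple EM EG p q p' q' S) (hS : IsEmbeddedTriple EM EG S) :
    Manifold.IsSubmersion 𝓘(ℝ, TripleModel EM EG) 𝓘(ℝ, EG) ∞ (fun t : S => t.1.2.2) := by
  refine isSubmersion_of_surjective (fun x => (h.nonempty_equiv_fibre x).some) hS.contMDiff_thd ?_
  intro x Z
  obtain ⟨Y, hY⟩ := h.snd_left.modelDeriv_surjective x.1.2.1
    (modelDeriv 𝓘(ℝ, EG) 𝓘(ℝ, EM) q' x.1.2.2 Z)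
  obtain ⟨X, hX⟩ := h.fst_left.modelDeriv_surjective x.1.1
    (modelDeriv 𝓘(ℝ, EG) 𝓘(ℝ, EM) q x.1.2.1 Y)
  obtain ⟨v, -, -, hv⟩ := h.exists_tangent hS x hX hY
  exact ⟨v, hv⟩

end IsFibredTriple

end embeddedTriple

end

noncomputable section

/-! ### Left translations in a Lie groupoid -/

namespace SetGroupoid

section algebra

variable {M G : Type*} (𝒢 : SetGroupoid M G)

theorem mulExt_eq_mul {g h : G} (c : 𝒢.tgt g = 𝒢.src h) : 𝒢.mulExt g h = 𝒢.mul g h c := dif_pos c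

theorem src_mulExt {g h : G} (c : 𝒢.tgt g = 𝒢.src h) : 𝒢.src (𝒢.mulExt g h) = 𝒢.src g := by
  rw [mulExt_eq_mul _ c, src_mul]

theorem tgt_mulExt {g h : G} (c : 𝒢.tgt g = 𝒢.src h) : 𝒢.tgt (𝒢.mulExt g h) = 𝒢.tgt h := by
  rw [mulExt_eq_mul _ c, tgt_mul]

theorem one_mulExt {x : M} {g : G} (c : x = 𝒢.src g) : 𝒢.mulExt (𝒢.one x) g = g := by
  rw [mulExt_eq_mul _ ((𝒢.tgt_one x).trans c), one_mul']

theorem mulExt_one {x : M} {g : G} (c : 𝒢.tgt g = x) : 𝒢.mulExt g (𝒢.one x) = g := by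
  rw [mulExt_eq_mul _ (c.trans (𝒢.src_one x).symm), mul_one']

theorem mulExt_assoc {g k h : G} (c : 𝒢.tgt g = 𝒢.src k) (d : 𝒢.tgt k = 𝒢.src h) :
    𝒢.mulExt (𝒢.mulExt g k) h = 𝒢.mulExt g (𝒢.mulExt k h) := by
  rw [mulExt_eq_mul _ ((𝒢.tgt_mulExt c).trans d), mulExt_eq_mul _ (c.trans (𝒢.src_mulExt d).symm)]
  rw [𝒢.mul_congr (𝒢.mulExt_eq_mul c) rfl _ ((𝒢.tgt_mul _ _ c).trans d),
    𝒢.mul_congr (h := 𝒢.mulExt k h) rfl (𝒢.mulExt_eq_mul d) _ (c.trans (𝒢.src_mul _ _ d).symm),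
    mul_assoc]

theorem inv_mulExt (g : G) : 𝒢.mulExt (𝒢.inv g) g = 𝒢.one (𝒢.tgt g) := by
  rw [mulExt_eq_mul _ (𝒢.tgt_inv g), inv_mul]

theorem mulExt_inv (g : G) : 𝒢.mulExt g (𝒢.inv g) = 𝒢.one (𝒢.src g) := by
  rw [mulExt_eq_mul _ (𝒢.src_inv g).symm, mul_inv]

end algebra

variable {EM EG M G : Type*} [NormedAddCommGroup EM] [NormedSpace ℝ EM]
  [NormedAddCommGroup EG] [NormedSpace ℝ EG] [TopologicalSpace G] [ChartedSpace EG G]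
  {𝒢 : SetGroupoid M G}

variable (EG) in
/-- A smooth map `m` near `(g, h)` that extends the multiplication to pairs of arrows that need not
be composable. -/
structure IsLocalMul (𝒢 : SetGroupoid M G) (m : G × G → G) (g h : G) : Prop where
  smooth : ContMDiffAt (𝓘(ℝ, EG).prod 𝓘(ℝ, EG)) 𝓘(ℝ, EG) ∞ m (g, h)
  eventually_eq : ∀ᶠ p in 𝓝 (g, h), 𝒢.tgt p.1 = 𝒢.src p.2 → m p = 𝒢.mulExt p.1 p.2

theorem continuous_prodMk_right (g h : G) : Filter.Tendsto (fun k : G => (g, k)) (𝓝 h) (𝓝 (g, h)) :=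
  (by fun_prop : Continuous fun k : G => (g, k)).tendsto h

theorem IsLocalMul.apply_self {m : G × G → G} {g h : G} (hm : 𝒢.IsLocalMul EG m g h)
    (c : 𝒢.tgt g = 𝒢.src h) : m (g, h) = 𝒢.mulExt g h := hm.eventually_eq.self_of_nhds c

theorem IsLocalMul.contMDiffAt_right {m : G × G → G} {g h : G} (hm : 𝒢.IsLocalMul EG m g h) :
    ContMDiffAt 𝓘(ℝ, EG) 𝓘(ℝ, EG) ∞ (fun k => m (g, k)) h :=
  ContMDiffAt.comp (g := m) (f := fun k => (g, k)) (I' := 𝓘(ℝ, EG).prod 𝓘(ℝ, EG)) h hm.smooth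
    (contMDiffAt_const.prodMk contMDiffAt_id)

theorem IsLocalMul.eventually_right {m : G × G → G} {g h : G} (hm : 𝒢.IsLocalMul EG m g h)
    (c : 𝒢.tgt g = 𝒢.src h) : ∀ᶠ k in 𝓝 h, 𝒢.src k = 𝒢.src h → 𝒢.mulExt g k = m (g, k) :=
  ((continuous_prodMk_right g h).eventually hm.eventually_eq).mono
    fun _ hk hs => (hk (c.trans hs.symm)).symm

variable [TopologicalSpace M] [ChartedSpace EM M] [IsManifold 𝓘(ℝ, EM) ∞ M]
  [IsManifold 𝓘(ℝ, EG) ∞ G]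

/-- The second factor is first moved into the α-fibre over β of the first one, by a local lift for
the submersion α that fixes the arrows already in that fibre. The pair then becomes composable, and
composable pairs are left unchanged. -/
theorem IsLieGroupoid.exists_isLocalMul (h𝒢 : 𝒢.IsLieGroupoid EM EG) {g h : G}
    (c : 𝒢.tgt g = 𝒢.src h) : ∃ m, 𝒢.IsLocalMul EG m g h := by
  obtain ⟨L, hL, hLs, hLh⟩ := h𝒢.isSubmersion_src.exists_lift h
  rw [← c] at hL hLs
  have hβ := h𝒢.isSubmersion_tgt.contMDiff
  have hf : ContMDiffAt (𝓘(ℝ, EG).prod 𝓘(ℝ, EG)) (𝓘(ℝ, EG).prod 𝓘(ℝ, EM)) ∞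
      (fun p : G × G => (p.2, 𝒢.tgt p.1)) (g, h) :=
    contMDiffAt_snd.prodMk (ContMDiffAt.comp (g := 𝒢.tgt) (f := Prod.fst) (g, h)
      hβ.contMDiffAt contMDiffAt_fst)
  have hmap : ∀ᶠ p in 𝓝 (g, h), 𝒢.tgt p.1 = 𝒢.src (L (p.2, 𝒢.tgt p.1)) :=
    (hf.continuousAt.eventually hLs).mono fun p hp => hp.symm
  have hLg : L (h, 𝒢.tgt g) = h := c ▸ hLh.self_of_nhds
  have hq : ContMDiffAt (𝓘(ℝ, EG).prod 𝓘(ℝ, EG)) (𝓘(ℝ, EG).prod 𝓘(ℝ, EG)) ∞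
      (fun p : G × G => (p.1, L (p.2, 𝒢.tgt p.1))) (g, h) :=
    contMDiffAt_fst.prodMk (ContMDiffAt.comp (g := L) (f := fun p : G × G => (p.2, 𝒢.tgt p.1))
      (g, h) hL hf)
  refine ⟨fun p => 𝒢.mulExt p.1 (L (p.2, 𝒢.tgt p.1)), ?_, ?_⟩
  -- The multiplication is smooth only within the set of composable pairs. Since the corrected pairs
  -- are composable throughout a neighbourhood, the composition is smooth without restriction.
  · have hmul := h𝒢.contMDiffOn_mul (g, L (h, 𝒢.tgt g))
      (show 𝒢.tgt g = 𝒢.src (L (h, 𝒢.tgt g)) by rw [hLg, c])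
    exact (ContMDiffWithinAt.comp (g := fun p : G × G => 𝒢.mulExt p.1 p.2)
      (f := fun p : G × G => (p.1, L (p.2, 𝒢.tgt p.1))) (g, h) hmul hq.contMDiffWithinAt
      (mapsTo_preimage _ 𝒢.composable)).contMDiffAt hmap
  · have h2 : ∀ᶠ p : G × G in 𝓝 (g, h), L (p.2, 𝒢.src p.2) = p.2 :=
      (continuous_snd.tendsto (g, h)).eventually hLh
    filter_upwards [h2] with p hp hc
    rw [hc, hp]

variable (EG) in
/-- The derivative of the left translation `l_g` at `h` as a map of the model space. -/
def leftD (𝒢 : SetGroupoid M G) (g h : G) : EG →L[ℝ] EG := 𝒢.leftDeriv EG g h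

theorem IsLieGroupoid.leftD_eq (h𝒢 : 𝒢.IsLieGroupoid EM EG) {g h : G} {φ : G → G}
    (hφ : MDifferentiableAt 𝓘(ℝ, EG) 𝓘(ℝ, EG) φ h)
    (e : ∀ᶠ k in 𝓝 h, 𝒢.src k = 𝒢.src h → 𝒢.mulExt g k = φ k) {v : EG}
    (hv : modelDeriv 𝓘(ℝ, EG) 𝓘(ℝ, EM) 𝒢.src h v = 0) :
    𝒢.leftD EG g h v = modelDeriv 𝓘(ℝ, EG) 𝓘(ℝ, EG) φ h v :=
  mfderivWithin_fibre h𝒢.isSubmersion_src hφ e hv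

theorem IsLieGroupoid.leftD_eq_localMul (h𝒢 : 𝒢.IsLieGroupoid EM EG) {m : G × G → G} {g h : G}
    (hm : 𝒢.IsLocalMul EG m g h) (c : 𝒢.tgt g = 𝒢.src h) {v : EG}
    (hv : modelDeriv 𝓘(ℝ, EG) 𝓘(ℝ, EM) 𝒢.src h v = 0) :
    𝒢.leftD EG g h v = modelDeriv 𝓘(ℝ, EG) 𝓘(ℝ, EG) (fun k => m (g, k)) h v :=
  h𝒢.leftD_eq hm.contMDiffAt_right.mdiff (hm.eventually_right c) hv

/-- The derivative of a map that is constant, or known, on the image of a left translation. -/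
theorem IsLieGroupoid.modelDeriv_leftD (h𝒢 : 𝒢.IsLieGroupoid EM EG) {g h : G}
    (c : 𝒢.tgt g = 𝒢.src h) {E' H' Q : Type*} [NormedAddCommGroup E'] [NormedSpace ℝ E']
    [TopologicalSpace H'] [TopologicalSpace Q] [ChartedSpace H' Q] {I' : ModelWithCorners ℝ E' H'}
    {f f' : G → Q} (hf : MDifferentiableAt 𝓘(ℝ, EG) I' f (𝒢.mulExt g h))
    (hf' : MDifferentiableAt 𝓘(ℝ, EG) I' f' h)
    (e : ∀ᶠ k in 𝓝 h, 𝒢.src k = 𝒢.src h → f (𝒢.mulExt g k) = f' k) {v : EG}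
    (hv : modelDeriv 𝓘(ℝ, EG) 𝓘(ℝ, EM) 𝒢.src h v = 0) :
    modelDeriv 𝓘(ℝ, EG) I' f (𝒢.mulExt g h) (𝒢.leftD EG g h v) =
      modelDeriv 𝓘(ℝ, EG) I' f' h v := by
  obtain ⟨m, hm⟩ := h𝒢.exists_isLocalMul c
  rw [h𝒢.leftD_eq_localMul hm c hv]
  rw [← hm.apply_self c] at hf ⊢
  rw [← modelDeriv_comp_apply (f := fun k => m (g, k)) hf hm.contMDiffAt_right.mdiff]
  refine modelDeriv_eq_of_fibre h𝒢.isSubmersion_src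
    (hf.comp (f := fun k => m (g, k)) h hm.contMDiffAt_right.mdiff) hf' ?_ hv
  filter_upwards [e, hm.eventually_right c] with k h1 h2 hk
  rw [Function.comp_apply, ← h2 hk, h1 hk]

theorem IsLieGroupoid.modelDeriv_src_leftD (h𝒢 : 𝒢.IsLieGroupoid EM EG) {g h : G}
    (c : 𝒢.tgt g = 𝒢.src h) {v : EG} (hv : modelDeriv 𝓘(ℝ, EG) 𝓘(ℝ, EM) 𝒢.src h v = 0) :
    modelDeriv 𝓘(ℝ, EG) 𝓘(ℝ, EM) 𝒢.src (𝒢.mulExt g h) (𝒢.leftD EG g h v) = 0 := by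
  rw [h𝒢.modelDeriv_leftD c (f' := fun _ => 𝒢.src g)
    h𝒢.isSubmersion_src.contMDiff.contMDiffAt.mdiff mdifferentiableAt_const
    (.of_forall fun _ hk => 𝒢.src_mulExt (c.trans hk.symm)) hv, modelDeriv_const]
  rfl

theorem IsLieGroupoid.modelDeriv_tgt_leftD (h𝒢 : 𝒢.IsLieGroupoid EM EG) {g h : G}
    (c : 𝒢.tgt g = 𝒢.src h) {v : EG} (hv : modelDeriv 𝓘(ℝ, EG) 𝓘(ℝ, EM) 𝒢.src h v = 0) :
    modelDeriv 𝓘(ℝ, EG) 𝓘(ℝ, EM) 𝒢.tgt (𝒢.mulExt g h) (𝒢.leftD EG g h v) =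
      modelDeriv 𝓘(ℝ, EG) 𝓘(ℝ, EM) 𝒢.tgt h v :=
  h𝒢.modelDeriv_leftD c h𝒢.isSubmersion_tgt.contMDiff.contMDiffAt.mdiff
    h𝒢.isSubmersion_tgt.contMDiff.contMDiffAt.mdiff
    (.of_forall fun _ hk => 𝒢.tgt_mulExt (c.trans hk.symm)) hv

theorem IsLieGroupoid.leftD_one (h𝒢 : 𝒢.IsLieGroupoid EM EG) {h : G} {v : EG}
    (hv : modelDeriv 𝓘(ℝ, EG) 𝓘(ℝ, EM) 𝒢.src h v = 0) :
    𝒢.leftD EG (𝒢.one (𝒢.src h)) h v = v := by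
  rw [h𝒢.leftD_eq (φ := fun k => k) mdifferentiableAt_id
    (.of_forall fun _ hk => 𝒢.one_mulExt hk.symm) hv, modelDeriv_id]
  rfl

/-- Associativity differentiated along the α-fibre of h. Local extensions of the multiplication
represent the two outer translations, and a third one, at (k, h), supplies the continuity that keeps
the products k y in range. -/
theorem IsLieGroupoid.leftD_leftD (h𝒢 : 𝒢.IsLieGroupoid EM EG) {g k h : G}
    (c : 𝒢.tgt g = 𝒢.src k) (d : 𝒢.tgt k = 𝒢.src h) {v : EG}
    (hv : modelDeriv 𝓘(ℝ, EG) 𝓘(ℝ, EM) 𝒢.src h v = 0) :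
    𝒢.leftD EG g (𝒢.mulExt k h) (𝒢.leftD EG k h v) = 𝒢.leftD EG (𝒢.mulExt g k) h v := by
  have cd : 𝒢.tgt g = 𝒢.src (𝒢.mulExt k h) := c.trans (𝒢.src_mulExt d).symm
  obtain ⟨m, hm⟩ := h𝒢.exists_isLocalMul cd
  obtain ⟨m', hm'⟩ := h𝒢.exists_isLocalMul ((𝒢.tgt_mulExt c).trans d)
  rw [h𝒢.leftD_eq_localMul hm cd (h𝒢.modelDeriv_src_leftD d hv),
    h𝒢.leftD_eq_localMul hm' ((𝒢.tgt_mulExt c).trans d) hv]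
  refine h𝒢.modelDeriv_leftD d hm.contMDiffAt_right.mdiff hm'.contMDiffAt_right.mdiff ?_ hv
  obtain ⟨n, hn⟩ := h𝒢.exists_isLocalMul d
  have hn' : Filter.Tendsto (fun y => n (k, y)) (𝓝 h) (𝓝 (𝒢.mulExt k h)) := by
    rw [← hn.apply_self d]; exact hn.contMDiffAt_right.continuousAt
  filter_upwards [hm'.eventually_right ((𝒢.tgt_mulExt c).trans d), hn.eventually_right d,
    hn'.eventually (hm.eventually_right cd)] with y h1 h2 h3 hy
  have hd : 𝒢.tgt k = 𝒢.src y := d.trans hy.symm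
  rw [← h2 hy] at h3
  rw [← h1 hy, ← h3 (by rw [𝒢.src_mulExt hd, 𝒢.src_mulExt d]), 𝒢.mulExt_assoc c hd]

end SetGroupoid

end

noncomputable section

/-! ### Left-invariant vector fields -/

section fieldBracket

variable {E N : Type*} [NormedAddCommGroup E] [NormedSpace ℝ E]
  [TopologicalSpace N] [ChartedSpace E N] {U V V' W W' : N → E} {x : N}

theorem fieldBracket_congr (hV : ∀ᶠ y in 𝓝 x, V y = V' y) (hW : ∀ᶠ y in 𝓝 x, W y = W' y) :
    fieldBracket E V W x = fieldBracket E V' W' x :=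
  Filter.EventuallyEq.mlieBracket_vectorField_eq hV hW

theorem fieldBracket_swap : fieldBracket E V W x = -fieldBracket E W V x :=
  mlieBracket_swap_apply

variable [CompleteSpace E] [IsManifold 𝓘(ℝ, E) ∞ N]

theorem fieldBracket_add_right (hW : SmoothAlongAt 𝓘(ℝ, E) 𝓘(ℝ, E) (fun y => y) W x)
    (hW' : SmoothAlongAt 𝓘(ℝ, E) 𝓘(ℝ, E) (fun y => y) W' x) :
    fieldBracket E V (fun y => W y + W' y) x = fieldBracket E V W x + fieldBracket E V W' x := by
  have : IsManifold 𝓘(ℝ, E) 2 N := .of_le (n := ∞) (WithTop.coe_le_coe.2 le_top)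
  exact mlieBracket_add_right hW.mdiff hW'.mdiff

theorem fieldBracket_smul_right {f : N → ℝ} (hf : MDifferentiableAt 𝓘(ℝ, E) 𝓘(ℝ, ℝ) f x)
    (hW : SmoothAlongAt 𝓘(ℝ, E) 𝓘(ℝ, E) (fun y => y) W x) :
    fieldBracket E V (fun y => f y • W y) x =
      modelDeriv 𝓘(ℝ, E) 𝓘(ℝ, ℝ) f x (V x) • W x + f x • fieldBracket E V W x := by
  have : IsManifold 𝓘(ℝ, E) 2 N := .of_le (n := ∞) (WithTop.coe_le_coe.2 le_top)
  exact mlieBracket_smul_right hf hW.mdiff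

theorem SmoothAlongAt.fieldBracket (hV : SmoothAlongAt 𝓘(ℝ, E) 𝓘(ℝ, E) (fun y => y) V x)
    (hW : SmoothAlongAt 𝓘(ℝ, E) 𝓘(ℝ, E) (fun y => y) W x) :
    SmoothAlongAt 𝓘(ℝ, E) 𝓘(ℝ, E) (fun y => y) (fieldBracket E V W) x := by
  have : IsManifold 𝓘(ℝ, E) (((⊤ : ℕ∞) : WithTop ℕ∞) + 1) N :=
    inferInstanceAs (IsManifold 𝓘(ℝ, E) ∞ N)
  have : IsManifold 𝓘(ℝ, E) (minSmoothness ℝ 2) N := .of_le (n := ∞)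
    (by rw [minSmoothness_of_isRCLikeNormedField]; exact WithTop.coe_le_coe.2 le_top)
  exact ContMDiffAt.mlieBracket_vectorField (n := ⊤) (m := ⊤) hV hW
    (by rw [minSmoothness_of_isRCLikeNormedField]; exact le_rfl)

/-- The cyclic identity is the derivation property of the bracket with U, rearranged by
antisymmetry. -/
theorem fieldBracket_jacobi (hU : SmoothAlongAt 𝓘(ℝ, E) 𝓘(ℝ, E) (fun y => y) U x)
    (hV : SmoothAlongAt 𝓘(ℝ, E) 𝓘(ℝ, E) (fun y => y) V x)
    (hW : SmoothAlongAt 𝓘(ℝ, E) 𝓘(ℝ, E) (fun y => y) W x) :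
    fieldBracket E U (fieldBracket E V W) x + fieldBracket E V (fieldBracket E W U) x +
      fieldBracket E W (fieldBracket E U V) x = 0 := by
  have h3 : minSmoothness ℝ 3 ≤ ∞ := by
    rw [minSmoothness_of_isRCLikeNormedField]
    exact (WithTop.coe_le_coe.2 le_top : ((3 : ℕ∞) : WithTop ℕ∞) ≤ ((⊤ : ℕ∞) : WithTop ℕ∞))
  have h2 : minSmoothness ℝ 2 ≤ ∞ := by
    rw [minSmoothness_of_isRCLikeNormedField]
    exact (WithTop.coe_le_coe.2 le_top : ((2 : ℕ∞) : WithTop ℕ∞) ≤ ((⊤ : ℕ∞) : WithTop ℕ∞))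
  have : IsManifold 𝓘(ℝ, E) (minSmoothness ℝ 3) N := .of_le h3
  have h : _root_.fieldBracket E U (_root_.fieldBracket E V W) x =
      _root_.fieldBracket E (_root_.fieldBracket E U V) W x +
        _root_.fieldBracket E V (_root_.fieldBracket E U W) x :=
    leibniz_identity_mlieBracket_apply (ContMDiffAt.of_le hU h2) (ContMDiffAt.of_le hV h2)
      (ContMDiffAt.of_le hW h2)
  -- Here the antisymmetry is needed for an inner field, not at one point; -1 is treated as a
  -- constant coefficient function, whose derivative vanishes.
  have e : fieldBracket E V (fieldBracket E U W) x = -fieldBracket E V (fieldBracket E W U) x := by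
    have e1 : fieldBracket E U W = fun y => (-1 : ℝ) • fieldBracket E W U y :=
      funext fun y => by rw [fieldBracket_swap, neg_one_smul]
    rw [e1, fieldBracket_smul_right mdifferentiableAt_const (hW.fieldBracket hU), modelDeriv_const]
    simp
  rw [h, e, fieldBracket_swap (W := W)]
  abel

end fieldBracket

namespace SetGroupoid

variable {EM EG M G : Type*} [NormedAddCommGroup EM] [NormedSpace ℝ EM]
  [NormedAddCommGroup EG] [NormedSpace ℝ EG] [TopologicalSpace G] [ChartedSpace EG G]
  {𝒢 : SetGroupoid M G} {U : Set M} {X Y : M → EG}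

variable (EG) in
/-- The left-invariant vector field of a section, with values in the model space. -/
def leftVF (𝒢 : SetGroupoid M G) (X : M → EG) : G → EG := 𝒢.leftField EG X

variable (EG) in
/-- The bracket of two sections of the Lie algebroid, with values in the model space. -/
def sectionBracket (𝒢 : SetGroupoid M G) (X Y : M → EG) (x : M) : EG :=
  fieldBracket EG (𝒢.leftVF EG X) (𝒢.leftVF EG Y) (𝒢.one x)

theorem leftVF_congr {X' : M → EG} (h : ∀ x ∈ U, X x = X' x) {g : G} (hg : 𝒢.tgt g ∈ U) :
    𝒢.leftVF EG X g = 𝒢.leftVF EG X' g :=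
  congrArg (𝒢.leftD EG g (𝒢.one (𝒢.tgt g))) (h _ hg)

theorem leftVF_add : 𝒢.leftVF EG (fun x => X x + Y x) = fun g => 𝒢.leftVF EG X g + 𝒢.leftVF EG Y g :=
  funext fun g => map_add (𝒢.leftD EG g (𝒢.one (𝒢.tgt g))) _ _

theorem leftVF_smul {f : M → ℝ} :
    𝒢.leftVF EG (fun x => f x • Y x) = fun g => f (𝒢.tgt g) • 𝒢.leftVF EG Y g :=
  funext fun g => map_smul (𝒢.leftD EG g (𝒢.one (𝒢.tgt g))) _ _

variable [TopologicalSpace M] [ChartedSpace EM M]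

variable (EM EG) in
/-- `X` is a smooth section of the Lie algebroid on `U`. -/
def SectionOn [IsManifold 𝓘(ℝ, EG) ∞ G] (𝒢 : SetGroupoid M G) (U : Set M) (X : M → EG) : Prop :=
  ∀ x ∈ U, SmoothAlongAt 𝓘(ℝ, EG) 𝓘(ℝ, EM) 𝒢.one X x ∧
    modelDeriv 𝓘(ℝ, EG) 𝓘(ℝ, EM) 𝒢.src (𝒢.one x) (X x) = 0

theorem IsLieGroupoid.eventually_tgt_mem (h𝒢 : 𝒢.IsLieGroupoid EM EG) (hU : IsOpen U) {g : G}
    (hg : 𝒢.tgt g ∈ U) : ∀ᶠ k in 𝓝 g, 𝒢.tgt k ∈ U :=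
  h𝒢.isSubmersion_tgt.contMDiff.continuous.continuousAt (hU.mem_nhds hg)

variable [IsManifold 𝓘(ℝ, EM) ∞ M] [IsManifold 𝓘(ℝ, EG) ∞ G]

namespace IsLieGroupoid

theorem modelDeriv_src_leftVF (h𝒢 : 𝒢.IsLieGroupoid EM EG) {g : G}
    (hv : modelDeriv 𝓘(ℝ, EG) 𝓘(ℝ, EM) 𝒢.src (𝒢.one (𝒢.tgt g)) (X (𝒢.tgt g)) = 0) :
    modelDeriv 𝓘(ℝ, EG) 𝓘(ℝ, EM) 𝒢.src g (𝒢.leftVF EG X g) = 0 := by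
  have := h𝒢.modelDeriv_src_leftD (𝒢.src_one (𝒢.tgt g)).symm hv
  rwa [𝒢.mulExt_one rfl] at this

theorem modelDeriv_tgt_leftVF (h𝒢 : 𝒢.IsLieGroupoid EM EG) {g : G}
    (hv : modelDeriv 𝓘(ℝ, EG) 𝓘(ℝ, EM) 𝒢.src (𝒢.one (𝒢.tgt g)) (X (𝒢.tgt g)) = 0) :
    modelDeriv 𝓘(ℝ, EG) 𝓘(ℝ, EM) 𝒢.tgt g (𝒢.leftVF EG X g) =
      modelDeriv 𝓘(ℝ, EG) 𝓘(ℝ, EM) 𝒢.tgt (𝒢.one (𝒢.tgt g)) (X (𝒢.tgt g)) := by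
  have := h𝒢.modelDeriv_tgt_leftD (𝒢.src_one (𝒢.tgt g)).symm hv
  rwa [𝒢.mulExt_one rfl] at this

theorem leftVF_one (h𝒢 : 𝒢.IsLieGroupoid EM EG) {x : M}
    (hv : modelDeriv 𝓘(ℝ, EG) 𝓘(ℝ, EM) 𝒢.src (𝒢.one x) (X x) = 0) :
    𝒢.leftVF EG X (𝒢.one x) = X x := by
  change 𝒢.leftD EG (𝒢.one x) (𝒢.one (𝒢.tgt (𝒢.one x))) (X (𝒢.tgt (𝒢.one x))) = X x
  rw [𝒢.tgt_one]
  have := h𝒢.leftD_one hv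
  rwa [𝒢.src_one] at this

/-- The field at h is itself a translate from the unit at β(h), so this is functoriality of
translation, together with β(gh) = β(h). -/
theorem leftD_leftVF (h𝒢 : 𝒢.IsLieGroupoid EM EG) {g h : G} (c : 𝒢.tgt g = 𝒢.src h)
    (hv : modelDeriv 𝓘(ℝ, EG) 𝓘(ℝ, EM) 𝒢.src (𝒢.one (𝒢.tgt h)) (X (𝒢.tgt h)) = 0) :
    𝒢.leftD EG g h (𝒢.leftVF EG X h) = 𝒢.leftVF EG X (𝒢.mulExt g h) := by
  have := h𝒢.leftD_leftD c (𝒢.src_one (𝒢.tgt h)).symm hv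
  rw [𝒢.mulExt_one rfl] at this
  refine this.trans ?_
  change _ = 𝒢.leftD EG (𝒢.mulExt g h) (𝒢.one (𝒢.tgt (𝒢.mulExt g h))) (X (𝒢.tgt (𝒢.mulExt g h)))
  rw [𝒢.tgt_mulExt c]

/-- With a local extension m of the multiplication, the field at k is Tm applied to (0, X(β(k))) at
(k, ε(β(k))). This exhibits it as the image of a smooth field along a smooth map, although each
translation is defined on its own fibre. -/
theorem smoothAlongAt_leftVF (h𝒢 : 𝒢.IsLieGroupoid EM EG) (hU : IsOpen U)
    (hX : 𝒢.SectionOn EM EG U X) {g : G} (hg : 𝒢.tgt g ∈ U) :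
    SmoothAlongAt 𝓘(ℝ, EG) 𝓘(ℝ, EG) (fun y => y) (𝒢.leftVF EG X) g := by
  obtain ⟨m, hm⟩ := h𝒢.exists_isLocalMul (g := g) (𝒢.src_one (𝒢.tgt g)).symm
  have hβ := h𝒢.isSubmersion_tgt.contMDiff.contMDiffAt (x := g)
  have h1 : SmoothAlongAt 𝓘(ℝ, EG) 𝓘(ℝ, EG) (fun k => 𝒢.one (𝒢.tgt k)) (fun k => X (𝒢.tgt k)) g :=
    (hX _ hg).1.comp hβ
  have h2 : SmoothAlongAt 𝓘(ℝ, EG) 𝓘(ℝ, EG) (fun k : G => k) (fun _ => (0 : EG)) g :=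
    SmoothAlongAt.zero contMDiffAt_id
  have h3 := (h2.prodMk h1).map hm.smooth
  have hc : Filter.Tendsto (fun k : G => (k, 𝒢.one (𝒢.tgt k))) (𝓝 g) (𝓝 (g, 𝒢.one (𝒢.tgt g))) :=
    (continuousAt_id.prodMk h1.base.continuousAt)
  refine h3.congr ?_ ?_
  · filter_upwards [hc.eventually hm.eventually_eq] with k hk
    rw [hk (𝒢.src_one _).symm, 𝒢.mulExt_one rfl]
  · filter_upwards [hc.eventually hm.eventually_eq.eventually_nhds,
      hc.eventually hm.smooth.eventually_mdiff, h𝒢.eventually_tgt_mem hU hg] with k hk1 hk2 hk3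
    rw [modelDeriv_prod_apply hk2, map_zero, zero_add]
    refine h𝒢.leftD_eq (φ := fun z => m (k, z)) ?_ ?_ (hX _ hk3).2
    · exact MDifferentiableAt.comp (g := m) (f := fun z => (k, z)) (I' := 𝓘(ℝ, EG).prod 𝓘(ℝ, EG)) _
        hk2 (mdifferentiableAt_const.prodMk mdifferentiableAt_id)
    · filter_upwards [(continuous_prodMk_right k _).eventually hk1] with z hz hs
      rw [hz (by rw [hs, 𝒢.src_one])]

variable [CompleteSpace EM] [CompleteSpace EG]

theorem modelDeriv_src_fieldBracket (h𝒢 : 𝒢.IsLieGroupoid EM EG) (hU : IsOpen U)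
    (hX : 𝒢.SectionOn EM EG U X) (hY : 𝒢.SectionOn EM EG U Y) {g : G} (hg : 𝒢.tgt g ∈ U) :
    modelDeriv 𝓘(ℝ, EG) 𝓘(ℝ, EM) 𝒢.src g
      (fieldBracket EG (𝒢.leftVF EG X) (𝒢.leftVF EG Y) g) = 0 := by
  have h0 : SmoothAlongAt 𝓘(ℝ, EM) 𝓘(ℝ, EM) (fun y => y) (fun _ => 0) (𝒢.src g) :=
    SmoothAlongAt.zero contMDiffAt_id
  -- Left-invariant fields are α-vertical, hence α-related to the empty combination; so the bracket
  -- is mapped to 0.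
  have := modelDeriv_fieldBracket_of_related (ι := Empty) (κ := Empty) (r := fun y => y)
    h𝒢.isSubmersion_src.contMDiff.contMDiffAt
    (h𝒢.smoothAlongAt_leftVF hU hX hg) (h𝒢.smoothAlongAt_leftVF hU hY hg)
    mdifferentiableAt_id rfl (by rw [modelDeriv_id]; rfl) (by rw [modelDeriv_id]; rfl)
    (a := fun i => i.elim) (c := fun i => i.elim) (X := fun i => i.elim) (Y := fun i => i.elim)
    (fun i => i.elim) (fun i => i.elim) (fun i => i.elim) (fun i => i.elim)
    ((h𝒢.eventually_tgt_mem hU hg).mono fun k hk => by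
      simpa using h𝒢.modelDeriv_src_leftVF (hX _ hk).2)
    ((h𝒢.eventually_tgt_mem hU hg).mono fun k hk => by
      simpa using h𝒢.modelDeriv_src_leftVF (hY _ hk).2)
  simpa using this

/-- The bracket of left-invariant vector fields is left-invariant. -/
theorem leftD_fieldBracket (h𝒢 : 𝒢.IsLieGroupoid EM EG) (hU : IsOpen U)
    (hX : 𝒢.SectionOn EM EG U X) (hY : 𝒢.SectionOn EM EG U Y) {g h : G}
    (c : 𝒢.tgt g = 𝒢.src h) (hh : 𝒢.tgt h ∈ U) :
    𝒢.leftD EG g h (fieldBracket EG (𝒢.leftVF EG X) (𝒢.leftVF EG Y) h) =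
      fieldBracket EG (𝒢.leftVF EG X) (𝒢.leftVF EG Y) (𝒢.mulExt g h) := by
  obtain ⟨m, hm⟩ := h𝒢.exists_isLocalMul c
  -- The extension k ↦ m(g, k) agrees with left translation only on the α-fibre of h, so the fields
  -- are related only there. The retraction r onto this fibre has a derivative that fixes α-vertical
  -- vectors.
  obtain ⟨r, hr, hrx, hrf, hrv⟩ := h𝒢.isSubmersion_src.exists_retraction h
  have hgh : 𝒢.tgt (𝒢.mulExt g h) ∈ U := by rwa [𝒢.tgt_mulExt c]
  have hrc : Filter.Tendsto r (𝓝 h) (𝓝 h) := by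
    have := hr.continuousAt; rwa [ContinuousAt, hrx] at this
  have hm1 := (continuous_prodMk_right g h).eventually hm.eventually_eq
  have key : ∀ Z : M → EG, 𝒢.SectionOn EM EG U Z → ∀ᶠ k in 𝓝 h,
      modelDeriv 𝓘(ℝ, EG) 𝓘(ℝ, EG) (fun k => m (g, k)) (r k) (𝒢.leftVF EG Z (r k)) =
        𝒢.leftVF EG Z (m (g, r k)) := by
    intro Z hZ
    filter_upwards [hrf, hrc.eventually hm1.eventually_nhds,
      hrc.eventually hm.contMDiffAt_right.eventually_mdiff,
      hrc.eventually (h𝒢.eventually_tgt_mem hU hh)] with k k1 k2 k3 k4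
    have ck : 𝒢.tgt g = 𝒢.src (r k) := c.trans k1.symm
    rw [k2.self_of_nhds ck, ← h𝒢.leftD_leftVF ck (hZ _ k4).2]
    refine (h𝒢.leftD_eq k3 ?_ (h𝒢.modelDeriv_src_leftVF (hZ _ k4).2)).symm
    filter_upwards [k2] with y hy hs
    exact (hy (ck.trans hs.symm)).symm
  rw [h𝒢.leftD_eq_localMul hm c (h𝒢.modelDeriv_src_fieldBracket hU hX hY hh),
    ← hm.apply_self c]
  exact modelDeriv_fieldBracket_of_related_along hm.contMDiffAt_right
    (h𝒢.smoothAlongAt_leftVF hU hX hh) (h𝒢.smoothAlongAt_leftVF hU hY hh)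
    (by rw [hm.apply_self c]; exact h𝒢.smoothAlongAt_leftVF hU hX hgh)
    (by rw [hm.apply_self c]; exact h𝒢.smoothAlongAt_leftVF hU hY hgh) hr.mdiff hrx
    (hrv _ (h𝒢.modelDeriv_src_leftVF (hX _ hh).2)) (hrv _ (h𝒢.modelDeriv_src_leftVF (hY _ hh).2))
    (key X hX) (key Y hY)

/-- A left-invariant field is determined by its values at units; the bracket is left-invariant, and
its values at units define the section. -/
theorem leftVF_sectionBracket (h𝒢 : 𝒢.IsLieGroupoid EM EG) (hU : IsOpen U)
    (hX : 𝒢.SectionOn EM EG U X) (hY : 𝒢.SectionOn EM EG U Y) {g : G} (hg : 𝒢.tgt g ∈ U) :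
    𝒢.leftVF EG (𝒢.sectionBracket EG X Y) g =
      fieldBracket EG (𝒢.leftVF EG X) (𝒢.leftVF EG Y) g := by
  have := h𝒢.leftD_fieldBracket hU hX hY (𝒢.src_one (𝒢.tgt g)).symm (by rwa [𝒢.tgt_one])
  rwa [𝒢.mulExt_one rfl] at this

theorem sectionOn_sectionBracket (h𝒢 : 𝒢.IsLieGroupoid EM EG) (hU : IsOpen U)
    (hX : 𝒢.SectionOn EM EG U X) (hY : 𝒢.SectionOn EM EG U Y) :
    𝒢.SectionOn EM EG U (𝒢.sectionBracket EG X Y) := by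
  intro x hx
  have hx' : 𝒢.tgt (𝒢.one x) ∈ U := by rwa [𝒢.tgt_one]
  refine ⟨?_, h𝒢.modelDeriv_src_fieldBracket hU hX hY hx'⟩
  exact ((h𝒢.smoothAlongAt_leftVF hU hX hx').fieldBracket
    (h𝒢.smoothAlongAt_leftVF hU hY hx')).comp h𝒢.contMDiff_one.contMDiffAt

end IsLieGroupoid

end SetGroupoid

end

noncomputable section

/-! ### Frames of the vertical bundle of a submersion -/

namespace SubmersionChart

variable {E F : Type*} [NormedAddCommGroup E] [NormedSpace ℝ E]
  [NormedAddCommGroup F] [NormedSpace ℝ F]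
  {N Q : Type*} [TopologicalSpace N] [ChartedSpace E N]
  [TopologicalSpace Q] [ChartedSpace F Q] {f : N → Q} {x : N} (c : SubmersionChart E F f x)

instance finiteDimensional [FiniteDimensional ℝ E] : FiniteDimensional ℝ c.K :=
  FiniteDimensional.of_surjective
    (((ContinuousLinearMap.snd ℝ F c.K).comp (c.T : E →L[ℝ] F × c.K)).toLinearMap : E →ₗ[ℝ] c.K)
    ((LinearMap.snd_surjective (R := ℝ) (M := F) (M₂ := c.K)).comp c.T.surjective)

variable [FiniteDimensional ℝ E]

/-- The coordinate frame of the vertical bundle. -/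
def frame (i : Fin (finrank ℝ c.K)) (y : N) : E :=
  modelDeriv 𝓘(ℝ, E) 𝓘(ℝ, E) c.e.symm (c.e y) (c.T.symm (0, finBasis ℝ c.K i))

/-- The coefficients of vertical vectors with respect to the coordinate frame. -/
def coef (i : Fin (finrank ℝ c.K)) (y : N) : E →L[ℝ] ℝ :=
  (LinearMap.toContinuousLinearMap ((finBasis ℝ c.K).coord i)).comp
    (((ContinuousLinearMap.snd ℝ F c.K).comp (c.T : E →L[ℝ] F × c.K)).comp
      (modelDeriv 𝓘(ℝ, E) 𝓘(ℝ, E) c.e y))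

variable [IsManifold 𝓘(ℝ, E) ∞ N] {y : N}

theorem modelDeriv_frame (hy : y ∈ c.e.source) (i : Fin (finrank ℝ c.K)) :
    modelDeriv 𝓘(ℝ, E) 𝓘(ℝ, E) c.e y (c.frame i y) = c.T.symm (0, finBasis ℝ c.K i) :=
  modelDeriv_chart_apply_symm c.e_mem hy _

theorem smoothAlongAt_frame (hy : y ∈ c.e.source) (i : Fin (finrank ℝ c.K)) :
    SmoothAlongAt 𝓘(ℝ, E) 𝓘(ℝ, E) (fun z => z) (c.frame i) y := by
  have h1 : SmoothAlongAt 𝓘(ℝ, E) 𝓘(ℝ, E) (fun z => c.e z)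
      (fun _ => c.T.symm (0, finBasis ℝ c.K i)) y :=
    SmoothAlongAt.of_model (contMDiffAt_of_mem_maximalAtlas c.e_mem hy) contMDiffAt_const
  refine (h1.map (contMDiffAt_symm_of_mem_maximalAtlas c.e_mem (c.e.map_source hy))).congr ?_
    (.of_forall fun _ => rfl)
  filter_upwards [c.e.open_source.mem_nhds hy] with z hz using (c.e.left_inv hz).symm

theorem frame_mem_ker [IsManifold 𝓘(ℝ, F) ∞ Q] (hy : y ∈ c.e.source)
    (hf : MDifferentiableAt 𝓘(ℝ, E) 𝓘(ℝ, F) f y) (i : Fin (finrank ℝ c.K)) :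
    modelDeriv 𝓘(ℝ, E) 𝓘(ℝ, F) f y (c.frame i y) = 0 := by
  have h := c.modelDeriv_proj hy hf (c.frame i y)
  rw [c.modelDeriv_frame hy, c.T.apply_symm_apply] at h
  rw [← modelDeriv_chart_symm_apply c.ψ_mem (c.map_source y hy)
    (modelDeriv 𝓘(ℝ, E) 𝓘(ℝ, F) f y (c.frame i y)), ← h, map_zero]

theorem coef_frame (hy : y ∈ c.e.source) (i j : Fin (finrank ℝ c.K)) :
    c.coef i y (c.frame j y) = if i = j then 1 else 0 := by
  simp [coef, c.modelDeriv_frame hy, Finsupp.single_apply, eq_comm]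

/-- It suffices to compare images under the chart and T, which are injective. For a vertical vector
the component in F vanishes, and the other component is expanded in the basis of K. -/
theorem sum_coef [IsManifold 𝓘(ℝ, F) ∞ Q] (hy : y ∈ c.e.source)
    (hf : MDifferentiableAt 𝓘(ℝ, E) 𝓘(ℝ, F) f y) {v : E}
    (hv : modelDeriv 𝓘(ℝ, E) 𝓘(ℝ, F) f y v = 0) : ∑ i, c.coef i y v • c.frame i y = v := by
  have h := c.modelDeriv_proj hy hf v
  rw [hv, map_zero] at h
  have h1 : Function.Injective (modelDeriv 𝓘(ℝ, E) 𝓘(ℝ, E) c.e y) :=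
    Function.LeftInverse.injective (modelDeriv_chart_symm_apply c.e_mem hy)
  apply h1
  apply c.T.injective
  simp only [map_sum, map_smul, c.modelDeriv_frame hy, c.T.apply_symm_apply]
  have e := (finBasis ℝ c.K).sum_repr (c.T (modelDeriv 𝓘(ℝ, E) 𝓘(ℝ, E) c.e y v)).2
  refine Prod.ext ?_ ?_
  · rw [Prod.fst_sum, h]
    exact Finset.sum_eq_zero fun i _ => smul_zero _
  · rw [Prod.snd_sum]
    exact e

theorem contMDiffAt_coef {E' H' P : Type*} [NormedAddCommGroup E'] [NormedSpace ℝ E']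
    [TopologicalSpace H'] {I : ModelWithCorners ℝ E' H'} [TopologicalSpace P] [ChartedSpace H' P]
    {η : P → N} {v : P → E} {p : P} (h : SmoothAlongAt 𝓘(ℝ, E) I η v p)
    (hp : η p ∈ c.e.source) (i : Fin (finrank ℝ c.K)) :
    ContMDiffAt I 𝓘(ℝ, ℝ) ∞ (fun q => c.coef i (η q) (v q)) p := by
  have h1 := (h.map (contMDiffAt_of_mem_maximalAtlas c.e_mem hp)).model
  exact (((LinearMap.toContinuousLinearMap ((finBasis ℝ c.K).coord i)).comp
    ((ContinuousLinearMap.snd ℝ F c.K).comp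
      (c.T : E →L[ℝ] F × c.K))).contDiff.contMDiff.contMDiffAt).comp p h1

end SubmersionChart

/-! ### The Lie algebroid axioms -/

namespace SetGroupoid

variable {EM EG M G : Type*} [NormedAddCommGroup EM] [NormedSpace ℝ EM]
  [NormedAddCommGroup EG] [NormedSpace ℝ EG] [TopologicalSpace M] [ChartedSpace EM M]
  [TopologicalSpace G] [ChartedSpace EG G] {𝒢 : SetGroupoid M G} {U : Set M} {X Y : M → EG}

theorem sectionBracket_congr {X' Y' : M → EG} (hX : ∀ x ∈ U, X x = X' x)
    (hY : ∀ x ∈ U, Y x = Y' x) (hβ : Continuous 𝒢.tgt) (hU : IsOpen U) {x : M} (hx : x ∈ U) :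
    𝒢.sectionBracket EG X Y x = 𝒢.sectionBracket EG X' Y' x := by
  have : ∀ᶠ g in 𝓝 (𝒢.one x), 𝒢.tgt g ∈ U :=
    hβ.continuousAt (hU.mem_nhds (by rwa [𝒢.tgt_one]))
  exact fieldBracket_congr (this.mono fun _ hg => leftVF_congr hX hg)
    (this.mono fun _ hg => leftVF_congr hY hg)

variable [IsManifold 𝓘(ℝ, EG) ∞ G]

theorem smooth_iff (hU : IsOpen U) : (𝒢.lieAlgebroid EM EG).Smooth U X ↔
    ∀ x ∈ U, SmoothAlongAt 𝓘(ℝ, EG) 𝓘(ℝ, EM) 𝒢.one X x :=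
  ⟨fun h _ hx => ContMDiffOn.contMDiffAt h (hU.mem_nhds hx),
    fun h x hx => (h x hx).contMDiffWithinAt⟩

theorem isSection_iff (hU : IsOpen U) :
    (𝒢.lieAlgebroid EM EG).IsSection U X ↔ 𝒢.SectionOn EM EG U X := by
  refine ⟨fun h x hx => ⟨(smooth_iff hU).1 h.1 x hx, h.2 x hx⟩,
    fun h => ⟨(smooth_iff hU).2 fun x hx => (h x hx).1, fun x hx => (h x hx).2⟩⟩

theorem SectionOn.mono {V : Set M} (h : 𝒢.SectionOn EM EG U X) (hV : V ⊆ U) :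
    𝒢.SectionOn EM EG V X := fun x hx => h x (hV hx)

theorem SectionOn.add (hX : 𝒢.SectionOn EM EG U X) (hY : 𝒢.SectionOn EM EG U Y) :
    𝒢.SectionOn EM EG U (fun x => X x + Y x) := fun x hx =>
  ⟨(hX x hx).1.add (hY x hx).1, by rw [map_add, (hX x hx).2, (hY x hx).2, add_zero]⟩

theorem SectionOn.smul {f : M → ℝ} (hf : ∀ x ∈ U, ContMDiffAt 𝓘(ℝ, EM) 𝓘(ℝ, ℝ) ∞ f x)
    (hX : 𝒢.SectionOn EM EG U X) : 𝒢.SectionOn EM EG U (fun x => f x • X x) := fun x hx =>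
  ⟨(hX x hx).1.smul (hf x hx), by rw [map_smul, (hX x hx).2, smul_zero]⟩

variable [IsManifold 𝓘(ℝ, EM) ∞ M] [FiniteDimensional ℝ EG]

/-- Local frames of the Lie algebroid; the coefficients of a smooth section of a pull-back are
smooth. -/
theorem IsLieGroupoid.exists_frame (h𝒢 : 𝒢.IsLieGroupoid EM EG) {EP P : Type*}
    [NormedAddCommGroup EP] [NormedSpace ℝ EP] [TopologicalSpace P] [ChartedSpace EP P]
    (π : P → M) (x₀ : M) :
    ∃ (U : Set M) (k : ℕ) (e : Fin k → M → EG) (c : Fin k → M → EG →L[ℝ] ℝ),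
      IsOpen U ∧ x₀ ∈ U ∧ (∀ i, 𝒢.SectionOn EM EG U (e i)) ∧
      (∀ x ∈ U, ∀ i j, c i x (e j x) = if i = j then 1 else 0) ∧
      (∀ x ∈ U, ∀ v, modelDeriv 𝓘(ℝ, EG) 𝓘(ℝ, EM) 𝒢.src (𝒢.one x) v = 0 →
        ∑ i, c i x v • e i x = v) ∧
      ∀ (v : P → EG) (p : P), π p ∈ U →
        SmoothAlongAt 𝓘(ℝ, EG) 𝓘(ℝ, EP) (fun q => 𝒢.one (π q)) v p →
        ∀ i, ContMDiffAt 𝓘(ℝ, EP) 𝓘(ℝ, ℝ) ∞ (fun q => c i (π q) (v q)) p := by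
  -- The frame of the α-vertical bundle near the unit ε(x₀) restricts along the identity section to
  -- a frame of AG.
  obtain ⟨c⟩ := h𝒢.isSubmersion_src.exists_chart (𝒢.one x₀)
  refine ⟨𝒢.one ⁻¹' c.e.source, finrank ℝ c.K, fun i x => c.frame i (𝒢.one x),
    fun i x => c.coef i (𝒢.one x), c.e.open_source.preimage h𝒢.contMDiff_one.continuous,
    c.mem_source, fun i x hx => ⟨?_, ?_⟩, fun x hx => c.coef_frame hx, fun x hx v hv => ?_,
    fun v p hp hv => c.contMDiffAt_coef hv hp⟩
  · exact (c.smoothAlongAt_frame hx i).comp h𝒢.contMDiff_one.contMDiffAt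
  · exact c.frame_mem_ker hx h𝒢.isSubmersion_src.contMDiff.contMDiffAt.mdiff i
  · exact c.sum_coef hx h𝒢.isSubmersion_src.contMDiff.contMDiffAt.mdiff hv

end SetGroupoid

end

/-! ### Bracket identities and local frames for the Lie algebroid of a Lie groupoid. -/

noncomputable section

namespace SetGroupoid

variable {EM EG M G : Type*} [NormedAddCommGroup EM] [NormedSpace ℝ EM]
  [NormedAddCommGroup EG] [NormedSpace ℝ EG] [TopologicalSpace M] [ChartedSpace EM M]
  [TopologicalSpace G] [ChartedSpace EG G] {𝒢 : SetGroupoid M G} {U : Set M} {X Y Z : M → EG}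
  [IsManifold 𝓘(ℝ, EM) ∞ M] [IsManifold 𝓘(ℝ, EG) ∞ G]

namespace IsLieGroupoid

section brackets

variable [CompleteSpace EG]

theorem sectionBracket_add (h𝒢 : 𝒢.IsLieGroupoid EM EG) (hU : IsOpen U)
    (hY : 𝒢.SectionOn EM EG U Y) (hZ : 𝒢.SectionOn EM EG U Z) {x : M} (hx : x ∈ U) :
    𝒢.sectionBracket EG X (fun y => Y y + Z y) x =
      𝒢.sectionBracket EG X Y x + 𝒢.sectionBracket EG X Z x := by
  have hx' : 𝒢.tgt (𝒢.one x) ∈ U := by rwa [𝒢.tgt_one]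
  unfold sectionBracket
  rw [leftVF_add]
  exact fieldBracket_add_right (h𝒢.smoothAlongAt_leftVF hU hY hx')
    (h𝒢.smoothAlongAt_leftVF hU hZ hx')

/-- The left-invariant field of fY is (f ∘ β) times that of Y. The Leibniz rule for vector fields at
the unit then produces the derivative of f along Tβ(X), which is the anchor. -/
theorem sectionBracket_smul (h𝒢 : 𝒢.IsLieGroupoid EM EG) (hU : IsOpen U)
    (hX : 𝒢.SectionOn EM EG U X) (hY : 𝒢.SectionOn EM EG U Y) {f : M → ℝ} {x : M} (hx : x ∈ U)
    (hf : ContMDiffAt 𝓘(ℝ, EM) 𝓘(ℝ, ℝ) ∞ f x) :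
    𝒢.sectionBracket EG X (fun y => f y • Y y) x = f x • 𝒢.sectionBracket EG X Y x +
      modelDeriv 𝓘(ℝ, EM) 𝓘(ℝ, ℝ) f x
        (modelDeriv 𝓘(ℝ, EG) 𝓘(ℝ, EM) 𝒢.tgt (𝒢.one x) (X x)) • Y x := by
  have hx' : 𝒢.tgt (𝒢.one x) ∈ U := by rwa [𝒢.tgt_one]
  have hfx : MDifferentiableAt 𝓘(ℝ, EM) 𝓘(ℝ, ℝ) f (𝒢.tgt (𝒢.one x)) := by
    rw [𝒢.tgt_one]; exact hf.mdiff
  have hβ : MDifferentiableAt 𝓘(ℝ, EG) 𝓘(ℝ, EM) 𝒢.tgt (𝒢.one x) :=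
    h𝒢.isSubmersion_tgt.contMDiff.contMDiffAt.mdiff
  unfold sectionBracket
  rw [leftVF_smul, fieldBracket_smul_right (f := fun g => f (𝒢.tgt g)) (hfx.comp _ hβ)
    (h𝒢.smoothAlongAt_leftVF hU hY hx'), modelDeriv_comp_apply hfx hβ,
    h𝒢.leftVF_one (hX x hx).2, h𝒢.leftVF_one (hY x hx).2, 𝒢.tgt_one, add_comm]

variable [CompleteSpace EM]

/-- The left-invariant field of a bracket is the bracket of the left-invariant fields near the unit.
Iterated brackets of sections thus become iterated brackets of vector fields, and the Jacobi
identity is inherited. -/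
theorem sectionBracket_sectionBracket (h𝒢 : 𝒢.IsLieGroupoid EM EG) (hU : IsOpen U)
    (hY : 𝒢.SectionOn EM EG U Y) (hZ : 𝒢.SectionOn EM EG U Z) {x : M} (hx : x ∈ U) :
    𝒢.sectionBracket EG X (𝒢.sectionBracket EG Y Z) x =
      fieldBracket EG (𝒢.leftVF EG X) (fieldBracket EG (𝒢.leftVF EG Y) (𝒢.leftVF EG Z))
        (𝒢.one x) :=
  fieldBracket_congr (.of_forall fun _ => rfl)
    ((h𝒢.eventually_tgt_mem hU (by rwa [𝒢.tgt_one])).mono fun _ hg =>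
      h𝒢.leftVF_sectionBracket hU hY hZ hg)

theorem sectionBracket_jacobi (h𝒢 : 𝒢.IsLieGroupoid EM EG) (hU : IsOpen U)
    (hX : 𝒢.SectionOn EM EG U X) (hY : 𝒢.SectionOn EM EG U Y) (hZ : 𝒢.SectionOn EM EG U Z)
    {x : M} (hx : x ∈ U) :
    𝒢.sectionBracket EG X (𝒢.sectionBracket EG Y Z) x +
      𝒢.sectionBracket EG Y (𝒢.sectionBracket EG Z X) x +
      𝒢.sectionBracket EG Z (𝒢.sectionBracket EG X Y) x = 0 := by
  have hx' : 𝒢.tgt (𝒢.one x) ∈ U := by rwa [𝒢.tgt_one]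
  rw [h𝒢.sectionBracket_sectionBracket hU hY hZ hx, h𝒢.sectionBracket_sectionBracket hU hZ hX hx,
    h𝒢.sectionBracket_sectionBracket hU hX hY hx]
  exact fieldBracket_jacobi (h𝒢.smoothAlongAt_leftVF hU hX hx')
    (h𝒢.smoothAlongAt_leftVF hU hY hx') (h𝒢.smoothAlongAt_leftVF hU hZ hx')

end brackets

variable [FiniteDimensional ℝ EG]

/-- The frame comes with dual functionals. They prove independence, and they turn a smooth section
into smooth coefficients; here π is the identity of M. -/
theorem lieAlgebroid_frame (h𝒢 : 𝒢.IsLieGroupoid EM EG) (x₀ : M) :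
    ∃ (U : Set M) (k : ℕ) (e : Fin k → M → EG),
    IsOpen U ∧ x₀ ∈ U ∧ (∀ i, 𝒢.SectionOn EM EG U (e i)) ∧
    (∀ x ∈ U, LinearIndependent ℝ (fun i => e i x) ∧
      Submodule.span ℝ (Set.range fun i => e i x) =
        LinearMap.ker (modelDeriv 𝓘(ℝ, EG) 𝓘(ℝ, EM) 𝒢.src (𝒢.one x)).toLinearMap) ∧
    ∀ (V : Set M) (X : M → EG), IsOpen V → V ⊆ U →
      (∀ x ∈ V, modelDeriv 𝓘(ℝ, EG) 𝓘(ℝ, EM) 𝒢.src (𝒢.one x) (X x) = 0) →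
      ((𝒢.lieAlgebroid EM EG).Smooth V X ↔
        ∃ c : Fin k → M → ℝ, (∀ i, ContMDiffOn 𝓘(ℝ, EM) 𝓘(ℝ, ℝ) ∞ (c i) V) ∧
        ∀ x ∈ V, X x = ∑ i, c i x • e i x) := by
  obtain ⟨U, k, e, c, hU, hx₀, he, hce, hsum, hc⟩ := h𝒢.exists_frame (EP := EM) (fun x : M => x) x₀
  refine ⟨U, k, e, hU, hx₀, he, fun x hx => ⟨?_, le_antisymm ?_ ?_⟩, fun V X hV hVU hX => ?_⟩
  · rw [Fintype.linearIndependent_iff]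
    intro a ha i
    have := congrArg (c i x) ha
    simpa [map_sum, hce x hx] using this
  · rw [Submodule.span_le]
    rintro _ ⟨i, rfl⟩
    exact (he i x hx).2
  · intro v hv
    rw [← hsum x hx v hv]
    exact Submodule.sum_mem _ fun i _ => Submodule.smul_mem _ _
      (Submodule.subset_span (mem_range_self i))
  · rw [smooth_iff hV]
    constructor
    · intro h
      exact ⟨fun i x => c i x (X x),
        fun i x hx => (hc X x (hVU hx) (h x hx) i).contMDiffWithinAt,
        fun x hx => (hsum x (hVU hx) _ (hX x hx)).symm⟩
    · rintro ⟨a, ha, haX⟩ x hx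
      refine (SmoothAlongAt.sum h𝒢.contMDiff_one.contMDiffAt (v := fun i x => a i x • e i x)
        fun i => (he i x (hVU hx)).1.smul ((ha i).contMDiffAt (hV.mem_nhds hx))).congr
        (.of_forall fun _ => rfl) ?_
      filter_upwards [hV.mem_nhds hx] with y hy using haX y hy

variable [FiniteDimensional ℝ EM]

/-- The Lie algebroid of a Lie groupoid satisfies the axioms of a Lie algebroid. -/
theorem isLieAlgebroid (h𝒢 : 𝒢.IsLieGroupoid EM EG) :
    (𝒢.lieAlgebroid EM EG).IsLieAlgebroid := by
  have : CompleteSpace EM := FiniteDimensional.complete ℝ EM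
  have : CompleteSpace EG := FiniteDimensional.complete ℝ EG
  constructor
  · intro U V X _ _ hVU hX
    exact ⟨ContMDiffOn.mono hX.1 hVU, fun x hx => hX.2 x (hVU hx)⟩
  · intro U X hU h
    refine (isSection_iff hU).2 fun x hx => ?_
    obtain ⟨V, hV, hxV, hX⟩ := h x hx
    exact (isSection_iff hV).1 hX x hxV
  · intro x₀
    obtain ⟨U, k, e, hU, hx₀, he, hspan, hs⟩ := h𝒢.lieAlgebroid_frame x₀
    exact ⟨U, k, e, hU, hx₀, fun i => (isSection_iff hU).2 (he i), hspan, hs⟩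
  · intro U X hU hX x hx
    have h := ((isSection_iff hU).1 hX x hx).1.map
      (h𝒢.isSubmersion_tgt.contMDiff.contMDiffAt (x := 𝒢.one x))
    exact ContMDiffAt.contMDiffWithinAt
      (h.congr (.of_forall fun y => (𝒢.tgt_one y).symm) (.of_forall fun _ => rfl))
  · intro U X Y hU hX hY
    replace hX := (isSection_iff hU).1 hX
    replace hY := (isSection_iff hU).1 hY
    exact (isSection_iff hU).2 (h𝒢.sectionOn_sectionBracket hU hX hY)
  · intro U X X' Y Y' hU _ _ _ _ hXX hYY x hx
    exact sectionBracket_congr hXX hYY h𝒢.isSubmersion_tgt.contMDiff.continuous hU hx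
  · intro U X Y Z hU _ hY hZ x hx
    replace hY := (isSection_iff hU).1 hY
    replace hZ := (isSection_iff hU).1 hZ
    exact h𝒢.sectionBracket_add hU hY hZ hx
  · intro U X Y _ _ _ x _
    exact fieldBracket_swap (V := 𝒢.leftVF EG X) (W := 𝒢.leftVF EG Y) (x := 𝒢.one x)
  · intro U X Y Z hU hX hY hZ x hx
    replace hX := (isSection_iff hU).1 hX
    replace hY := (isSection_iff hU).1 hY
    replace hZ := (isSection_iff hU).1 hZ
    exact h𝒢.sectionBracket_jacobi hU hX hY hZ hx
  · intro U X Y f hU hX hY hf x hx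
    replace hX := (isSection_iff hU).1 hX
    replace hY := (isSection_iff hU).1 hY
    exact h𝒢.sectionBracket_smul hU hX hY hx (hf.contMDiffAt (hU.mem_nhds hx))

end IsLieGroupoid

end SetGroupoid

end

noncomputable section

namespace SetGroupoid

/-! ### Morphisms of Lie groupoids -/

variable {EM EM' EG EH M M' G H : Type*} [NormedAddCommGroup EM] [NormedSpace ℝ EM]
  [NormedAddCommGroup EM'] [NormedSpace ℝ EM']
  [NormedAddCommGroup EG] [NormedSpace ℝ EG] [NormedAddCommGroup EH] [NormedSpace ℝ EH]
  [TopologicalSpace M] [ChartedSpace EM M] [TopologicalSpace M'] [ChartedSpace EM' M']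
  [TopologicalSpace G] [ChartedSpace EG G] [TopologicalSpace H] [ChartedSpace EH H]
  {𝒢 : SetGroupoid M G} {ℋ : SetGroupoid M' H}

variable (EM EM' EG EH) in
/-- `Φ` is a smooth morphism of groupoids over the smooth map `φ` of the bases. -/
structure IsMorphism (𝒢 : SetGroupoid M G) (ℋ : SetGroupoid M' H) (Φ : G → H) (φ : M → M') :
    Prop where
  smooth : ContMDiff 𝓘(ℝ, EG) 𝓘(ℝ, EH) ∞ Φ
  smooth_base : ContMDiff 𝓘(ℝ, EM) 𝓘(ℝ, EM') ∞ φ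
  src_map : ∀ g, ℋ.src (Φ g) = φ (𝒢.src g)
  tgt_map : ∀ g, ℋ.tgt (Φ g) = φ (𝒢.tgt g)
  one_map : ∀ x, Φ (𝒢.one x) = ℋ.one (φ x)
  mul_map : ∀ g k, 𝒢.tgt g = 𝒢.src k → Φ (𝒢.mulExt g k) = ℋ.mulExt (Φ g) (Φ k)

namespace IsMorphism

variable {Φ : G → H} {φ : M → M'} (hΦ : IsMorphism EM EM' EG EH 𝒢 ℋ Φ φ)
include hΦ

theorem modelDeriv_src (h𝒢 : 𝒢.IsLieGroupoid EM EG) (hℋ : ℋ.IsLieGroupoid EM' EH) {g : G} {v : EG}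
    (hv : modelDeriv 𝓘(ℝ, EG) 𝓘(ℝ, EM) 𝒢.src g v = 0) :
    modelDeriv 𝓘(ℝ, EH) 𝓘(ℝ, EM') ℋ.src (Φ g) (modelDeriv 𝓘(ℝ, EG) 𝓘(ℝ, EH) Φ g v) = 0 := by
  rw [← modelDeriv_comp_apply hℋ.isSubmersion_src.contMDiff.contMDiffAt.mdiff
    hΦ.smooth.contMDiffAt.mdiff]
  rw [modelDeriv_congr (g := fun k => φ (𝒢.src k)) (.of_forall hΦ.src_map),
    modelDeriv_comp_apply hΦ.smooth_base.contMDiffAt.mdiff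
      h𝒢.isSubmersion_src.contMDiff.contMDiffAt.mdiff, hv, map_zero]

variable [IsManifold 𝓘(ℝ, EM) ∞ M] [IsManifold 𝓘(ℝ, EG) ∞ G]
  [IsManifold 𝓘(ℝ, EM') ∞ M'] [IsManifold 𝓘(ℝ, EH) ∞ H]

/-- On the α-fibre of k one has Φ ∘ l_g = l_{Φ(g)} ∘ Φ, and this identity is differentiated along
the fibre. -/
theorem modelDeriv_leftD (h𝒢 : 𝒢.IsLieGroupoid EM EG) (hℋ : ℋ.IsLieGroupoid EM' EH) {g k : G}
    (c : 𝒢.tgt g = 𝒢.src k) {v : EG} (hv : modelDeriv 𝓘(ℝ, EG) 𝓘(ℝ, EM) 𝒢.src k v = 0) :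
    modelDeriv 𝓘(ℝ, EG) 𝓘(ℝ, EH) Φ (𝒢.mulExt g k) (𝒢.leftD EG g k v) =
      ℋ.leftD EH (Φ g) (Φ k) (modelDeriv 𝓘(ℝ, EG) 𝓘(ℝ, EH) Φ k v) := by
  have c' : ℋ.tgt (Φ g) = ℋ.src (Φ k) := by rw [hΦ.tgt_map, hΦ.src_map, c]
  obtain ⟨m, hm⟩ := hℋ.exists_isLocalMul c'
  have hΦk : ContMDiffAt 𝓘(ℝ, EG) 𝓘(ℝ, EH) ∞ Φ k := hΦ.smooth.contMDiffAt
  rw [hℋ.leftD_eq_localMul hm c' (hΦ.modelDeriv_src h𝒢 hℋ hv),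
    ← modelDeriv_comp_apply (g := fun y => m (Φ g, y)) hm.contMDiffAt_right.mdiff hΦk.mdiff]
  refine h𝒢.modelDeriv_leftD c hΦ.smooth.contMDiffAt.mdiff
    (hm.contMDiffAt_right.mdiff.comp k hΦk.mdiff) ?_ hv
  filter_upwards [hΦk.continuousAt.eventually (hm.eventually_right c')] with y hy hs
  rw [hΦ.mul_map g y (c.trans hs.symm), hy (by rw [hΦ.src_map, hΦ.src_map, hs])]
  rfl

/-- The base map φ need not be injective, so the image of X need not be a section over the new base.
The right side is therefore a translate of the pushed vector, not a left-invariant field of a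
section. -/
theorem modelDeriv_leftVF (h𝒢 : 𝒢.IsLieGroupoid EM EG) (hℋ : ℋ.IsLieGroupoid EM' EH) {X : M → EG}
    {g : G} (hv : modelDeriv 𝓘(ℝ, EG) 𝓘(ℝ, EM) 𝒢.src (𝒢.one (𝒢.tgt g)) (X (𝒢.tgt g)) = 0) :
    modelDeriv 𝓘(ℝ, EG) 𝓘(ℝ, EH) Φ g (𝒢.leftVF EG X g) =
      ℋ.leftD EH (Φ g) (ℋ.one (ℋ.tgt (Φ g)))
        (modelDeriv 𝓘(ℝ, EG) 𝓘(ℝ, EH) Φ (𝒢.one (𝒢.tgt g)) (X (𝒢.tgt g))) := by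
  have := hΦ.modelDeriv_leftD h𝒢 hℋ (𝒢.src_one (𝒢.tgt g)).symm hv
  rw [𝒢.mulExt_one rfl, hΦ.one_map, ← hΦ.tgt_map] at this
  exact this

end IsMorphism

section iso

variable {ℋ : SetGroupoid M H} {Φ : G → H}

theorem IsLieGroupoidIso.isMorphism (h : 𝒢.IsLieGroupoidIso EM EG EH ℋ Φ) :
    IsMorphism EM EM EG EH 𝒢 ℋ Φ (fun x => x) where
  smooth := by
    obtain ⟨e, rfl⟩ := h.diffeo
    exact e.contMDiff
  smooth_base := contMDiff_id
  src_map := h.src_map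
  tgt_map := h.tgt_map
  one_map := h.one_map
  mul_map g k c := by
    obtain ⟨c', hc⟩ := h.mul_map g k c
    rw [mulExt_eq_mul _ c, mulExt_eq_mul _ c', hc]

variable [IsManifold 𝓘(ℝ, EM) ∞ M] [IsManifold 𝓘(ℝ, EG) ∞ G] [IsManifold 𝓘(ℝ, EH) ∞ H]
  [FiniteDimensional ℝ EM] [FiniteDimensional ℝ EG] [FiniteDimensional ℝ EH]

/-- The Lie functor maps isomorphisms of Lie groupoids to isomorphisms of Lie algebroids. -/
theorem IsLieGroupoidIso.isLieAlgebroidIso (h : 𝒢.IsLieGroupoidIso EM EG EH ℋ Φ) :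
    (𝒢.lieAlgebroid EM EG).IsLieAlgebroidIso (ℋ.lieAlgebroid EM EH)
      (𝒢.algebroidMap EG EH ℋ Φ) := by
  have : CompleteSpace EM := FiniteDimensional.complete ℝ EM
  have : CompleteSpace EG := FiniteDimensional.complete ℝ EG
  have : CompleteSpace EH := FiniteDimensional.complete ℝ EH
  have hΦ := h.isMorphism
  obtain ⟨e, he⟩ := h.diffeo
  have hΨ : ContMDiff 𝓘(ℝ, EH) 𝓘(ℝ, EG) ∞ e.symm := e.symm.contMDiff
  have hΨΦ (g : G) : e.symm (Φ g) = g := by rw [← he]; exact e.symm_apply_apply g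
  have hΦΨ (k : H) : Φ (e.symm k) = k := by rw [← he]; exact e.apply_symm_apply k
  have dΨΦ (g : G) (v : EG) : modelDeriv 𝓘(ℝ, EH) 𝓘(ℝ, EG) e.symm (Φ g)
      (modelDeriv 𝓘(ℝ, EG) 𝓘(ℝ, EH) Φ g v) = v := by
    rw [← modelDeriv_comp_apply hΨ.contMDiffAt.mdiff hΦ.smooth.contMDiffAt.mdiff,
      modelDeriv_of_eventuallyEq_id (.of_forall hΨΦ)]
    rfl
  have dΦΨ (g : G) (w : EH) : modelDeriv 𝓘(ℝ, EG) 𝓘(ℝ, EH) Φ g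
      (modelDeriv 𝓘(ℝ, EH) 𝓘(ℝ, EG) e.symm (Φ g) w) = w := by
    have := modelDeriv_comp_apply (f := e.symm) (x := Φ g) (g := Φ) hΦ.smooth.contMDiffAt.mdiff
      hΨ.contMDiffAt.mdiff w
    rw [modelDeriv_of_eventuallyEq_id (.of_forall hΦΨ), hΨΦ] at this
    exact this.symm
  have hker (x : M) (v : EG) (hv : modelDeriv 𝓘(ℝ, EG) 𝓘(ℝ, EM) 𝒢.src (𝒢.one x) v = 0) :
      modelDeriv 𝓘(ℝ, EH) 𝓘(ℝ, EM) ℋ.src (ℋ.one x)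
        (modelDeriv 𝓘(ℝ, EG) 𝓘(ℝ, EH) Φ (𝒢.one x) v) = 0 := by
    rw [← h.one_map]
    exact hΦ.modelDeriv_src h.source h.target hv
  have hsmooth (X : M → EG) (x : M) (hX : SmoothAlongAt 𝓘(ℝ, EG) 𝓘(ℝ, EM) 𝒢.one X x) :
      SmoothAlongAt 𝓘(ℝ, EH) 𝓘(ℝ, EM) ℋ.one
        (fun y => modelDeriv 𝓘(ℝ, EG) 𝓘(ℝ, EH) Φ (𝒢.one y) (X y)) x :=
    (hX.map hΦ.smooth.contMDiffAt).congr (.of_forall fun y => (h.one_map y).symm)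
      (.of_forall fun _ => rfl)
  refine ⟨h.source.isLieAlgebroid, h.target.isLieAlgebroid, fun x => ⟨?_, ?_, ?_⟩, ?_, ?_, ?_⟩
  · exact fun v hv => hker x v hv
  · exact (Function.LeftInverse.injective (dΨΦ (𝒢.one x))).injOn
  · intro w hw
    refine ⟨modelDeriv 𝓘(ℝ, EH) 𝓘(ℝ, EG) e.symm (Φ (𝒢.one x)) w, ?_, dΦΨ (𝒢.one x) w⟩
    change modelDeriv 𝓘(ℝ, EG) 𝓘(ℝ, EM) 𝒢.src (𝒢.one x)
      (modelDeriv 𝓘(ℝ, EH) 𝓘(ℝ, EG) e.symm (Φ (𝒢.one x)) w) = 0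
    have hw' : modelDeriv 𝓘(ℝ, EH) 𝓘(ℝ, EM) ℋ.src (ℋ.one x) w = 0 := hw
    rw [← h.one_map, ← dΦΨ (𝒢.one x) w, ← modelDeriv_comp_apply
      h.target.isSubmersion_src.contMDiff.contMDiffAt.mdiff hΦ.smooth.contMDiffAt.mdiff,
      modelDeriv_congr (g := 𝒢.src) (.of_forall h.src_map)] at hw'
    exact hw'
  · intro U X hU _
    refine (smooth_iff hU).trans (Iff.trans ?_ (smooth_iff hU).symm)
    refine forall₂_congr fun x _ => ⟨fun hX => hsmooth X x hX, fun hX => ?_⟩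
    refine (SmoothAlongAt.map hX (hΨ.contMDiffAt (x := ℋ.one x))).congr (.of_forall fun y => ?_)
      (.of_forall fun y => ?_)
    · rw [← h.one_map, hΨΦ]
    · rw [← h.one_map]
      exact (dΨΦ (𝒢.one y) (X y)).symm
  · intro x (v : EG) _
    change modelDeriv 𝓘(ℝ, EH) 𝓘(ℝ, EM) ℋ.tgt (ℋ.one x)
      (modelDeriv 𝓘(ℝ, EG) 𝓘(ℝ, EH) Φ (𝒢.one x) v) =
        modelDeriv 𝓘(ℝ, EG) 𝓘(ℝ, EM) 𝒢.tgt (𝒢.one x) v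
    rw [← h.one_map, ← modelDeriv_comp_apply
      h.target.isSubmersion_tgt.contMDiff.contMDiffAt.mdiff hΦ.smooth.contMDiffAt.mdiff,
      modelDeriv_congr (g := 𝒢.tgt) (.of_forall h.tgt_map)]
  · intro U X Y hU hX hY x hx
    replace hX := (isSection_iff hU).1 hX
    replace hY := (isSection_iff hU).1 hY
    have hsec (Z : M → EG) (hZ : 𝒢.SectionOn EM EG U Z) : ℋ.SectionOn EM EH U
        (fun y => modelDeriv 𝓘(ℝ, EG) 𝓘(ℝ, EH) Φ (𝒢.one y) (Z y)) := fun y hy =>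
      ⟨hsmooth Z y (hZ y hy).1, hker y (Z y) (hZ y hy).2⟩
    have hx' : 𝒢.tgt (𝒢.one x) ∈ U := by rwa [𝒢.tgt_one]
    have hx'' : ℋ.tgt (Φ (𝒢.one x)) ∈ U := by rwa [h.tgt_map]
    -- Over the identity of M the pushed vectors do form a section, and its left-invariant field is
    -- Φ-related to the one of Z; so brackets correspond.
    have key (Z : M → EG) (hZ : 𝒢.SectionOn EM EG U Z) : ∀ᶠ g in 𝓝 (𝒢.one x),
        modelDeriv 𝓘(ℝ, EG) 𝓘(ℝ, EH) Φ g (𝒢.leftVF EG Z g) =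
          ℋ.leftVF EH (fun y => modelDeriv 𝓘(ℝ, EG) 𝓘(ℝ, EH) Φ (𝒢.one y) (Z y)) (Φ g) := by
      filter_upwards [h.source.eventually_tgt_mem hU hx'] with g hg
      rw [hΦ.modelDeriv_leftVF h.source h.target (hZ _ hg).2, ← h.tgt_map]
      rfl
    have main := modelDeriv_fieldBracket_of_related_along (hΦ.smooth.contMDiffAt (x := 𝒢.one x))
      (h.source.smoothAlongAt_leftVF hU hX hx') (h.source.smoothAlongAt_leftVF hU hY hx')
      (h.target.smoothAlongAt_leftVF hU (hsec X hX) hx'')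
      (h.target.smoothAlongAt_leftVF hU (hsec Y hY) hx'') (r := fun y => y) mdifferentiableAt_id rfl
      (by rw [modelDeriv_id]; rfl) (by rw [modelDeriv_id]; rfl) (key X hX) (key Y hY)
    rw [h.one_map] at main
    exact main

end iso

end SetGroupoid

end

noncomputable section

/-! ### Transport of Lie algebroids -/

namespace AlgebroidData

variable {E : Type*} [NormedAddCommGroup E] [NormedSpace ℝ E]
  {N : Type*} [TopologicalSpace N] [ChartedSpace E N] [IsManifold 𝓘(ℝ, E) ∞ N]
  {𝒜 ℬ 𝒞 : AlgebroidData E N}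

/-- Smoothness in a local frame is a condition on the values over the open set alone; gluing passes
from frame domains to U. -/
theorem IsLieAlgebroid.isSection_congr (h : 𝒜.IsLieAlgebroid) {U : Set N} {X X' : ∀ x, 𝒜.Amb x}
    (hU : IsOpen U) (hX : 𝒜.IsSection U X) (hXX : ∀ x ∈ U, X x = X' x) : 𝒜.IsSection U X' := by
  refine h.glue U X' hU fun x hx => ?_
  obtain ⟨W, k, e, hW, hxW, -, -, hs⟩ := h.frame x
  have hV := hU.inter hW
  have hXV := h.mono U (U ∩ W) X hU hV inter_subset_left hX
  have hXV' : ∀ y ∈ U ∩ W, X' y ∈ 𝒜.fib y := fun y hy => hXX y hy.1 ▸ hX.2 y hy.1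
  refine ⟨U ∩ W, hV, ⟨hx, hxW⟩, ?_, hXV'⟩
  obtain ⟨c, hc, hcX⟩ := (hs _ X hV inter_subset_right hXV.2).1 hXV.1
  exact (hs _ X' hV inter_subset_right hXV').2 ⟨c, hc, fun y hy => hXX y hy.1 ▸ hcX y hy⟩

section transport

variable {F : ∀ x, 𝒜.Amb x →ₗ[ℝ] ℬ.Amb x}

/-- A bundle isomorphism `F` that maps the bracket of a Lie algebroid `𝒜` to the one of `ℬ` is an
isomorphism of Lie algebroids. In particular `ℬ` is a Lie algebroid. -/
theorem IsLieAlgebroid.isLieAlgebroidIso (h : 𝒜.IsLieAlgebroid)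
    (hadd : ∀ (U : Set N) (X Y : ∀ x, 𝒜.Amb x), IsOpen U → 𝒜.IsSection U X → 𝒜.IsSection U Y →
      𝒜.IsSection U (fun x => X x + Y x))
    (hsmul : ∀ (U : Set N) (f : N → ℝ) (X : ∀ x, 𝒜.Amb x), IsOpen U →
      ContMDiffOn 𝓘(ℝ, E) 𝓘(ℝ, ℝ) ∞ f U → 𝒜.IsSection U X → 𝒜.IsSection U (fun x => f x • X x))
    (hbij : ∀ x, Set.BijOn (F x) (𝒜.fib x) (ℬ.fib x))
    (hcongr : ∀ (U : Set N) (Z Z' : ∀ x, ℬ.Amb x), IsOpen U → (∀ x ∈ U, Z x = Z' x) →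
      ℬ.Smooth U Z → ℬ.Smooth U Z')
    (hsmooth : ∀ (U : Set N) (X : ∀ x, 𝒜.Amb x), IsOpen U → (∀ x ∈ U, X x ∈ 𝒜.fib x) →
      (𝒜.Smooth U X ↔ ℬ.Smooth U (fun x => F x (X x))))
    (hanchor : ∀ x, ∀ v ∈ 𝒜.fib x, ℬ.anchor x (F x v) = 𝒜.anchor x v)
    (hbracket : ∀ (U : Set N) (X Y : ∀ x, 𝒜.Amb x) (Z W : ∀ x, ℬ.Amb x), IsOpen U →
      𝒜.IsSection U X → 𝒜.IsSection U Y → (∀ x ∈ U, F x (X x) = Z x) →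
      (∀ x ∈ U, F x (Y x) = W x) → ∀ x ∈ U, F x (𝒜.bracket X Y x) = ℬ.bracket Z W x) :
    𝒜.IsLieAlgebroidIso ℬ F := by
  -- The inverse of F on the fibres. Every section of ℬ is the image of its lift, so each axiom for
  -- ℬ is the same axiom for 𝒜 applied to lifts and then pushed forward.
  let I (x : N) (z : ℬ.Amb x) : 𝒜.Amb x := Function.invFunOn (F x) (𝒜.fib x) z
  have hI (x : N) (z : ℬ.Amb x) (hz : z ∈ ℬ.fib x) : I x z ∈ 𝒜.fib x ∧ F x (I x z) = z :=
    Function.invFunOn_pos ((hbij x).surjOn hz)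
  have push (U : Set N) (X : ∀ x, 𝒜.Amb x) (Z : ∀ x, ℬ.Amb x) (hU : IsOpen U)
      (hX : 𝒜.IsSection U X) (hXZ : ∀ x ∈ U, F x (X x) = Z x) : ℬ.IsSection U Z :=
    ⟨hcongr U _ Z hU hXZ ((hsmooth U X hU hX.2).1 hX.1),
      fun x hx => hXZ x hx ▸ (hbij x).mapsTo (hX.2 x hx)⟩
  have liftS (U : Set N) (Z : ∀ x, ℬ.Amb x) (hU : IsOpen U) (hZ : ∀ x ∈ U, Z x ∈ ℬ.fib x) :
      ℬ.Smooth U Z ↔ 𝒜.Smooth U (fun x => I x (Z x)) := by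
    have e : ∀ x ∈ U, F x (I x (Z x)) = Z x := fun x hx => (hI x _ (hZ x hx)).2
    rw [hsmooth U (fun x => I x (Z x)) hU fun x hx => (hI x _ (hZ x hx)).1]
    exact ⟨hcongr U _ _ hU fun x hx => (e x hx).symm, hcongr U _ _ hU e⟩
  have lift (U : Set N) (Z : ∀ x, ℬ.Amb x) (hU : IsOpen U) (hZ : ℬ.IsSection U Z) :
      𝒜.IsSection U (fun x => I x (Z x)) ∧ ∀ x ∈ U, F x (I x (Z x)) = Z x :=
    ⟨⟨(liftS U Z hU hZ.2).1 hZ.1, fun x hx => (hI x _ (hZ.2 x hx)).1⟩,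
      fun x hx => (hI x _ (hZ.2 x hx)).2⟩
  refine ⟨h, ?_, hbij, hsmooth, hanchor, fun U X Y hU hX hY =>
    hbracket U X Y _ _ hU hX hY (fun _ _ => rfl) fun _ _ => rfl⟩
  constructor
  · intro U V Z hU hV hVU hZ
    obtain ⟨hX, e⟩ := lift U Z hU hZ
    exact push V _ Z hV (h.mono U V _ hU hV hVU hX) fun x hx => e x (hVU hx)
  · intro U Z hU hZ
    have hZ' : ∀ x ∈ U, Z x ∈ ℬ.fib x := fun x hx => by
      obtain ⟨V, _, hxV, hV⟩ := hZ x hx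
      exact hV.2 x hxV
    refine push U (fun x => I x (Z x)) Z hU (h.glue U _ hU fun x hx => ?_)
      fun x hx => (hI x _ (hZ' x hx)).2
    obtain ⟨V, hV, hxV, hZV⟩ := hZ x hx
    exact ⟨V, hV, hxV, (lift V Z hV hZV).1⟩
  · intro x₀
    obtain ⟨U, k, e, hU, hx₀, he, hspan, hs⟩ := h.frame x₀
    refine ⟨U, k, fun i x => F x (e i x), hU, hx₀, fun i => push U (e i) _ hU (he i)
      fun _ _ => rfl, fun x hx => ⟨?_, ?_⟩, fun V Z hV hVU hZ => ?_⟩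
    · refine (hspan x hx).1.map_injOn (F x) ?_
      rw [(hspan x hx).2]
      exact (hbij x).injOn
    · have e1 : (Set.range fun i => F x (e i x)) = F x '' Set.range fun i => e i x := by
        rw [← Set.range_comp]; rfl
      rw [e1, Submodule.span_image, (hspan x hx).2]
      exact SetLike.coe_injective ((Submodule.map_coe _ _).trans (hbij x).image_eq)
    · rw [liftS V Z hV hZ, hs V _ hV hVU fun x hx => (hI x _ (hZ x hx)).1]
      refine exists_congr fun c => and_congr_right fun _ => forall₂_congr fun x hx => ?_
      have hmem : ∑ i, c i x • e i x ∈ 𝒜.fib x := Submodule.sum_mem _ fun i _ =>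
        Submodule.smul_mem _ _ ((he i).2 x (hVU hx))
      rw [← (hbij x).injOn.eq_iff (hI x _ (hZ x hx)).1 hmem, (hI x _ (hZ x hx)).2]
      simp only [map_sum, map_smul]
  · intro U Z hU hZ
    obtain ⟨hX, e⟩ := lift U Z hU hZ
    refine (h.anchor_smooth U _ hU hX).congr fun x hx => ?_
    rw [← hanchor x _ (hX.2 x hx), e x hx]
  · intro U Z W hU hZ hW
    obtain ⟨hX, e⟩ := lift U Z hU hZ
    obtain ⟨hY, e'⟩ := lift U W hU hW
    exact push U _ _ hU (h.bracket_section U _ _ hU hX hY) (hbracket U _ _ Z W hU hX hY e e')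
  -- The bracket hypothesis allows any representatives that agree with the images on U, so the same
  -- lifts compute both brackets.
  · intro U Z Z' W W' hU hZ _ hW _ hZZ hWW x hx
    obtain ⟨hX, e⟩ := lift U Z hU hZ
    obtain ⟨hY, e'⟩ := lift U W hU hW
    rw [← hbracket U _ _ Z W hU hX hY e e' x hx]
    exact hbracket U _ _ Z' W' hU hX hY (fun y hy => (e y hy).trans (hZZ y hy))
      (fun y hy => (e' y hy).trans (hWW y hy)) x hx
  · intro U Z W T hU hZ hW hT x hx
    obtain ⟨hX, e⟩ := lift U Z hU hZ
    obtain ⟨hY, e'⟩ := lift U W hU hW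
    obtain ⟨hS, e''⟩ := lift U T hU hT
    rw [← hbracket U _ _ Z W hU hX hY e e' x hx, ← hbracket U _ _ Z T hU hX hS e e'' x hx,
      ← hbracket U _ _ Z (fun y => W y + T y) hU hX (hadd U _ _ hU hY hS) e (fun y hy => by
        rw [map_add, e' y hy, e'' y hy]) x hx, h.bracket_add U _ _ _ hU hX hY hS x hx, map_add]
  · intro U Z W hU hZ hW x hx
    obtain ⟨hX, e⟩ := lift U Z hU hZ
    obtain ⟨hY, e'⟩ := lift U W hU hW
    rw [← hbracket U _ _ Z W hU hX hY e e' x hx, ← hbracket U _ _ W Z hU hY hX e' e x hx,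
      h.bracket_antisymm U _ _ hU hX hY x hx, map_neg]
  · intro U Z W T hU hZ hW hT x hx
    obtain ⟨hX, e⟩ := lift U Z hU hZ
    obtain ⟨hY, e'⟩ := lift U W hU hW
    obtain ⟨hS, e''⟩ := lift U T hU hT
    rw [← hbracket U _ _ Z _ hU hX (h.bracket_section U _ _ hU hY hS) e
        (hbracket U _ _ W T hU hY hS e' e'') x hx,
      ← hbracket U _ _ W _ hU hY (h.bracket_section U _ _ hU hS hX) e'
        (hbracket U _ _ T Z hU hS hX e'' e) x hx,
      ← hbracket U _ _ T _ hU hS (h.bracket_section U _ _ hU hX hY) e''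
        (hbracket U _ _ Z W hU hX hY e e') x hx, ← map_add, ← map_add,
      h.bracket_jacobi U _ _ _ hU hX hY hS x hx, map_zero]
  · intro U Z W f hU hZ hW hf x hx
    obtain ⟨hX, e⟩ := lift U Z hU hZ
    obtain ⟨hY, e'⟩ := lift U W hU hW
    rw [← hbracket U _ _ Z W hU hX hY e e' x hx,
      ← hbracket U _ _ Z (fun y => f y • W y) hU hX (hsmul U f _ hU hf hY) e (fun y hy => by
        rw [map_smul, e' y hy]) x hx, h.leibniz U _ _ f hU hX hY hf x hx, map_add, map_smul,
      map_smul, e' x hx, ← hanchor x _ (hX.2 x hx), e x hx]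

variable {H : ∀ x, 𝒜.Amb x →ₗ[ℝ] 𝒞.Amb x} {K : ∀ x, ℬ.Amb x →ₗ[ℝ] 𝒞.Amb x}

/-- If `F` and `K ∘ F` are isomorphisms of Lie algebroids, then so is `K`. -/
theorem IsLieAlgebroidIso.of_comp (hF : 𝒜.IsLieAlgebroidIso ℬ F) (hH : 𝒜.IsLieAlgebroidIso 𝒞 H)
    (hK : ∀ x, ∀ v ∈ 𝒜.fib x, K x (F x v) = H x v) : ℬ.IsLieAlgebroidIso 𝒞 K := by
  let I (x : N) (z : ℬ.Amb x) : 𝒜.Amb x := Function.invFunOn (F x) (𝒜.fib x) z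
  have hI (x : N) (z : ℬ.Amb x) (hz : z ∈ ℬ.fib x) : I x z ∈ 𝒜.fib x ∧ F x (I x z) = z :=
    Function.invFunOn_pos ((hF.bijOn x).surjOn hz)
  have hKI (x : N) (z : ℬ.Amb x) (hz : z ∈ ℬ.fib x) : H x (I x z) = K x z := by
    rw [← hK x _ (hI x z hz).1, (hI x z hz).2]
  -- F followed by the fibrewise inverse returns Z only on U. That smoothness ignores values
  -- elsewhere follows here from ℬ being a Lie algebroid.
  have lift (U : Set N) (Z : ∀ x, ℬ.Amb x) (hU : IsOpen U) (hZ : ℬ.IsSection U Z) :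
      𝒜.IsSection U (fun x => I x (Z x)) := by
    refine ⟨?_, fun x hx => (hI x _ (hZ.2 x hx)).1⟩
    rw [hF.smooth_iff U (fun x => I x (Z x)) hU fun x hx => (hI x _ (hZ.2 x hx)).1]
    exact (hF.target.isSection_congr hU hZ fun x hx => (hI x _ (hZ.2 x hx)).2.symm).1
  have pushC (U : Set N) (X : ∀ x, 𝒜.Amb x) (hU : IsOpen U) (hX : 𝒜.IsSection U X) :
      𝒞.IsSection U (fun x => H x (X x)) :=
    ⟨(hH.smooth_iff U X hU hX.2).1 hX.1, fun x hx => (hH.bijOn x).mapsTo (hX.2 x hx)⟩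
  have pushB (U : Set N) (X : ∀ x, 𝒜.Amb x) (hU : IsOpen U) (hX : 𝒜.IsSection U X) :
      ℬ.IsSection U (fun x => F x (X x)) :=
    ⟨(hF.smooth_iff U X hU hX.2).1 hX.1, fun x hx => (hF.bijOn x).mapsTo (hX.2 x hx)⟩
  refine ⟨hF.target, hH.target, fun x => ⟨fun z hz => ?_, fun z hz z' hz' e => ?_, fun w hw => ?_⟩,
    fun U Z hU hZ => ⟨fun hs => ?_, fun hs => ?_⟩, fun x z hz => ?_, fun U Z W hU hZ hW x hx => ?_⟩
  · rw [← hKI x z hz]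
    exact (hH.bijOn x).mapsTo (hI x z hz).1
  · rw [← hKI x z hz, ← hKI x z' hz'] at e
    rw [← (hI x z hz).2, ← (hI x z' hz').2,
      (hH.bijOn x).injOn (hI x z hz).1 (hI x z' hz').1 e]
  · obtain ⟨v, hv, rfl⟩ := (hH.bijOn x).surjOn hw
    exact ⟨F x v, (hF.bijOn x).mapsTo hv, hK x v hv⟩
  · exact (hH.target.isSection_congr hU (pushC U _ hU (lift U Z hU ⟨hs, hZ⟩))
      fun x hx => hKI x _ (hZ x hx)).1
  · have hC : 𝒞.IsSection U (fun x => K x (Z x)) := ⟨hs, fun x hx => by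
      change K x (Z x) ∈ 𝒞.fib x
      rw [← hKI x _ (hZ x hx)]
      exact (hH.bijOn x).mapsTo (hI x _ (hZ x hx)).1⟩
    have hA : 𝒜.IsSection U (fun x => I x (Z x)) := by
      refine ⟨?_, fun x hx => (hI x _ (hZ x hx)).1⟩
      rw [hH.smooth_iff U (fun x => I x (Z x)) hU fun x hx => (hI x _ (hZ x hx)).1]
      exact (hH.target.isSection_congr hU hC fun x hx => (hKI x _ (hZ x hx)).symm).1
    exact (hF.target.isSection_congr hU (pushB U _ hU hA) fun x hx => (hI x _ (hZ x hx)).2).1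
  · rw [← hKI x z hz, hH.anchor_map x _ (hI x z hz).1, ← hF.anchor_map x _ (hI x z hz).1,
      (hI x z hz).2]
  · have hX := lift U Z hU hZ
    have hY := lift U W hU hW
    rw [← hF.target.bracket_congr U _ Z _ W hU (pushB U _ hU hX) hZ (pushB U _ hU hY) hW
        (fun y hy => (hI y _ (hZ.2 y hy)).2) (fun y hy => (hI y _ (hW.2 y hy)).2) x hx,
      ← hF.bracket_map U _ _ hU hX hY x hx,
      hK x _ ((hF.source.bracket_section U _ _ hU hX hY).2 x hx),
      hH.bracket_map U _ _ hU hX hY x hx]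
    refine hH.target.bracket_congr U _ _ _ _ hU (pushC U _ hU hX) ?_ (pushC U _ hU hY) ?_
      (fun y hy => hKI y _ (hZ.2 y hy)) (fun y hy => hKI y _ (hW.2 y hy)) x hx
    · exact hH.target.isSection_congr hU (pushC U _ hU hX) fun y hy => hKI y _ (hZ.2 y hy)
    · exact hH.target.isSection_congr hU (pushC U _ hU hY) fun y hy => hKI y _ (hW.2 y hy)

end transport

end AlgebroidData

end

noncomputable section

namespace SetGroupoid

/-! ### Algebra in groupoids -/

section algebra

variable {M G : Type*} (𝒢 : SetGroupoid M G)

theorem inv_mulExt_cancel_left {g h : G} (c : 𝒢.tgt g = 𝒢.src h) :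
    𝒢.mulExt (𝒢.inv g) (𝒢.mulExt g h) = h := by
  rw [← 𝒢.mulExt_assoc (𝒢.tgt_inv g) c, inv_mulExt, 𝒢.one_mulExt c]

theorem mulExt_inv_cancel_left {g h : G} (c : 𝒢.src g = 𝒢.src h) :
    𝒢.mulExt g (𝒢.mulExt (𝒢.inv g) h) = h := by
  rw [← 𝒢.mulExt_assoc (𝒢.src_inv g).symm ((𝒢.tgt_inv g).trans c), mulExt_inv, 𝒢.one_mulExt c]

theorem mulExt_inv_cancel_right {g h : G} (c : 𝒢.tgt g = 𝒢.src h) :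
    𝒢.mulExt (𝒢.mulExt g h) (𝒢.inv h) = g := by
  rw [𝒢.mulExt_assoc c (𝒢.src_inv h).symm, mulExt_inv, 𝒢.mulExt_one c]

theorem inv_mulExt_cancel_right {g h : G} (c : 𝒢.tgt g = 𝒢.tgt h) :
    𝒢.mulExt (𝒢.mulExt g (𝒢.inv h)) h = g := by
  rw [𝒢.mulExt_assoc (c.trans (𝒢.src_inv h).symm) (𝒢.tgt_inv h), inv_mulExt, 𝒢.mulExt_one c]

theorem eq_inv_of_mulExt_eq_one {g h : G} (c : 𝒢.tgt g = 𝒢.src h)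
    (e : 𝒢.mulExt g h = 𝒢.one (𝒢.tgt h)) : g = 𝒢.inv h := by
  rw [← 𝒢.mulExt_inv_cancel_right c, e, 𝒢.one_mulExt (𝒢.src_inv h).symm]

theorem inv_mulExt_eq {u w s : G} (c : 𝒢.tgt u = 𝒢.src w) (e : 𝒢.mulExt u w = s) :
    𝒢.mulExt (𝒢.inv u) s = w := by
  rw [← e, 𝒢.inv_mulExt_cancel_left c]

theorem mulExt_inv_eq {u w s : G} (c : 𝒢.tgt w = 𝒢.src u) (e : 𝒢.mulExt w u = s) :
    𝒢.mulExt s (𝒢.inv u) = w := by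
  rw [← e, 𝒢.mulExt_inv_cancel_right c]

end algebra

/-! ### Smoothness of the structure maps of G_β ⋆ G_α and P^π G. -/

section lieGroupoid

variable {EM EG M G : Type*} [NormedAddCommGroup EM] [NormedSpace ℝ EM]
  [NormedAddCommGroup EG] [NormedSpace ℝ EG] [TopologicalSpace M] [ChartedSpace EM M]
  [TopologicalSpace G] [ChartedSpace EG G] {𝒢 : SetGroupoid M G}

namespace IsLieGroupoid

section maps

variable {E' H' P : Type*} [NormedAddCommGroup E'] [NormedSpace ℝ E'] [TopologicalSpace H']
  {I : ModelWithCorners ℝ E' H'} [TopologicalSpace P] [ChartedSpace H' P]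

theorem contMDiffWithinAt_mulExt (h : 𝒢.IsLieGroupoid EM EG) {f k : P → G} {s : Set P} {x : P}
    (hf : ContMDiffWithinAt I 𝓘(ℝ, EG) ∞ f s x) (hk : ContMDiffWithinAt I 𝓘(ℝ, EG) ∞ k s x)
    (hx : x ∈ s) (c : ∀ y ∈ s, 𝒢.tgt (f y) = 𝒢.src (k y)) :
    ContMDiffWithinAt I 𝓘(ℝ, EG) ∞ (fun y => 𝒢.mulExt (f y) (k y)) s x :=
  ContMDiffWithinAt.comp (g := fun p : G × G => 𝒢.mulExt p.1 p.2) (f := fun y => (f y, k y))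
    (t := 𝒢.composable) x (h.contMDiffOn_mul _ (c x hx)) (hf.prodMk hk) c

theorem contMDiff_mulExt (h : 𝒢.IsLieGroupoid EM EG) {f k : P → G}
    (hf : ContMDiff I 𝓘(ℝ, EG) ∞ f) (hk : ContMDiff I 𝓘(ℝ, EG) ∞ k)
    (c : ∀ y, 𝒢.tgt (f y) = 𝒢.src (k y)) :
    ContMDiff I 𝓘(ℝ, EG) ∞ (fun y => 𝒢.mulExt (f y) (k y)) := fun x => by
  rw [← contMDiffWithinAt_univ]
  exact h.contMDiffWithinAt_mulExt (hf x).contMDiffWithinAt (hk x).contMDiffWithinAt (mem_univ x)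
    fun y _ => c y

end maps

theorem isFibredTriple_star (h : 𝒢.IsLieGroupoid EM EG) :
    IsFibredTriple EM EG 𝒢.tgt 𝒢.tgt 𝒢.src 𝒢.src 𝒢.starSet :=
  ⟨h.isSubmersion_tgt, h.isSubmersion_tgt, h.isSubmersion_src, h.isSubmersion_src,
    fun _ => Iff.rfl⟩

theorem isFibredTriple_prolongation (h : 𝒢.IsLieGroupoid EM EG) {π : G → M}
    (hπ : Manifold.IsSubmersion 𝓘(ℝ, EG) 𝓘(ℝ, EM) ∞ π) :
    IsFibredTriple EM EG π 𝒢.src 𝒢.tgt π (𝒢.prolongationSet π) :=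
  ⟨hπ, h.isSubmersion_src, h.isSubmersion_tgt, hπ, fun _ => Iff.rfl⟩

variable [IsManifold 𝓘(ℝ, EM) ∞ M] [IsManifold 𝓘(ℝ, EG) ∞ G]
  [FiniteDimensional ℝ EM] [FiniteDimensional ℝ EG]

/-- Smoothness is checked on the three entries. A composable pair of triples has composable middle
entries, since both ends agree under π, so the middle entry of a product is a smooth product in G.
-/
theorem prolongation (h : 𝒢.IsLieGroupoid EM EG) {π : G → M}
    (hπ : Manifold.IsSubmersion 𝓘(ℝ, EG) 𝓘(ℝ, EM) ∞ π)
    [ChartedSpace (TripleModel EM EG) (𝒢.prolongationSet π)]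
    [IsManifold 𝓘(ℝ, TripleModel EM EG) ∞ (𝒢.prolongationSet π)]
    (hS : IsEmbeddedTriple EM EG (𝒢.prolongationSet π)) :
    (𝒢.prolongation π).IsLieGroupoid EG (TripleModel EM EG) where
  isSubmersion_src := (h.isFibredTriple_prolongation hπ).isSubmersion_fst hS
  isSubmersion_tgt := (h.isFibredTriple_prolongation hπ).isSubmersion_thd hS
  contMDiff_one := hS.contMDiff contMDiff_id (h.contMDiff_one.comp hπ.contMDiff) contMDiff_id
  contMDiff_inv := hS.contMDiff hS.contMDiff_thd (h.contMDiff_inv.comp hS.contMDiff_snd)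
    hS.contMDiff_fst
  contMDiffOn_mul := by
    intro p hp
    have e {y : 𝒢.prolongationSet π × 𝒢.prolongationSet π}
        (hy : y ∈ (𝒢.prolongation π).composable) :
        𝒢.tgt y.1.1.2.1 = 𝒢.src y.2.1.2.1 :=
      y.1.2.2.trans ((congrArg π hy).trans y.2.2.1)
    refine hS.contMDiffWithinAt ?_ ?_ ?_
    · refine ((hS.contMDiff_fst.comp contMDiff_fst) p).contMDiffWithinAt.congr_of_mem
        (fun y hy => ?_) hp
      rw [mulExt_eq_mul _ hy]
      rfl
    · refine (h.contMDiffWithinAt_mulExt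
        ((hS.contMDiff_snd.comp contMDiff_fst) p).contMDiffWithinAt
        ((hS.contMDiff_snd.comp contMDiff_snd) p).contMDiffWithinAt hp
        (fun y hy => e hy)).congr_of_mem (fun y hy => ?_) hp
      rw [mulExt_eq_mul _ hy]
      exact (𝒢.mulExt_eq_mul (e hy)).symm
    · refine ((hS.contMDiff_thd.comp contMDiff_snd) p).contMDiffWithinAt.congr_of_mem
        (fun y hy => ?_) hp
      rw [mulExt_eq_mul _ hy]
      rfl

theorem star (h : 𝒢.IsLieGroupoid EM EG) [ChartedSpace (TripleModel EM EG) 𝒢.starSet]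
    [IsManifold 𝓘(ℝ, TripleModel EM EG) ∞ 𝒢.starSet] (hS : IsEmbeddedTriple EM EG 𝒢.starSet) :
    𝒢.star.IsLieGroupoid EG (TripleModel EM EG) where
  isSubmersion_src := h.isFibredTriple_star.isSubmersion_fst hS
  isSubmersion_tgt := h.isFibredTriple_star.isSubmersion_thd hS
  contMDiff_one := hS.contMDiff contMDiff_id contMDiff_id contMDiff_id
  contMDiff_inv := by
    have e (y : 𝒢.starSet) : 𝒢.tgt (𝒢.inv y.1.2.1) = 𝒢.src y.1.2.2 := (𝒢.tgt_inv _).trans y.2.2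
    have e' (y : 𝒢.starSet) : 𝒢.tgt y.1.1 = 𝒢.src (𝒢.mulExt (𝒢.inv y.1.2.1) y.1.2.2) := by
      rw [𝒢.src_mulExt (e y), 𝒢.src_inv, y.2.1]
    refine hS.contMDiff hS.contMDiff_thd ((h.contMDiff_mulExt hS.contMDiff_fst
      (h.contMDiff_mulExt (h.contMDiff_inv.comp hS.contMDiff_snd) hS.contMDiff_thd e) e').congr
        fun y => ?_) hS.contMDiff_fst
    refine Eq.trans ?_ (𝒢.mulExt_eq_mul (e' y)).symm
    exact 𝒢.mul_congr rfl (𝒢.mulExt_eq_mul (e y)).symm _ _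
  contMDiffOn_mul := by
    intro p hp
    have e (y : 𝒢.starSet) : 𝒢.tgt (𝒢.inv y.1.2.2) = 𝒢.src y.1.2.1 :=
      (𝒢.tgt_inv _).trans y.2.2.symm
    have e' {y : 𝒢.starSet × 𝒢.starSet} (hy : y ∈ 𝒢.star.composable) :
        𝒢.tgt y.2.1.2.1 = 𝒢.src (𝒢.mulExt (𝒢.inv y.1.1.2.2) y.1.1.2.1) := by
      rw [𝒢.src_mulExt (e y.1), 𝒢.src_inv, ← y.2.2.1]
      exact (congrArg 𝒢.tgt hy).symm
    refine hS.contMDiffWithinAt ?_ ?_ ?_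
    · refine ((hS.contMDiff_fst.comp contMDiff_fst) p).contMDiffWithinAt.congr_of_mem
        (fun y hy => ?_) hp
      rw [mulExt_eq_mul _ hy]
      rfl
    · refine (h.contMDiffWithinAt_mulExt
        ((hS.contMDiff_snd.comp contMDiff_snd) p).contMDiffWithinAt
        ((h.contMDiff_mulExt (h.contMDiff_inv.comp hS.contMDiff_thd) hS.contMDiff_snd e).comp
          contMDiff_fst p).contMDiffWithinAt hp
        (fun y hy => e' hy)).congr_of_mem (fun y hy => ?_) hp
      rw [mulExt_eq_mul _ hy]
      refine Eq.trans ?_ (𝒢.mulExt_eq_mul (e' hy)).symm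
      exact 𝒢.mul_congr rfl (𝒢.mulExt_eq_mul (e y.1)).symm _ _
    · refine ((hS.contMDiff_thd.comp contMDiff_snd) p).contMDiffWithinAt.congr_of_mem
        (fun y hy => ?_) hp
      rw [mulExt_eq_mul _ hy]
      rfl

end IsLieGroupoid

end lieGroupoid

end SetGroupoid

end

noncomputable section

namespace SetGroupoid

/-! ### The isomorphisms `Φ^β` and `Φ^α` -/

section algebra

variable {M G : Type*} (𝒢 : SetGroupoid M G)

/-- The inverse of `Φ^β`. -/
def invPhiβ (q : 𝒢.prolongationSet 𝒢.tgt) : 𝒢.starSet :=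
  ⟨(q.1.1, 𝒢.mulExt q.1.2.2 (𝒢.inv q.1.2.1), q.1.2.2), by
    have c : 𝒢.tgt q.1.2.2 = 𝒢.src (𝒢.inv q.1.2.1) := q.2.2.symm.trans (𝒢.src_inv _).symm
    refine ⟨?_, 𝒢.src_mulExt c⟩
    dsimp only
    rw [𝒢.tgt_mulExt c, 𝒢.tgt_inv]
    exact q.2.1⟩

/-- The inverse of `Φ^α`. -/
def invPhiα (q : 𝒢.prolongationSet 𝒢.src) : 𝒢.starSet :=
  ⟨(q.1.1, 𝒢.mulExt (𝒢.inv q.1.2.1) q.1.1, q.1.2.2), by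
    have c : 𝒢.tgt (𝒢.inv q.1.2.1) = 𝒢.src q.1.1 := (𝒢.tgt_inv _).trans q.2.1.symm
    refine ⟨(𝒢.tgt_mulExt c).symm, ?_⟩
    dsimp only
    rw [𝒢.src_mulExt c, 𝒢.src_inv]
    exact q.2.2⟩

theorem Phiβ_snd (p : 𝒢.starSet) : (𝒢.Phiβ p).1.2.1 = 𝒢.mulExt (𝒢.inv p.1.2.1) p.1.2.2 :=
  (𝒢.mulExt_eq_mul ((𝒢.tgt_inv _).trans p.2.2)).symm

theorem Phiα_snd (p : 𝒢.starSet) : (𝒢.Phiα p).1.2.1 = 𝒢.mulExt p.1.1 (𝒢.inv p.1.2.1) :=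
  (𝒢.mulExt_eq_mul (p.2.1.trans (𝒢.src_inv _).symm)).symm

theorem star_mul_snd {p q : 𝒢.starSet} (c : 𝒢.star.tgt p = 𝒢.star.src q) :
    (𝒢.star.mul p q c).1.2.1 =
      𝒢.mulExt q.1.2.1 (𝒢.mulExt (𝒢.inv p.1.2.2) p.1.2.1) := by
  have e : 𝒢.tgt (𝒢.inv p.1.2.2) = 𝒢.src p.1.2.1 := (𝒢.tgt_inv _).trans p.2.2.symm
  have e' : 𝒢.tgt q.1.2.1 = 𝒢.src (𝒢.mulExt (𝒢.inv p.1.2.2) p.1.2.1) := by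
    rw [𝒢.src_mulExt e, 𝒢.src_inv, ← q.2.1]
    exact (congrArg 𝒢.tgt c).symm
  refine Eq.trans ?_ (𝒢.mulExt_eq_mul e').symm
  exact 𝒢.mul_congr rfl (𝒢.mulExt_eq_mul e).symm _ _

theorem invPhiβ_Phiβ (p : 𝒢.starSet) : 𝒢.invPhiβ (𝒢.Phiβ p) = p := by
  refine Subtype.ext (Prod.ext rfl (Prod.ext ?_ rfl))
  change 𝒢.mulExt p.1.2.2 (𝒢.inv (𝒢.Phiβ p).1.2.1) = p.1.2.1
  rw [Phiβ_snd]
  have c : 𝒢.tgt (𝒢.inv p.1.2.1) = 𝒢.src p.1.2.2 := (𝒢.tgt_inv _).trans p.2.2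
  exact 𝒢.mulExt_inv_eq (by rw [𝒢.src_mulExt c, 𝒢.src_inv])
    (𝒢.mulExt_inv_cancel_left p.2.2)

theorem Phiβ_invPhiβ (q : 𝒢.prolongationSet 𝒢.tgt) : 𝒢.Phiβ (𝒢.invPhiβ q) = q := by
  refine Subtype.ext (Prod.ext rfl (Prod.ext ?_ rfl))
  rw [Phiβ_snd]
  have c : 𝒢.tgt q.1.2.2 = 𝒢.src (𝒢.inv q.1.2.1) := q.2.2.symm.trans (𝒢.src_inv _).symm
  exact 𝒢.inv_mulExt_eq ((𝒢.tgt_mulExt c).trans (𝒢.tgt_inv _))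
    (𝒢.inv_mulExt_cancel_right q.2.2.symm)

theorem invPhiα_Phiα (p : 𝒢.starSet) : 𝒢.invPhiα (𝒢.Phiα p) = p := by
  refine Subtype.ext (Prod.ext rfl (Prod.ext ?_ rfl))
  change 𝒢.mulExt (𝒢.inv (𝒢.Phiα p).1.2.1) p.1.1 = p.1.2.1
  rw [Phiα_snd]
  have c : 𝒢.tgt p.1.1 = 𝒢.src (𝒢.inv p.1.2.1) := p.2.1.trans (𝒢.src_inv _).symm
  exact 𝒢.inv_mulExt_eq ((𝒢.tgt_mulExt c).trans (𝒢.tgt_inv _))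
    (𝒢.inv_mulExt_cancel_right p.2.1)

theorem Phiα_invPhiα (q : 𝒢.prolongationSet 𝒢.src) : 𝒢.Phiα (𝒢.invPhiα q) = q := by
  refine Subtype.ext (Prod.ext rfl (Prod.ext ?_ rfl))
  rw [Phiα_snd]
  have c : 𝒢.tgt (𝒢.inv q.1.2.1) = 𝒢.src q.1.1 := (𝒢.tgt_inv _).trans q.2.1.symm
  exact 𝒢.mulExt_inv_eq ((𝒢.src_mulExt c).trans (𝒢.src_inv _)).symm
    (𝒢.mulExt_inv_cancel_left q.2.1.symm)

/-- With p = (g, h, s) and q = (s, h', s'), the claim is (h's⁻¹h)⁻¹s' = (h⁻¹s)(h'⁻¹s'). It is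
verified by multiplying the right side by h's⁻¹h on the left, where everything cancels to s'. -/
theorem Phiβ_mul {p q : 𝒢.starSet} (c : 𝒢.star.tgt p = 𝒢.star.src q) :
    𝒢.Phiβ (𝒢.star.mul p q c) = (𝒢.prolongation 𝒢.tgt).mul (𝒢.Phiβ p) (𝒢.Phiβ q) c := by
  refine Subtype.ext (Prod.ext rfl (Prod.ext ?_ rfl))
  have c' : 𝒢.tgt p.1.2.2 = 𝒢.tgt q.1.1 := congrArg 𝒢.tgt c
  have e1 : 𝒢.tgt (𝒢.inv p.1.2.1) = 𝒢.src p.1.2.2 := (𝒢.tgt_inv _).trans p.2.2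
  have e2 : 𝒢.tgt (𝒢.inv q.1.2.1) = 𝒢.src q.1.2.2 := (𝒢.tgt_inv _).trans q.2.2
  have e3 : 𝒢.tgt (𝒢.inv p.1.2.2) = 𝒢.src p.1.2.1 := (𝒢.tgt_inv _).trans p.2.2.symm
  have e4 : 𝒢.tgt (𝒢.Phiβ p).1.2.1 = 𝒢.src (𝒢.Phiβ q).1.2.1 := by
    rw [(𝒢.Phiβ q).2.1.symm, (𝒢.Phiβ p).2.2]; exact c'
  have e5 : 𝒢.tgt q.1.2.1 = 𝒢.src (𝒢.mulExt (𝒢.inv p.1.2.2) p.1.2.1) := by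
    rw [𝒢.src_mulExt e3, 𝒢.src_inv, ← q.2.1, c']
  have e6 : 𝒢.tgt (𝒢.mulExt (𝒢.inv p.1.2.2) p.1.2.1) = 𝒢.src (𝒢.Phiβ p).1.2.1 := by
    rw [𝒢.tgt_mulExt e3, (𝒢.Phiβ p).2.1.symm]; exact p.2.1.symm
  refine Eq.trans ?_ (𝒢.mulExt_eq_mul e4)
  rw [Phiβ_snd, star_mul_snd]
  refine 𝒢.inv_mulExt_eq (by rw [𝒢.tgt_mulExt e5, 𝒢.src_mulExt e4, e6]) ?_
  change _ = q.1.2.2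
  rw [𝒢.mulExt_assoc e5 (by rw [e6, 𝒢.src_mulExt e4]), ← 𝒢.mulExt_assoc e6 e4, Phiβ_snd,
    Phiβ_snd, 𝒢.mulExt_assoc e3 (by rw [𝒢.src_mulExt e1, 𝒢.src_inv]),
    𝒢.mulExt_inv_cancel_left p.2.2, inv_mulExt,
    𝒢.one_mulExt (by rw [𝒢.src_mulExt e2, 𝒢.src_inv, ← q.2.1, c']),
    𝒢.mulExt_inv_cancel_left q.2.2]

/-- In the same notation the claim is g(h's⁻¹h)⁻¹ = (gh⁻¹)(sh'⁻¹); multiplying the right side by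
h's⁻¹h on the right gives g. -/
theorem Phiα_mul {p q : 𝒢.starSet} (c : 𝒢.star.tgt p = 𝒢.star.src q) :
    𝒢.Phiα (𝒢.star.mul p q c) = (𝒢.prolongation 𝒢.src).mul (𝒢.Phiα p) (𝒢.Phiα q) c := by
  refine Subtype.ext (Prod.ext rfl (Prod.ext ?_ rfl))
  have c' : p.1.2.2 = q.1.1 := c
  have e1 : 𝒢.tgt p.1.1 = 𝒢.src (𝒢.inv p.1.2.1) := p.2.1.trans (𝒢.src_inv _).symm
  have e2 : 𝒢.tgt q.1.1 = 𝒢.src (𝒢.inv q.1.2.1) := q.2.1.trans (𝒢.src_inv _).symm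
  have e3 : 𝒢.tgt (𝒢.inv p.1.2.2) = 𝒢.src p.1.2.1 := (𝒢.tgt_inv _).trans p.2.2.symm
  have e4 : 𝒢.tgt (𝒢.Phiα p).1.2.1 = 𝒢.src (𝒢.Phiα q).1.2.1 := by
    rw [(𝒢.Phiα q).2.1.symm, (𝒢.Phiα p).2.2]; exact congrArg 𝒢.src c'
  have e5 : 𝒢.tgt q.1.2.1 = 𝒢.src (𝒢.mulExt (𝒢.inv p.1.2.2) p.1.2.1) := by
    rw [𝒢.src_mulExt e3, 𝒢.src_inv, ← q.2.1, c']
  have e6 : 𝒢.tgt (𝒢.Phiα q).1.2.1 = 𝒢.src q.1.2.1 := (𝒢.Phiα q).2.2.trans q.2.2.symm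
  refine Eq.trans ?_ (𝒢.mulExt_eq_mul e4)
  rw [Phiα_snd, star_mul_snd]
  refine 𝒢.mulExt_inv_eq (by rw [𝒢.tgt_mulExt e4, 𝒢.src_mulExt e5, e6]) ?_
  change _ = p.1.1
  rw [𝒢.mulExt_assoc e4 (by rw [𝒢.src_mulExt e5, e6]), ← 𝒢.mulExt_assoc e6 e5, Phiα_snd,
    Phiα_snd, 𝒢.inv_mulExt_cancel_right q.2.1, c',
    𝒢.mulExt_inv_cancel_left (by rw [p.2.2, c']), 𝒢.inv_mulExt_cancel_right p.2.1]

end algebra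

/-! ### Φ^β and Φ^α as isomorphisms of Lie groupoids. -/

section iso

variable {EM EG EH M G H : Type*} [NormedAddCommGroup EM] [NormedSpace ℝ EM]
  [NormedAddCommGroup EG] [NormedSpace ℝ EG] [NormedAddCommGroup EH] [NormedSpace ℝ EH]
  [TopologicalSpace M] [ChartedSpace EM M] [TopologicalSpace G] [ChartedSpace EG G]
  [TopologicalSpace H] [ChartedSpace EH H] {𝒢 : SetGroupoid M G}

/-- A diffeomorphism that is compatible with sources, targets, identities and products is an
isomorphism of Lie groupoids. -/
theorem IsLieGroupoid.isLieGroupoidIso {ℋ : SetGroupoid M H} (h𝒢 : 𝒢.IsLieGroupoid EM EG)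
    (hℋ : ℋ.IsLieGroupoid EM EH) {Φ : G → H} {Ψ : H → G} (hΦ : ContMDiff 𝓘(ℝ, EG) 𝓘(ℝ, EH) ∞ Φ)
    (hΨ : ContMDiff 𝓘(ℝ, EH) 𝓘(ℝ, EG) ∞ Ψ) (hΨΦ : ∀ g, Ψ (Φ g) = g) (hΦΨ : ∀ k, Φ (Ψ k) = k)
    (src_map : ∀ g, ℋ.src (Φ g) = 𝒢.src g) (tgt_map : ∀ g, ℋ.tgt (Φ g) = 𝒢.tgt g)
    (one_map : ∀ x, Φ (𝒢.one x) = ℋ.one x) (mul_map : ∀ g h (c : 𝒢.tgt g = 𝒢.src h),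
      ∃ c' : ℋ.tgt (Φ g) = ℋ.src (Φ h), Φ (𝒢.mul g h c) = ℋ.mul (Φ g) (Φ h) c') :
    𝒢.IsLieGroupoidIso EM EG EH ℋ Φ where
  source := h𝒢
  target := hℋ
  diffeo := ⟨⟨⟨Φ, Ψ, hΨΦ, hΦΨ⟩, hΦ, hΨ⟩, rfl⟩
  src_map := src_map
  tgt_map := tgt_map
  one_map := one_map
  -- Inverses are unique, so preservation of products and units already determines the image of an
  -- inverse.
  inv_map g := by
    obtain ⟨c, e⟩ := mul_map (𝒢.inv g) g (𝒢.tgt_inv g)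
    refine ℋ.eq_inv_of_mulExt_eq_one c ?_
    rw [mulExt_eq_mul _ c, ← e, 𝒢.inv_mul, one_map, tgt_map]
  mul_map := mul_map

variable [IsManifold 𝓘(ℝ, EM) ∞ M] [IsManifold 𝓘(ℝ, EG) ∞ G]
  [FiniteDimensional ℝ EM] [FiniteDimensional ℝ EG]
  [ChartedSpace (TripleModel EM EG) 𝒢.starSet]
  [IsManifold 𝓘(ℝ, TripleModel EM EG) ∞ 𝒢.starSet]

theorem IsLieGroupoid.isLieGroupoidIso_Phiβ (h : 𝒢.IsLieGroupoid EM EG)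
    [ChartedSpace (TripleModel EM EG) (𝒢.prolongationSet 𝒢.tgt)]
    [IsManifold 𝓘(ℝ, TripleModel EM EG) ∞ (𝒢.prolongationSet 𝒢.tgt)]
    (hS : IsEmbeddedTriple EM EG 𝒢.starSet)
    (hP : IsEmbeddedTriple EM EG (𝒢.prolongationSet 𝒢.tgt)) :
    𝒢.star.IsLieGroupoidIso EG (TripleModel EM EG) (TripleModel EM EG)
      (𝒢.prolongation 𝒢.tgt) 𝒢.Phiβ := by
  refine (h.star hS).isLieGroupoidIso (h.prolongation h.isSubmersion_tgt hP) (Ψ := 𝒢.invPhiβ)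
    (hP.contMDiff hS.contMDiff_fst ?_ hS.contMDiff_thd)
    (hS.contMDiff hP.contMDiff_fst ?_ hP.contMDiff_thd)
    𝒢.invPhiβ_Phiβ 𝒢.Phiβ_invPhiβ (fun _ => rfl) (fun _ => rfl) (fun g => ?_)
    fun p q c => ⟨c, 𝒢.Phiβ_mul c⟩
  · exact (h.contMDiff_mulExt (h.contMDiff_inv.comp hS.contMDiff_snd) hS.contMDiff_thd
      fun p => (𝒢.tgt_inv _).trans p.2.2).congr 𝒢.Phiβ_snd
  · exact h.contMDiff_mulExt hP.contMDiff_thd (h.contMDiff_inv.comp hP.contMDiff_snd)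
      fun q => q.2.2.symm.trans (𝒢.src_inv _).symm
  · exact Subtype.ext (Prod.ext rfl (Prod.ext (𝒢.inv_mul g) rfl))

theorem IsLieGroupoid.isLieGroupoidIso_Phiα (h : 𝒢.IsLieGroupoid EM EG)
    [ChartedSpace (TripleModel EM EG) (𝒢.prolongationSet 𝒢.src)]
    [IsManifold 𝓘(ℝ, TripleModel EM EG) ∞ (𝒢.prolongationSet 𝒢.src)]
    (hS : IsEmbeddedTriple EM EG 𝒢.starSet)
    (hP : IsEmbeddedTriple EM EG (𝒢.prolongationSet 𝒢.src)) :
    𝒢.star.IsLieGroupoidIso EG (TripleModel EM EG) (TripleModel EM EG)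
      (𝒢.prolongation 𝒢.src) 𝒢.Phiα := by
  refine (h.star hS).isLieGroupoidIso (h.prolongation h.isSubmersion_src hP) (Ψ := 𝒢.invPhiα)
    (hP.contMDiff hS.contMDiff_fst ?_ hS.contMDiff_thd)
    (hS.contMDiff hP.contMDiff_fst ?_ hP.contMDiff_thd)
    𝒢.invPhiα_Phiα 𝒢.Phiα_invPhiα (fun _ => rfl) (fun _ => rfl) (fun g => ?_)
    fun p q c => ⟨c, 𝒢.Phiα_mul c⟩
  · exact (h.contMDiff_mulExt hS.contMDiff_fst (h.contMDiff_inv.comp hS.contMDiff_snd)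
      fun p => p.2.1.trans (𝒢.src_inv _).symm).congr 𝒢.Phiα_snd
  · exact h.contMDiff_mulExt (h.contMDiff_inv.comp hP.contMDiff_snd) hP.contMDiff_fst
      fun q => (𝒢.tgt_inv _).trans q.2.1.symm
  · exact Subtype.ext (Prod.ext rfl (Prod.ext (𝒢.mul_inv g) rfl))

end iso

end SetGroupoid

end

noncomputable section

namespace SetGroupoid

/-! ### The Lie algebroid of the prolongation -/

variable {EM EG M G : Type*} [NormedAddCommGroup EM] [NormedSpace ℝ EM]
  [NormedAddCommGroup EG] [NormedSpace ℝ EG] [TopologicalSpace M] [ChartedSpace EM M]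
  [TopologicalSpace G] [ChartedSpace EG G] {𝒢 : SetGroupoid M G} {π : G → M}

/-- The middle entries multiply as arrows of G, and their ends are the π-images of the outer
entries. This morphism carries the bracket computation for the prolongation. -/
theorem IsLieGroupoid.isMorphism_snd [ChartedSpace (TripleModel EM EG) (𝒢.prolongationSet π)]
    (hπ : Manifold.IsSubmersion 𝓘(ℝ, EG) 𝓘(ℝ, EM) ∞ π)
    (hP : IsEmbeddedTriple EM EG (𝒢.prolongationSet π)) :
    IsMorphism EG EM (TripleModel EM EG) EG (𝒢.prolongation π) 𝒢
      (fun q : 𝒢.prolongationSet π => q.1.2.1) π where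
  smooth := hP.contMDiff_snd
  smooth_base := hπ.contMDiff
  src_map q := q.2.1.symm
  tgt_map q := q.2.2
  one_map _ := rfl
  mul_map q r c := by
    have c' : 𝒢.tgt q.1.2.1 = 𝒢.src r.1.2.1 := by
      rw [q.2.2, ← r.2.1]; exact congrArg π c
    rw [mulExt_eq_mul _ c, mulExt_eq_mul _ c']
    rfl

variable [IsManifold 𝓘(ℝ, EG) ∞ G]

theorem smoothAlongAt_of_isPullbackDecomposition (h : 𝒢.IsLieGroupoid EM EG)
    (hπ : ContMDiff 𝓘(ℝ, EG) 𝓘(ℝ, EM) ∞ π) {V : Set G} {O : Set M}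
    {k : ℕ} {a : Fin k → G → ℝ} {X : Fin k → M → EG} {σ : G → EG}
    (hd : (𝒢.lieAlgebroid EM EG).IsPullbackDecomposition π EG V O a X σ) {q : G} (hq : q ∈ V) :
    SmoothAlongAt 𝓘(ℝ, EG) 𝓘(ℝ, EG) (fun q => 𝒢.one (π q)) σ q := by
  obtain ⟨hV, hO, hVO, ha, hX, hσ⟩ := hd
  have h1 : SmoothAlongAt 𝓘(ℝ, EG) 𝓘(ℝ, EG) (fun q => 𝒢.one (π q))
      (fun q => ∑ i, a i q • X i (π q)) q := by
    refine SmoothAlongAt.sum ((h.contMDiff_one.comp hπ).contMDiffAt) fun i => ?_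
    have hXi := ((isSection_iff hO).1 (hX i) _ (hVO q hq)).1
    exact (hXi.comp hπ.contMDiffAt).smul ((ha i).contMDiffAt (hV.mem_nhds hq))
  refine h1.congr (.of_forall fun _ => rfl) ?_
  filter_upwards [hV.mem_nhds hq] with y hy using hσ y hy

/-- A section of the pull-back of the Lie algebroid is smooth if and only if it can locally be
decomposed, and the decompositions of different sections use the same frame. -/
theorem IsLieGroupoid.exists_isPullbackDecomposition [IsManifold 𝓘(ℝ, EM) ∞ M]
    [FiniteDimensional ℝ EG] (h : 𝒢.IsLieGroupoid EM EG) (hπ : Continuous π) {U : Set G}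
    (hU : IsOpen U) {p : G} (hp : p ∈ U) :
    ∃ (V : Set G) (O : Set M) (k : ℕ) (e : Fin k → M → EG), p ∈ V ∧
      ∀ σ : G → EG, (∀ q ∈ U, SmoothAlongAt 𝓘(ℝ, EG) 𝓘(ℝ, EG) (fun q => 𝒢.one (π q)) σ q) →
        (∀ q ∈ U, modelDeriv 𝓘(ℝ, EG) 𝓘(ℝ, EM) 𝒢.src (𝒢.one (π q)) (σ q) = 0) →
        ∃ a : Fin k → G → ℝ,
          (𝒢.lieAlgebroid EM EG).IsPullbackDecomposition π EG V O a e σ := by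
  obtain ⟨O, k, e, c, hO, hpO, he, -, hsum, hc⟩ := h.exists_frame (EP := EG) π (π p)
  refine ⟨U ∩ π ⁻¹' O, O, k, e, ⟨hp, hpO⟩, fun σ hσ hker => ⟨fun i q => c i (π q) (σ q),
    hU.inter (hO.preimage hπ), hO, fun q hq => hq.2, fun i q hq => ?_,
    fun i => (isSection_iff hO).2 (he i), fun q hq => ?_⟩⟩
  · exact (hc σ q hq.2 (hσ q hq.1) i).contMDiffWithinAt
  · exact (hsum _ hq.2 _ (hker q hq.1)).symm

variable [IsManifold 𝓘(ℝ, EM) ∞ M] [FiniteDimensional ℝ EM] [FiniteDimensional ℝ EG]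
  [ChartedSpace (TripleModel EM EG) (𝒢.prolongationSet π)]
  [IsManifold 𝓘(ℝ, TripleModel EM EG) ∞ (𝒢.prolongationSet π)]
  {U : Set G} {X Y : G → TripleModel EM EG}

/-- The middle projection maps the left-invariant field of a section to the combination of
left-invariant fields of G given by its decomposition, with coefficients composed with the target
map. The general bracket formula applies, and at a unit the target derivative of X is its third
entry, which yields the terms that differentiate coefficients. -/
theorem IsLieGroupoid.modelDeriv_snd_sectionBracket (h : 𝒢.IsLieGroupoid EM EG)
    (hπ : Manifold.IsSubmersion 𝓘(ℝ, EG) 𝓘(ℝ, EM) ∞ π)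
    (hP : IsEmbeddedTriple EM EG (𝒢.prolongationSet π)) (hU : IsOpen U)
    (hX : (𝒢.prolongation π).SectionOn EG (TripleModel EM EG) U X)
    (hY : (𝒢.prolongation π).SectionOn EG (TripleModel EM EG) U Y)
    {O : Set M} (hO : IsOpen O) (hUO : ∀ q ∈ U, π q ∈ O) {k l : ℕ} {a : Fin k → G → ℝ}
    {A : Fin k → M → EG} {c : Fin l → G → ℝ} {B : Fin l → M → EG} {p : G} (hp : p ∈ U)
    (ha : ∀ i, ContMDiffAt 𝓘(ℝ, EG) 𝓘(ℝ, ℝ) ∞ (a i) p) (hA : ∀ i, 𝒢.SectionOn EM EG O (A i))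
    (hc : ∀ i, ContMDiffAt 𝓘(ℝ, EG) 𝓘(ℝ, ℝ) ∞ (c i) p) (hB : ∀ i, 𝒢.SectionOn EM EG O (B i))
    (haA : ∀ q ∈ U, modelDeriv 𝓘(ℝ, TripleModel EM EG) 𝓘(ℝ, EG)
      (fun t : 𝒢.prolongationSet π => t.1.2.1) ((𝒢.prolongation π).one q) (X q) =
        ∑ i, a i q • A i (π q))
    (hcB : ∀ q ∈ U, modelDeriv 𝓘(ℝ, TripleModel EM EG) 𝓘(ℝ, EG)
      (fun t : 𝒢.prolongationSet π => t.1.2.1) ((𝒢.prolongation π).one q) (Y q) =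
        ∑ i, c i q • B i (π q)) :
    modelDeriv 𝓘(ℝ, TripleModel EM EG) 𝓘(ℝ, EG) (fun t : 𝒢.prolongationSet π => t.1.2.1)
      ((𝒢.prolongation π).one p)
        ((𝒢.prolongation π).sectionBracket (TripleModel EM EG) X Y p) =
      ∑ i, ∑ j, (a i p * c j p) • 𝒢.sectionBracket EG (A i) (B j) (π p)
        + ∑ j, modelDeriv 𝓘(ℝ, EG) 𝓘(ℝ, ℝ) (c j) p
          (modelDeriv 𝓘(ℝ, TripleModel EM EG) 𝓘(ℝ, EG) (fun t : 𝒢.prolongationSet π => t.1.2.2)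
            ((𝒢.prolongation π).one p) (X p)) • B j (π p)
        - ∑ i, modelDeriv 𝓘(ℝ, EG) 𝓘(ℝ, ℝ) (a i) p
          (modelDeriv 𝓘(ℝ, TripleModel EM EG) 𝓘(ℝ, EG) (fun t : 𝒢.prolongationSet π => t.1.2.2)
            ((𝒢.prolongation π).one p) (Y p)) • A i (π p) := by
  have : CompleteSpace EM := FiniteDimensional.complete ℝ EM
  have : CompleteSpace EG := FiniteDimensional.complete ℝ EG
  have h𝒫 := h.prolongation hπ hP
  have hm := IsLieGroupoid.isMorphism_snd hπ hP
  have hp' : (𝒢.prolongation π).tgt ((𝒢.prolongation π).one p) ∈ U := hp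
  have key (Z : G → TripleModel EM EG)
      (hZ : (𝒢.prolongation π).SectionOn EG (TripleModel EM EG) U Z) {n : ℕ}
      {b : Fin n → G → ℝ} {C : Fin n → M → EG}
      (hbC : ∀ q ∈ U, modelDeriv 𝓘(ℝ, TripleModel EM EG) 𝓘(ℝ, EG)
        (fun t : 𝒢.prolongationSet π => t.1.2.1) ((𝒢.prolongation π).one q) (Z q) =
          ∑ i, b i q • C i (π q)) :
      ∀ᶠ q in 𝓝 ((𝒢.prolongation π).one p),
        modelDeriv 𝓘(ℝ, TripleModel EM EG) 𝓘(ℝ, EG)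
          (fun t : 𝒢.prolongationSet π => t.1.2.1) q
            ((𝒢.prolongation π).leftVF (TripleModel EM EG) Z q) =
          ∑ i, b i ((𝒢.prolongation π).tgt q) • 𝒢.leftVF EG (C i) q.1.2.1 := by
    filter_upwards [h𝒫.eventually_tgt_mem hU hp'] with q hq
    rw [hm.modelDeriv_leftVF h𝒫 h (hZ _ hq).2, hbC _ hq, map_sum]
    refine Finset.sum_congr rfl fun i _ => ?_
    rw [map_smul]
    refine congrArg (fun v : EG => b i ((𝒢.prolongation π).tgt q) • v) ?_
    change _ = 𝒢.leftD EG q.1.2.1 (𝒢.one (𝒢.tgt q.1.2.1)) (C i (𝒢.tgt q.1.2.1))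
    rw [q.2.2]
    rfl
  have hA' (i : Fin k) : SmoothAlongAt 𝓘(ℝ, EG) 𝓘(ℝ, EG) (fun y => y) (𝒢.leftVF EG (A i))
      (𝒢.one (π p)) :=
    h.smoothAlongAt_leftVF hO (hA i) (by rw [𝒢.tgt_one]; exact hUO p hp)
  have hB' (i : Fin l) : SmoothAlongAt 𝓘(ℝ, EG) 𝓘(ℝ, EG) (fun y => y) (𝒢.leftVF EG (B i))
      (𝒢.one (π p)) :=
    h.smoothAlongAt_leftVF hO (hB i) (by rw [𝒢.tgt_one]; exact hUO p hp)
  have htgt := h𝒫.isSubmersion_tgt.contMDiff.contMDiffAt (x := (𝒢.prolongation π).one p)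
  have main := modelDeriv_fieldBracket_of_related (f := fun t : 𝒢.prolongationSet π => t.1.2.1)
    (x := (𝒢.prolongation π).one p) hm.smooth.contMDiffAt
    (h𝒫.smoothAlongAt_leftVF hU hX hp') (h𝒫.smoothAlongAt_leftVF hU hY hp') (r := fun y => y)
    mdifferentiableAt_id rfl (by rw [modelDeriv_id]; rfl) (by rw [modelDeriv_id]; rfl)
    (a := fun i q => a i ((𝒢.prolongation π).tgt q))
    (c := fun i q => c i ((𝒢.prolongation π).tgt q))
    (fun i => ((ha i).comp _ htgt).mdiff) hA' (fun i => ((hc i).comp _ htgt).mdiff) hB'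
    (key X hX haA) (key Y hY hcB)
  have hv (x : M) (hx : x ∈ O) (C : M → EG) (hC : 𝒢.SectionOn EM EG O C) :
      𝒢.leftVF EG C (𝒢.one x) = C x := h.leftVF_one (hC x hx).2
  have hl (Z : G → TripleModel EM EG)
      (hZ : (𝒢.prolongation π).SectionOn EG (TripleModel EM EG) U Z) {b : G → ℝ}
      (hb : ContMDiffAt 𝓘(ℝ, EG) 𝓘(ℝ, ℝ) ∞ b p) :
      modelDeriv 𝓘(ℝ, TripleModel EM EG) 𝓘(ℝ, ℝ) (fun q => b ((𝒢.prolongation π).tgt q))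
        ((𝒢.prolongation π).one p)
          ((𝒢.prolongation π).leftVF (TripleModel EM EG) Z ((𝒢.prolongation π).one p)) =
      modelDeriv 𝓘(ℝ, EG) 𝓘(ℝ, ℝ) b p
        (modelDeriv 𝓘(ℝ, TripleModel EM EG) 𝓘(ℝ, EG) (fun t : 𝒢.prolongationSet π => t.1.2.2)
          ((𝒢.prolongation π).one p) (Z p)) := by
    rw [h𝒫.leftVF_one (hZ p hp).2]
    exact modelDeriv_comp_apply (g := b) (f := (𝒢.prolongation π).tgt)
      (x := (𝒢.prolongation π).one p) hb.mdiff htgt.mdiff (Z p)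
  simp only [hl X hX (hc _), hl Y hY (ha _)] at main
  refine main.trans ?_
  refine congrArg₂ (fun u v : EG => u - v) (congrArg₂ (fun u v : EG => u + v) rfl ?_) ?_
  · exact Finset.sum_congr rfl fun j _ =>
      congrArg (fun v : EG => _ • v) (hv _ (hUO p hp) _ (hB j))
  · exact Finset.sum_congr rfl fun i _ =>
      congrArg (fun v : EG => _ • v) (hv _ (hUO p hp) _ (hA i))

/-- The anchor preserves brackets: a left-invariant field is related by the target map to the anchor
of its section, because left translation does not change the target. -/
theorem IsLieGroupoid.modelDeriv_tgt_sectionBracket {EN N H : Type*} [NormedAddCommGroup EN]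
    [NormedSpace ℝ EN] [TopologicalSpace N] [ChartedSpace EN N] [IsManifold 𝓘(ℝ, EN) ∞ N]
    {EH : Type*} [NormedAddCommGroup EH] [NormedSpace ℝ EH] [TopologicalSpace H]
    [ChartedSpace EH H] [IsManifold 𝓘(ℝ, EH) ∞ H] [CompleteSpace EN] [CompleteSpace EH]
    {ℋ : SetGroupoid N H} (h : ℋ.IsLieGroupoid EN EH)
    {U : Set N} {X Y : N → EH} (hU : IsOpen U) (hX : ℋ.SectionOn EN EH U X)
    (hY : ℋ.SectionOn EN EH U Y) {x : N} (hx : x ∈ U) :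
    modelDeriv 𝓘(ℝ, EH) 𝓘(ℝ, EN) ℋ.tgt (ℋ.one x) (ℋ.sectionBracket EH X Y x) =
      fieldBracket EN (fun y => modelDeriv 𝓘(ℝ, EH) 𝓘(ℝ, EN) ℋ.tgt (ℋ.one y) (X y))
        (fun y => modelDeriv 𝓘(ℝ, EH) 𝓘(ℝ, EN) ℋ.tgt (ℋ.one y) (Y y)) x := by
  have hx' : ℋ.tgt (ℋ.one x) ∈ U := by rwa [ℋ.tgt_one]
  have htgt := h.isSubmersion_tgt.contMDiff
  have smooth (Z : N → EH) (hZ : ℋ.SectionOn EN EH U Z) : SmoothAlongAt 𝓘(ℝ, EN) 𝓘(ℝ, EN)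
      (fun y => y) (fun y => modelDeriv 𝓘(ℝ, EH) 𝓘(ℝ, EN) ℋ.tgt (ℋ.one y) (Z y))
      (ℋ.tgt (ℋ.one x)) := by
    rw [ℋ.tgt_one]
    exact ((hZ x hx).1.map htgt.contMDiffAt).congr (.of_forall fun y => (ℋ.tgt_one y).symm)
      (.of_forall fun _ => rfl)
  have key (Z : N → EH) (hZ : ℋ.SectionOn EN EH U Z) : ∀ᶠ g in 𝓝 (ℋ.one x),
      modelDeriv 𝓘(ℝ, EH) 𝓘(ℝ, EN) ℋ.tgt g (ℋ.leftVF EH Z g) =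
        modelDeriv 𝓘(ℝ, EH) 𝓘(ℝ, EN) ℋ.tgt (ℋ.one (ℋ.tgt g)) (Z (ℋ.tgt g)) := by
    filter_upwards [h.eventually_tgt_mem hU hx'] with g hg
    exact h.modelDeriv_tgt_leftVF (hZ _ hg).2
  have main := modelDeriv_fieldBracket_of_related_along (htgt.contMDiffAt (x := ℋ.one x))
    (h.smoothAlongAt_leftVF hU hX hx') (h.smoothAlongAt_leftVF hU hY hx')
    (smooth X hX) (smooth Y hY) (r := fun y => y) mdifferentiableAt_id rfl
    (by rw [modelDeriv_id]; rfl) (by rw [modelDeriv_id]; rfl) (key X hX) (key Y hY)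
  rw [ℋ.tgt_one] at main
  exact main

end SetGroupoid

end

/-! ### The identification of A(P^π G) with P^π(AG). -/

noncomputable section

namespace SetGroupoid

variable {EM EG M G : Type*} [NormedAddCommGroup EM] [NormedSpace ℝ EM]
  [NormedAddCommGroup EG] [NormedSpace ℝ EG] [TopologicalSpace M] [ChartedSpace EM M]
  [TopologicalSpace G] [ChartedSpace EG G] {𝒢 : SetGroupoid M G}
  {π : G → M} [IsManifold 𝓘(ℝ, EM) ∞ M] [IsManifold 𝓘(ℝ, EG) ∞ G]
  [FiniteDimensional ℝ EM] [FiniteDimensional ℝ EG]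
  [ChartedSpace (TripleModel EM EG) (𝒢.prolongationSet π)]
  [IsManifold 𝓘(ℝ, TripleModel EM EG) ∞ (𝒢.prolongationSet π)]

/-- The Lie algebroid of a prolongation is the prolongation of the Lie algebroid. -/
theorem IsLieGroupoid.isLieAlgebroidIso_prolongationIdent (h : 𝒢.IsLieGroupoid EM EG)
    (hπ : Manifold.IsSubmersion 𝓘(ℝ, EG) 𝓘(ℝ, EM) ∞ π)
    (hP : IsEmbeddedTriple EM EG (𝒢.prolongationSet π)) :
    ((𝒢.prolongation π).lieAlgebroid EG (TripleModel EM EG)).IsLieAlgebroidIso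
      ((𝒢.lieAlgebroid EM EG).prolongation π)
      (𝒢.prolongationIdent EG EG (TripleModel EM EG) π) := by
  have : CompleteSpace EM := FiniteDimensional.complete ℝ EM
  have : CompleteSpace EG := FiniteDimensional.complete ℝ EG
  have h𝒫 := h.prolongation hπ hP
  have hm := IsLieGroupoid.isMorphism_snd hπ hP
  have hF := h.isFibredTriple_prolongation hπ
  have hthd := h𝒫.isSubmersion_tgt.contMDiff
  have hmid (U : Set G) (X : G → TripleModel EM EG)
      (hX : (𝒢.prolongation π).SectionOn EG (TripleModel EM EG) U X) (q : G) (hq : q ∈ U) :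
      SmoothAlongAt 𝓘(ℝ, EG) 𝓘(ℝ, EG) (fun q => 𝒢.one (π q))
        (fun q => modelDeriv 𝓘(ℝ, TripleModel EM EG) 𝓘(ℝ, EG)
          (fun t : 𝒢.prolongationSet π => t.1.2.1) ((𝒢.prolongation π).one q) (X q)) q ∧
      modelDeriv 𝓘(ℝ, EG) 𝓘(ℝ, EM) 𝒢.src (𝒢.one (π q))
        (modelDeriv 𝓘(ℝ, TripleModel EM EG) 𝓘(ℝ, EG)
          (fun t : 𝒢.prolongationSet π => t.1.2.1) ((𝒢.prolongation π).one q) (X q)) = 0 :=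
    ⟨(hX q hq).1.map hm.smooth.contMDiffAt, hm.modelDeriv_src h𝒫 h (hX q hq).2⟩
  refine h𝒫.isLieAlgebroid.isLieAlgebroidIso ?_ ?_ ?_ ?_ ?_ ?_ ?_
  · intro U X Y hU hX hY
    exact (isSection_iff hU).2 (((isSection_iff hU).1 hX).add ((isSection_iff hU).1 hY))
  · intro U f X hU hf hX
    exact (isSection_iff hU).2 (SectionOn.smul (fun x hx => hf.contMDiffAt (hU.mem_nhds hx))
      ((isSection_iff hU).1 hX))
  · intro p
    refine ⟨fun (v : TripleModel EM EG) hv => ⟨?_, ?_⟩, ?_, ?_⟩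
    · exact hm.modelDeriv_src h𝒫 h (g := (𝒢.prolongation π).one p) hv
    · exact hF.modelDeriv_snd_eq hP ((𝒢.prolongation π).one p) v
    · intro (v : TripleModel EM EG) hv (w : TripleModel EM EG) hw e
      refine hP.modelDeriv_ext (x := (𝒢.prolongation π).one p) ?_ (congrArg Prod.fst e)
        (congrArg Prod.snd e)
      exact Eq.trans (b := (0 : EG)) hv (Eq.symm hw)
    · intro z hz
      -- For the triple (0, z.1, z.2) the first linearized equation says that z.1 is α-vertical, and
      -- the second is the compatibility of anchor and Tπ in the fibre of P^π(AG).
      obtain ⟨v, h1, h2, h3⟩ := hF.exists_tangent hP ((𝒢.prolongation π).one p) (X := 0)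
        (Y := z.1) (Z := z.2) ((map_zero _).trans (Eq.symm hz.1)) hz.2
      exact ⟨v, h1, Prod.ext h2 h3⟩
  · intro U Z Z' hU hZ hs
    refine ⟨fun p hp => ?_, hs.2.congr fun q hq => by rw [hZ q hq]⟩
    obtain ⟨V, O, k, a, X, hpV, hV, hO, hVO, ha, hX, hd⟩ := hs.1 p hp
    exact ⟨V ∩ U, O, k, a, X, ⟨hpV, hp⟩, hV.inter hU, hO, fun q hq => hVO q hq.1,
      fun i => (ha i).mono inter_subset_left, hX, fun q hq =>
        (congrArg Prod.fst (hZ q hq.2)).symm.trans (hd q hq.1)⟩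
  · intro U X hU hX
    constructor
    · intro hs
      have hsec : (𝒢.prolongation π).SectionOn EG (TripleModel EM EG) U X :=
        (isSection_iff hU).1 ⟨hs, hX⟩
      refine ⟨fun p hp => ?_, fun p hp => ?_⟩
      · obtain ⟨V, O, k, e, hpV, hd⟩ := h.exists_isPullbackDecomposition hπ.contMDiff.continuous
          hU hp
        obtain ⟨a, ha⟩ := hd _ (fun q hq => (hmid U X hsec q hq).1)
          fun q hq => (hmid U X hsec q hq).2
        exact ⟨V, O, k, a, e, hpV, ha⟩
      · exact ((hsec p hp).1.map hthd.contMDiffAt).contMDiffWithinAt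
    · intro hs
      refine (smooth_iff hU).2 fun p hp => hP.smoothAlongAt ?_ ?_ ?_
      · refine (SmoothAlongAt.zero contMDiffAt_id).congr (.of_forall fun _ => rfl) ?_
        filter_upwards [hU.mem_nhds hp] with q hq using hX q hq
      · obtain ⟨V, O, k, a, A, hpV, hd⟩ := hs.1 p hp
        exact smoothAlongAt_of_isPullbackDecomposition h hπ.contMDiff hd hpV
      · exact hs.2.contMDiffAt (hU.mem_nhds hp)
  · exact fun _ _ _ => rfl
  · intro U X Y Z W hU hX hY hXZ hYW p hp
    replace hX := (isSection_iff hU).1 hX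
    replace hY := (isSection_iff hU).1 hY
    -- The bracket in P^π(AG) is defined by choice, so some decomposition must exist. Local frames
    -- of AG provide it.
    have hex : ∃ b, (𝒢.lieAlgebroid EM EG).IsProlongationBracketAt π Z W p b := by
      obtain ⟨V, O, k, e, hpV, hd⟩ := h.exists_isPullbackDecomposition hπ.contMDiff.continuous
        hU hp
      obtain ⟨a, ha⟩ := hd _ (fun q hq => (hmid U X hX q hq).1) fun q hq => (hmid U X hX q hq).2
      obtain ⟨c, hc⟩ := hd _ (fun q hq => (hmid U Y hY q hq).1) fun q hq => (hmid U Y hY q hq).2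
      refine ⟨_, V ∩ U, O, k, k, a, e, c, e, ⟨hpV, hp⟩, ?_, ?_, rfl⟩
      · exact ⟨ha.1.inter hU, ha.2.1, fun q hq => ha.2.2.1 q hq.1,
          fun i => (ha.2.2.2.1 i).mono inter_subset_left, ha.2.2.2.2.1,
          fun q hq => (congrArg Prod.fst (hXZ q hq.2)).symm.trans (ha.2.2.2.2.2 q hq.1)⟩
      · exact ⟨hc.1.inter hU, hc.2.1, fun q hq => hc.2.2.1 q hq.1,
          fun i => (hc.2.2.2.1 i).mono inter_subset_left, hc.2.2.2.2.1,
          fun q hq => (congrArg Prod.fst (hYW q hq.2)).symm.trans (hc.2.2.2.2.2 q hq.1)⟩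
    refine Prod.ext ?_ ?_
    · refine Eq.trans ?_ (dif_pos hex).symm
      -- Nothing is known about the chosen decomposition, and nothing is needed: the formula
      -- computes the same vector from every decomposition.
      obtain ⟨V, O, k, l, a, A, c, B, hpV, ⟨hV, hO, hVO, ha, hA, haA⟩,
        ⟨-, -, -, hc, hB, hcB⟩, hb⟩ := hex.choose_spec
      refine Eq.trans ?_ hb.symm
      have hsub : V ∩ U ⊆ U := inter_subset_right
      have main := h.modelDeriv_snd_sectionBracket hπ hP (hV.inter hU) (hX.mono hsub)
        (hY.mono hsub) hO (fun q hq => hVO q hq.1) ⟨hpV, hp⟩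
        (fun i => (ha i).contMDiffAt (hV.mem_nhds hpV)) (fun i => (isSection_iff hO).1 (hA i))
        (fun i => (hc i).contMDiffAt (hV.mem_nhds hpV)) (fun i => (isSection_iff hO).1 (hB i))
        (fun q hq => (congrArg Prod.fst (hXZ q hq.2)).trans (haA q hq.1))
        (fun q hq => (congrArg Prod.fst (hYW q hq.2)).trans (hcB q hq.1))
      refine Eq.trans main ?_
      rw [← hXZ p hp, ← hYW p hp]
      rfl
    · refine Eq.trans (h𝒫.modelDeriv_tgt_sectionBracket hU hX hY hp) ?_
      refine fieldBracket_congr (E := EG) ?_ ?_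
      · filter_upwards [hU.mem_nhds hp] with q hq using congrArg Prod.snd (hXZ q hq)
      · filter_upwards [hU.mem_nhds hp] with q hq using congrArg Prod.snd (hYW q hq)

end SetGroupoid

end

/-! ### The Lie algebroid of G_β ⋆ G_α and the formulas for the induced maps. -/

noncomputable section

theorem AlgebroidData.IsLieAlgebroidIso.trans {E : Type*} [NormedAddCommGroup E] [NormedSpace ℝ E]
    {N : Type*} [TopologicalSpace N] [ChartedSpace E N] [IsManifold 𝓘(ℝ, E) ∞ N]
    {𝒜 ℬ 𝒞 : AlgebroidData E N} {F : ∀ x, 𝒜.Amb x →ₗ[ℝ] ℬ.Amb x}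
    {K : ∀ x, ℬ.Amb x →ₗ[ℝ] 𝒞.Amb x} (hF : 𝒜.IsLieAlgebroidIso ℬ F)
    (hK : ℬ.IsLieAlgebroidIso 𝒞 K) : 𝒜.IsLieAlgebroidIso 𝒞 (fun x => K x ∘ₗ F x) := by
  have push (U : Set N) (X : ∀ x, 𝒜.Amb x) (hU : IsOpen U) (hX : 𝒜.IsSection U X) :
      ℬ.IsSection U (fun x => F x (X x)) :=
    ⟨(hF.smooth_iff U X hU hX.2).1 hX.1, fun x hx => (hF.bijOn x).mapsTo (hX.2 x hx)⟩
  refine ⟨hF.source, hK.target, fun x => (hK.bijOn x).comp (hF.bijOn x), fun U X hU hX => ?_,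
    fun x v hv => ?_, fun U X Y hU hX hY x hx => ?_⟩
  · exact (hF.smooth_iff U X hU hX).trans
      (hK.smooth_iff U _ hU fun x hx => (hF.bijOn x).mapsTo (hX x hx))
  · exact (hK.anchor_map x _ ((hF.bijOn x).mapsTo hv)).trans (hF.anchor_map x v hv)
  · exact (congrArg (K x) (hF.bracket_map U X Y hU hX hY x hx)).trans
      (hK.bracket_map U _ _ hU (push U X hU hX) (push U Y hU hY) x hx)

namespace SetGroupoid

theorem inv_mulExt_inv {M G : Type*} (𝒢 : SetGroupoid M G) {g k : G} (c : 𝒢.tgt k = 𝒢.tgt g) :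
    𝒢.inv (𝒢.mulExt k (𝒢.inv g)) = 𝒢.mulExt g (𝒢.inv k) := by
  have c1 : 𝒢.tgt g = 𝒢.src (𝒢.inv k) := c.symm.trans (𝒢.src_inv k).symm
  have c2 : 𝒢.tgt k = 𝒢.src (𝒢.inv g) := c.trans (𝒢.src_inv g).symm
  have c3 : 𝒢.tgt (𝒢.inv k) = 𝒢.src (𝒢.mulExt k (𝒢.inv g)) := by
    rw [𝒢.src_mulExt c2, 𝒢.tgt_inv]
  refine (𝒢.eq_inv_of_mulExt_eq_one ((𝒢.tgt_mulExt c1).trans c3) ?_).symm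
  rw [𝒢.mulExt_assoc c1 c3, 𝒢.inv_mulExt_cancel_left c2, mulExt_inv, 𝒢.tgt_mulExt c2, 𝒢.tgt_inv]

variable {EM EG M G : Type*} [NormedAddCommGroup EM] [NormedSpace ℝ EM]
  [NormedAddCommGroup EG] [NormedSpace ℝ EG] [TopologicalSpace M] [ChartedSpace EM M]
  [TopologicalSpace G] [ChartedSpace EG G] {𝒢 : SetGroupoid M G}
  [IsManifold 𝓘(ℝ, EM) ∞ M] [IsManifold 𝓘(ℝ, EG) ∞ G]
  [FiniteDimensional ℝ EM] [FiniteDimensional ℝ EG]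
  [ChartedSpace (TripleModel EM EG) 𝒢.starSet]
  [IsManifold 𝓘(ℝ, TripleModel EM EG) ∞ 𝒢.starSet]

/-- The Lie algebroid of `G_β ⋆ G_α` is `Vβ ⊕ Vα`. -/
theorem IsLieGroupoid.isLieAlgebroidIso_starIdent (h : 𝒢.IsLieGroupoid EM EG)
    (hS : IsEmbeddedTriple EM EG 𝒢.starSet) :
    (𝒢.star.lieAlgebroid EG (TripleModel EM EG)).IsLieAlgebroidIso
      (𝒢.verticalSum EM EG (TripleModel EM EG)) (𝒢.starIdent EG (TripleModel EM EG)) := by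
  have hstar := h.star hS
  have hF := h.isFibredTriple_star
  have hA := hstar.isLieAlgebroid
  -- Vectors in the fibre have first entry 0, and X and Z - X determine the other two entries.
  have hinj (g : G) (v w : TripleModel EM EG)
      (hv : v ∈ (𝒢.star.lieAlgebroid EG (TripleModel EM EG)).fib g)
      (hw : w ∈ (𝒢.star.lieAlgebroid EG (TripleModel EM EG)).fib g)
      (e : 𝒢.starIdent EG (TripleModel EM EG) g v = 𝒢.starIdent EG (TripleModel EM EG) g w) :
      v = w := by
    have e1 : modelDeriv 𝓘(ℝ, TripleModel EM EG) 𝓘(ℝ, EG) (fun t : 𝒢.starSet => t.1.2.1)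
        (𝒢.star.one g) v = modelDeriv 𝓘(ℝ, TripleModel EM EG) 𝓘(ℝ, EG)
          (fun t : 𝒢.starSet => t.1.2.1) (𝒢.star.one g) w := congrArg Prod.fst e
    have e2 : modelDeriv 𝓘(ℝ, TripleModel EM EG) 𝓘(ℝ, EG) (fun t : 𝒢.starSet => t.1.2.2)
          (𝒢.star.one g) v - modelDeriv 𝓘(ℝ, TripleModel EM EG) 𝓘(ℝ, EG)
            (fun t : 𝒢.starSet => t.1.2.1) (𝒢.star.one g) v =
        modelDeriv 𝓘(ℝ, TripleModel EM EG) 𝓘(ℝ, EG) (fun t : 𝒢.starSet => t.1.2.2)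
          (𝒢.star.one g) w - modelDeriv 𝓘(ℝ, TripleModel EM EG) 𝓘(ℝ, EG)
            (fun t : 𝒢.starSet => t.1.2.1) (𝒢.star.one g) w := congrArg Prod.snd e
    rw [e1, sub_left_inj] at e2
    exact hS.modelDeriv_ext (Eq.trans (b := (0 : EG)) hv (Eq.symm hw)) e1 e2
  refine hA.isLieAlgebroidIso ?_ ?_ ?_ ?_ ?_ ?_ ?_
  · intro U X Y hU hX hY
    exact (isSection_iff hU).2 (((isSection_iff hU).1 hX).add ((isSection_iff hU).1 hY))
  · intro U f X hU hf hX
    exact (isSection_iff hU).2 (SectionOn.smul (fun x hx => hf.contMDiffAt (hU.mem_nhds hx))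
      ((isSection_iff hU).1 hX))
  · intro g
    refine ⟨fun (v : TripleModel EM EG) hv => ⟨?_, ?_⟩,
      fun v hv w hw e => hinj g v w hv hw e, fun z hz => ?_⟩
    · refine Eq.trans (hF.modelDeriv_fst_eq hS (𝒢.star.one g) v).symm ?_
      refine Eq.trans (congrArg (modelDeriv 𝓘(ℝ, EG) 𝓘(ℝ, EM) 𝒢.tgt g) hv) (map_zero _)
    · refine Eq.trans (map_sub (modelDeriv 𝓘(ℝ, EG) 𝓘(ℝ, EM) 𝒢.src g) _ _) ?_
      exact sub_eq_zero.2 (hF.modelDeriv_snd_eq hS (𝒢.star.one g) v).symm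
    · obtain ⟨(X : EG), (Y : EG)⟩ := z
      have hY : modelDeriv 𝓘(ℝ, EG) 𝓘(ℝ, EM) 𝒢.src g Y = 0 := hz.2
      have hXY : modelDeriv 𝓘(ℝ, EG) 𝓘(ℝ, EM) 𝒢.src g X =
          modelDeriv 𝓘(ℝ, EG) 𝓘(ℝ, EM) 𝒢.src g (X + Y) := by rw [map_add, hY, add_zero]
      -- The triple (0, X, X + Y) solves the linearized equations: the first because X is
      -- β-vertical, the second because Y is α-vertical.
      obtain ⟨v, h1, h2, h3⟩ := hF.exists_tangent hS (𝒢.star.one g) (X := 0) (Y := X)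
        (Z := X + Y) ((map_zero _).trans (Eq.symm hz.1)) hXY
      refine ⟨v, h1, Prod.ext h2 ?_⟩
      refine (congrArg₂ (fun a b : EG => a - b) h3 h2).trans ?_
      exact add_sub_cancel_left (G := EG) X Y
  · intro U Z Z' hU hZ hs
    exact ⟨hs.1.congr fun q hq => by rw [hZ q hq], hs.2.congr fun q hq => by rw [hZ q hq]⟩
  · intro U X hU hX
    constructor
    · intro hs
      replace hs := (smooth_iff hU).1 hs
      have h2 (g : G) (hg : g ∈ U) := (hs g hg).map (hS.contMDiff_snd.contMDiffAt)
      have h3 (g : G) (hg : g ∈ U) := (hs g hg).map (hS.contMDiff_thd.contMDiffAt)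
      exact ⟨fun g hg => (h2 g hg).contMDiffWithinAt,
        fun g hg => ((h3 g hg).sub (h2 g hg)).contMDiffWithinAt⟩
    · intro hs
      refine (smooth_iff hU).2 fun g hg => ?_
      have h2 : SmoothAlongAt 𝓘(ℝ, EG) 𝓘(ℝ, EG) (fun y => y) (fun y =>
        modelDeriv 𝓘(ℝ, TripleModel EM EG) 𝓘(ℝ, EG) (fun t : 𝒢.starSet => t.1.2.1)
          (𝒢.star.one y) (X y)) g := hs.1.contMDiffAt (hU.mem_nhds hg)
      have h3 : SmoothAlongAt 𝓘(ℝ, EG) 𝓘(ℝ, EG) (fun y => y) (fun y =>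
        modelDeriv 𝓘(ℝ, TripleModel EM EG) 𝓘(ℝ, EG) (fun t : 𝒢.starSet => t.1.2.2)
          (𝒢.star.one y) (X y) -
        modelDeriv 𝓘(ℝ, TripleModel EM EG) 𝓘(ℝ, EG) (fun t : 𝒢.starSet => t.1.2.1)
          (𝒢.star.one y) (X y)) g := hs.2.contMDiffAt (hU.mem_nhds hg)
      refine hS.smoothAlongAt ?_ h2 ?_
      · refine (SmoothAlongAt.zero contMDiffAt_id).congr (.of_forall fun _ => rfl) ?_
        filter_upwards [hU.mem_nhds hg] with q hq using hX q hq
      · exact (h2.add h3).congr (.of_forall fun _ => rfl)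
          (.of_forall fun _ => (add_sub_cancel _ _).symm)
  · intro g v _
    exact add_sub_cancel (G := EG) _ _
  · intro U X Y Z W hU hX hY hXZ hYW g hg
    have lift (X : ∀ g, (𝒢.star.lieAlgebroid EG (TripleModel EM EG)).Amb g)
        (Z : ∀ g : G, TangentSpace 𝓘(ℝ, EG) g × TangentSpace 𝓘(ℝ, EG) g)
        (hX : (𝒢.star.lieAlgebroid EG (TripleModel EM EG)).IsSection U X)
        (hXZ : ∀ k ∈ U, 𝒢.starIdent EG (TripleModel EM EG) k (X k) = Z k) (k : G) (hk : k ∈ U) :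
        X k = Function.invFunOn (𝒢.starIdent EG (TripleModel EM EG) k)
          {v | v ∈ (𝒢.star.lieAlgebroid EG (TripleModel EM EG)).fib k} (Z k) := by
      have := Function.invFunOn_pos (f := 𝒢.starIdent EG (TripleModel EM EG) k)
        (s := {v | v ∈ (𝒢.star.lieAlgebroid EG (TripleModel EM EG)).fib k}) (b := Z k)
        ⟨X k, hX.2 k hk, hXZ k hk⟩
      exact hinj k _ _ (hX.2 k hk) this.1 ((hXZ k hk).trans this.2.symm)
    -- The bracket on Vβ ⊕ Vα uses chosen preimages. By injectivity on the fibres these are the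
    -- given sections on U, and brackets depend only on the values there.
    refine congrArg (𝒢.starIdent EG (TripleModel EM EG) g) ?_
    exact hA.bracket_congr U X _ Y _ hU hX (hA.isSection_congr hU hX (lift X Z hX hXZ)) hY
      (hA.isSection_congr hU hY (lift Y W hY hYW)) (lift X Z hX hXZ) (lift Y W hY hYW) g hg

/-- The middle entry is h⁻¹s, so the vector is Tm(Ti(X), Z) at (g⁻¹, g). It splits as Tm(Ti(X), X) +
Tm(0, Z - X). The first summand vanishes, because k⁻¹k = ε(β(k)) and X is β-vertical; the second is
left translation by g⁻¹ of the α-vertical vector Z - X. -/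
theorem IsLieGroupoid.prolongationIdent_algebroidMap_Phiβ (h : 𝒢.IsLieGroupoid EM EG)
    [ChartedSpace (TripleModel EM EG) (𝒢.prolongationSet 𝒢.tgt)]
    [IsManifold 𝓘(ℝ, TripleModel EM EG) ∞ (𝒢.prolongationSet 𝒢.tgt)]
    (hS : IsEmbeddedTriple EM EG 𝒢.starSet)
    (hP : IsEmbeddedTriple EM EG (𝒢.prolongationSet 𝒢.tgt)) (g : G)
    (v : TripleModel EM EG)
    (hv : v ∈ (𝒢.star.lieAlgebroid EG (TripleModel EM EG)).fib g) :
    𝒢.prolongationIdent EG EG (TripleModel EM EG) 𝒢.tgt g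
      (𝒢.star.algebroidMap (TripleModel EM EG) (TripleModel EM EG)
        (𝒢.prolongation 𝒢.tgt) 𝒢.Phiβ g v) =
      𝒢.formulaβ EG g (𝒢.starIdent EG (TripleModel EM EG) g v) := by
  have hΦ := h.isLieGroupoidIso_Phiβ hS hP
  have hsm := hΦ.isMorphism.smooth.contMDiffAt (x := 𝒢.star.one g)
  have hfib := ((h.isLieAlgebroidIso_starIdent hS).bijOn g).mapsTo hv
  set X : EG := modelDeriv 𝓘(ℝ, TripleModel EM EG) 𝓘(ℝ, EG) (fun t : 𝒢.starSet => t.1.2.1)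
    (𝒢.star.one g) v with hX
  set Z : EG := modelDeriv 𝓘(ℝ, TripleModel EM EG) 𝓘(ℝ, EG) (fun t : 𝒢.starSet => t.1.2.2)
    (𝒢.star.one g) v with hZ
  have hkX : modelDeriv 𝓘(ℝ, EG) 𝓘(ℝ, EM) 𝒢.tgt g X = 0 := hfib.1
  have hkY : modelDeriv 𝓘(ℝ, EG) 𝓘(ℝ, EM) 𝒢.src g (Z - X) = 0 := hfib.2
  have hone : 𝒢.Phiβ (𝒢.star.one g) = (𝒢.prolongation 𝒢.tgt).one g := hΦ.one_map g
  have c : 𝒢.tgt (𝒢.inv g) = 𝒢.src g := 𝒢.tgt_inv g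
  obtain ⟨m, hm⟩ := h.exists_isLocalMul c
  have hinv : ContMDiffAt 𝓘(ℝ, EG) 𝓘(ℝ, EG) ∞ 𝒢.inv g := h.contMDiff_inv.contMDiffAt
  have hi : MDifferentiableAt 𝓘(ℝ, TripleModel EM EG) 𝓘(ℝ, EG)
      (fun t : 𝒢.starSet => 𝒢.inv t.1.2.1) (𝒢.star.one g) :=
    (h.contMDiff_inv.comp hS.contMDiff_snd).contMDiffAt.mdiff
  have ht : MDifferentiableAt 𝓘(ℝ, TripleModel EM EG) 𝓘(ℝ, EG)
      (fun t : 𝒢.starSet => t.1.2.2) (𝒢.star.one g) := hS.contMDiff_thd.contMDiffAt.mdiff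
  have hmd : MDifferentiableAt (𝓘(ℝ, EG).prod 𝓘(ℝ, EG)) 𝓘(ℝ, EG) m (𝒢.inv g, g) :=
    hm.smooth.mdiff
  have e1 : modelDeriv 𝓘(ℝ, TripleModel EM EG) 𝓘(ℝ, EG) (fun t => (𝒢.Phiβ t).1.2.1)
      (𝒢.star.one g) v = modelDeriv (𝓘(ℝ, EG).prod 𝓘(ℝ, EG)) 𝓘(ℝ, EG) m (𝒢.inv g, g)
        (modelDeriv 𝓘(ℝ, EG) 𝓘(ℝ, EG) 𝒢.inv g X, Z) := by
    have := modelDeriv_comp_apply (f := fun t : 𝒢.starSet => (𝒢.inv t.1.2.1, t.1.2.2))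
      (x := 𝒢.star.one g) hmd (hi.prodMk ht) v
    rw [modelDeriv_prodMk hi ht, modelDeriv_comp_apply (g := 𝒢.inv) (I' := 𝓘(ℝ, EG))
      (f := fun t : 𝒢.starSet => t.1.2.1) hinv.mdiff hS.contMDiff_snd.contMDiffAt.mdiff] at this
    refine Eq.trans (congrArg (fun L : TripleModel EM EG →L[ℝ] EG => L v)
      (modelDeriv_congr ?_)) this
    have hc : ContinuousAt (fun t : 𝒢.starSet => (𝒢.inv t.1.2.1, t.1.2.2)) (𝒢.star.one g) :=
      hi.continuousAt.prodMk ht.continuousAt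
    filter_upwards [hc.eventually hm.eventually_eq] with t ht
    exact (𝒢.Phiβ_snd t).trans (ht ((𝒢.tgt_inv _).trans t.2.2)).symm
  have e2 : modelDeriv (𝓘(ℝ, EG).prod 𝓘(ℝ, EG)) 𝓘(ℝ, EG) m (𝒢.inv g, g)
      (modelDeriv 𝓘(ℝ, EG) 𝓘(ℝ, EG) 𝒢.inv g X, X) = 0 := by
    have := modelDeriv_comp_apply (f := fun k : G => (𝒢.inv k, k)) (x := g) hmd
      (hinv.mdiff.prodMk mdifferentiableAt_id) X
    rw [modelDeriv_prodMk (g := fun k => k) hinv.mdiff mdifferentiableAt_id, modelDeriv_id] at this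
    refine this.symm.trans ?_
    have hc : ContinuousAt (fun k : G => (𝒢.inv k, k)) g :=
      hinv.continuousAt.prodMk continuousAt_id
    rw [modelDeriv_congr (g := fun k => 𝒢.one (𝒢.tgt k)), modelDeriv_comp_apply
      h.contMDiff_one.contMDiffAt.mdiff h.isSubmersion_tgt.contMDiff.contMDiffAt.mdiff, hkX,
      map_zero]
    filter_upwards [hc.eventually hm.eventually_eq] with k hk
    exact (hk (𝒢.tgt_inv k)).trans (𝒢.inv_mulExt k)
  have e3 : modelDeriv (𝓘(ℝ, EG).prod 𝓘(ℝ, EG)) 𝓘(ℝ, EG) m (𝒢.inv g, g) (0, Z - X) =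
      𝒢.leftD EG (𝒢.inv g) g (Z - X) := by
    rw [h.leftD_eq_localMul hm c hkY, modelDeriv_prod_apply hmd, map_zero, zero_add]
  refine Prod.ext ?_ ?_
  · change modelDeriv 𝓘(ℝ, TripleModel EM EG) 𝓘(ℝ, EG)
      (fun t : 𝒢.prolongationSet 𝒢.tgt => t.1.2.1) ((𝒢.prolongation 𝒢.tgt).one g)
        (modelDeriv 𝓘(ℝ, TripleModel EM EG) 𝓘(ℝ, TripleModel EM EG) 𝒢.Phiβ (𝒢.star.one g) v) =
      𝒢.leftD EG (𝒢.inv g) g (Z - X)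
    rw [← hone, ← modelDeriv_comp_apply (g := fun t : 𝒢.prolongationSet 𝒢.tgt => t.1.2.1)
      hP.contMDiff_snd.contMDiffAt.mdiff hsm.mdiff, e1, ← e3, ← sub_eq_zero, ← map_sub,
      Prod.mk_sub_mk, sub_zero, sub_sub_cancel, e2]
  · refine Eq.trans ?_ (add_sub_cancel (G := EG) X Z).symm
    change modelDeriv 𝓘(ℝ, TripleModel EM EG) 𝓘(ℝ, EG)
      (fun t : 𝒢.prolongationSet 𝒢.tgt => t.1.2.2) ((𝒢.prolongation 𝒢.tgt).one g)
        (modelDeriv 𝓘(ℝ, TripleModel EM EG) 𝓘(ℝ, TripleModel EM EG) 𝒢.Phiβ (𝒢.star.one g) v) = Z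
    rw [← hone, ← modelDeriv_comp_apply (g := fun t : 𝒢.prolongationSet 𝒢.tgt => t.1.2.2)
      hP.contMDiff_thd.contMDiffAt.mdiff hsm.mdiff]
    rfl

/-- The first entry of the vector is 0, so only h moves in gh⁻¹. Along the β-fibre of g one has gk⁻¹
= (kg⁻¹)⁻¹, so the derivative of k ↦ gk⁻¹ in the β-vertical direction X is that of i ∘ r_{g⁻¹}. -/
theorem IsLieGroupoid.prolongationIdent_algebroidMap_Phiα (h : 𝒢.IsLieGroupoid EM EG)
    [ChartedSpace (TripleModel EM EG) (𝒢.prolongationSet 𝒢.src)]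
    [IsManifold 𝓘(ℝ, TripleModel EM EG) ∞ (𝒢.prolongationSet 𝒢.src)]
    (hS : IsEmbeddedTriple EM EG 𝒢.starSet)
    (hP : IsEmbeddedTriple EM EG (𝒢.prolongationSet 𝒢.src)) (g : G)
    (v : TripleModel EM EG)
    (hv : v ∈ (𝒢.star.lieAlgebroid EG (TripleModel EM EG)).fib g) :
    𝒢.prolongationIdent EG EG (TripleModel EM EG) 𝒢.src g
      (𝒢.star.algebroidMap (TripleModel EM EG) (TripleModel EM EG)
        (𝒢.prolongation 𝒢.src) 𝒢.Phiα g v) =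
      𝒢.formulaα EG g (𝒢.starIdent EG (TripleModel EM EG) g v) := by
  have hΦ := h.isLieGroupoidIso_Phiα hS hP
  have hsm := hΦ.isMorphism.smooth.contMDiffAt (x := 𝒢.star.one g)
  have hfib := ((h.isLieAlgebroidIso_starIdent hS).bijOn g).mapsTo hv
  set X : EG := modelDeriv 𝓘(ℝ, TripleModel EM EG) 𝓘(ℝ, EG) (fun t : 𝒢.starSet => t.1.2.1)
    (𝒢.star.one g) v with hX
  set Z : EG := modelDeriv 𝓘(ℝ, TripleModel EM EG) 𝓘(ℝ, EG) (fun t : 𝒢.starSet => t.1.2.2)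
    (𝒢.star.one g) v with hZ
  have h0 : modelDeriv 𝓘(ℝ, TripleModel EM EG) 𝓘(ℝ, EG) (fun t : 𝒢.starSet => t.1.1)
    (𝒢.star.one g) v = 0 := hv
  have hkX : modelDeriv 𝓘(ℝ, EG) 𝓘(ℝ, EM) 𝒢.tgt g X = 0 := hfib.1
  have hone : 𝒢.Phiα (𝒢.star.one g) = (𝒢.prolongation 𝒢.src).one g := hΦ.one_map g
  have c : 𝒢.tgt g = 𝒢.src (𝒢.inv g) := (𝒢.src_inv g).symm
  obtain ⟨m, hm⟩ := h.exists_isLocalMul c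
  have hinv : ContMDiffAt 𝓘(ℝ, EG) 𝓘(ℝ, EG) ∞ 𝒢.inv g := h.contMDiff_inv.contMDiffAt
  have hi : MDifferentiableAt 𝓘(ℝ, TripleModel EM EG) 𝓘(ℝ, EG)
      (fun t : 𝒢.starSet => 𝒢.inv t.1.2.1) (𝒢.star.one g) :=
    (h.contMDiff_inv.comp hS.contMDiff_snd).contMDiffAt.mdiff
  have ht : MDifferentiableAt 𝓘(ℝ, TripleModel EM EG) 𝓘(ℝ, EG)
      (fun t : 𝒢.starSet => t.1.1) (𝒢.star.one g) := hS.contMDiff_fst.contMDiffAt.mdiff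
  have hmd : MDifferentiableAt (𝓘(ℝ, EG).prod 𝓘(ℝ, EG)) 𝓘(ℝ, EG) m (g, 𝒢.inv g) :=
    hm.smooth.mdiff
  have e1 : modelDeriv 𝓘(ℝ, TripleModel EM EG) 𝓘(ℝ, EG) (fun t => (𝒢.Phiα t).1.2.1)
      (𝒢.star.one g) v = modelDeriv (𝓘(ℝ, EG).prod 𝓘(ℝ, EG)) 𝓘(ℝ, EG) m (g, 𝒢.inv g)
        (0, modelDeriv 𝓘(ℝ, EG) 𝓘(ℝ, EG) 𝒢.inv g X) := by
    have := modelDeriv_comp_apply (f := fun t : 𝒢.starSet => (t.1.1, 𝒢.inv t.1.2.1))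
      (x := 𝒢.star.one g) hmd (ht.prodMk hi) v
    rw [modelDeriv_prodMk ht hi, modelDeriv_comp_apply (g := 𝒢.inv) (I' := 𝓘(ℝ, EG))
      (f := fun t : 𝒢.starSet => t.1.2.1) hinv.mdiff hS.contMDiff_snd.contMDiffAt.mdiff,
      h0] at this
    refine Eq.trans (congrArg (fun L : TripleModel EM EG →L[ℝ] EG => L v)
      (modelDeriv_congr ?_)) this
    have hc : ContinuousAt (fun t : 𝒢.starSet => (t.1.1, 𝒢.inv t.1.2.1)) (𝒢.star.one g) :=
      ht.continuousAt.prodMk hi.continuousAt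
    filter_upwards [hc.eventually hm.eventually_eq] with t ht
    exact (𝒢.Phiα_snd t).trans (ht (t.2.1.trans (𝒢.src_inv _).symm)).symm
  have hφ : MDifferentiableAt 𝓘(ℝ, EG) 𝓘(ℝ, EG) (fun k => m (g, 𝒢.inv k)) g :=
    hm.contMDiffAt_right.mdiff.comp g hinv.mdiff
  have e2 : modelDeriv (𝓘(ℝ, EG).prod 𝓘(ℝ, EG)) 𝓘(ℝ, EG) m (g, 𝒢.inv g)
      (0, modelDeriv 𝓘(ℝ, EG) 𝓘(ℝ, EG) 𝒢.inv g X) =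
        modelDeriv 𝓘(ℝ, EG) 𝓘(ℝ, EG) (fun k => m (g, 𝒢.inv k)) g X := by
    rw [modelDeriv_prod_apply hmd, map_zero, zero_add,
      modelDeriv_comp_apply (g := fun k => m (g, k)) hm.contMDiffAt_right.mdiff hinv.mdiff]
  have e3 : mfderivWithin 𝓘(ℝ, EG) 𝓘(ℝ, EG) (fun k => 𝒢.inv (𝒢.mulExt k (𝒢.inv g)))
      (𝒢.tgt ⁻¹' {𝒢.tgt g}) g X = modelDeriv 𝓘(ℝ, EG) 𝓘(ℝ, EG) (fun k => m (g, 𝒢.inv k)) g X := by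
    refine mfderivWithin_fibre h.isSubmersion_tgt hφ ?_ hkX
    filter_upwards [hinv.continuousAt.eventually (hm.eventually_right c)] with k hk hkg
    rw [𝒢.inv_mulExt_inv hkg, hk (by rw [𝒢.src_inv, 𝒢.src_inv, hkg])]
  refine Prod.ext ?_ ?_
  · change modelDeriv 𝓘(ℝ, TripleModel EM EG) 𝓘(ℝ, EG)
      (fun t : 𝒢.prolongationSet 𝒢.src => t.1.2.1) ((𝒢.prolongation 𝒢.src).one g)
        (modelDeriv 𝓘(ℝ, TripleModel EM EG) 𝓘(ℝ, TripleModel EM EG) 𝒢.Phiα (𝒢.star.one g) v) = _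
    rw [← hone, ← modelDeriv_comp_apply (g := fun t : 𝒢.prolongationSet 𝒢.src => t.1.2.1)
      hP.contMDiff_snd.contMDiffAt.mdiff hsm.mdiff, e1, e2]
    exact e3.symm
  · refine Eq.trans ?_ (add_sub_cancel (G := EG) X Z).symm
    change modelDeriv 𝓘(ℝ, TripleModel EM EG) 𝓘(ℝ, EG)
      (fun t : 𝒢.prolongationSet 𝒢.src => t.1.2.2) ((𝒢.prolongation 𝒢.src).one g)
        (modelDeriv 𝓘(ℝ, TripleModel EM EG) 𝓘(ℝ, TripleModel EM EG) 𝒢.Phiα (𝒢.star.one g) v) = Z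
    rw [← hone, ← modelDeriv_comp_apply (g := fun t : 𝒢.prolongationSet 𝒢.src => t.1.2.2)
      hP.contMDiff_thd.contMDiffAt.mdiff hsm.mdiff]
    rfl

end SetGroupoid

end

/-- `G_β ⋆ G_α`, `P^β G` and `P^α G` are embedded submanifolds of `G × G × G`; with these smooth
structures `Φ^β` and `Φ^α` are isomorphisms of Lie groupoids over the identity of `G`, they induce
isomorphisms of Lie algebroids, and these are given by the stated formulas under the
identifications with `Vβ ⊕ Vα`, `P^β(AG)` and `P^α(AG)`. -/
theorem theorem3p3 {EM EG M G : Type*}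
    [NormedAddCommGroup EM] [NormedSpace ℝ EM] [FiniteDimensional ℝ EM]
    [NormedAddCommGroup EG] [NormedSpace ℝ EG] [FiniteDimensional ℝ EG]
    [TopologicalSpace M] [ChartedSpace EM M] [IsManifold 𝓘(ℝ, EM) ∞ M]
    [TopologicalSpace G] [ChartedSpace EG G] [IsManifold 𝓘(ℝ, EG) ∞ G]
    (𝒢 : SetGroupoid M G) (h𝒢 : 𝒢.IsLieGroupoid EM EG) :
    (∃ (_ : ChartedSpace (TripleModel EM EG) 𝒢.starSet)
        (_ : IsManifold 𝓘(ℝ, TripleModel EM EG) ∞ 𝒢.starSet),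
        IsEmbeddedTriple EM EG 𝒢.starSet) ∧
    (∃ (_ : ChartedSpace (TripleModel EM EG) (𝒢.prolongationSet 𝒢.tgt))
        (_ : IsManifold 𝓘(ℝ, TripleModel EM EG) ∞ (𝒢.prolongationSet 𝒢.tgt)),
        IsEmbeddedTriple EM EG (𝒢.prolongationSet 𝒢.tgt)) ∧
    (∃ (_ : ChartedSpace (TripleModel EM EG) (𝒢.prolongationSet 𝒢.src))
        (_ : IsManifold 𝓘(ℝ, TripleModel EM EG) ∞ (𝒢.prolongationSet 𝒢.src)),
        IsEmbeddedTriple EM EG (𝒢.prolongationSet 𝒢.src)) ∧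
    ∀ [ChartedSpace (TripleModel EM EG) 𝒢.starSet]
      [IsManifold 𝓘(ℝ, TripleModel EM EG) ∞ 𝒢.starSet]
      [ChartedSpace (TripleModel EM EG) (𝒢.prolongationSet 𝒢.tgt)]
      [IsManifold 𝓘(ℝ, TripleModel EM EG) ∞ (𝒢.prolongationSet 𝒢.tgt)]
      [ChartedSpace (TripleModel EM EG) (𝒢.prolongationSet 𝒢.src)]
      [IsManifold 𝓘(ℝ, TripleModel EM EG) ∞ (𝒢.prolongationSet 𝒢.src)],
      IsEmbeddedTriple EM EG 𝒢.starSet →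
      IsEmbeddedTriple EM EG (𝒢.prolongationSet 𝒢.tgt) →
      IsEmbeddedTriple EM EG (𝒢.prolongationSet 𝒢.src) →
      -- the identifications are isomorphisms of Lie algebroids
      (𝒢.star.lieAlgebroid EG (TripleModel EM EG)).IsLieAlgebroidIso
        (𝒢.verticalSum EM EG (TripleModel EM EG)) (𝒢.starIdent EG (TripleModel EM EG)) ∧
      ((𝒢.prolongation 𝒢.tgt).lieAlgebroid EG (TripleModel EM EG)).IsLieAlgebroidIso
        ((𝒢.lieAlgebroid EM EG).prolongation 𝒢.tgt)
        (𝒢.prolongationIdent EG EG (TripleModel EM EG) 𝒢.tgt) ∧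
      ((𝒢.prolongation 𝒢.src).lieAlgebroid EG (TripleModel EM EG)).IsLieAlgebroidIso
        ((𝒢.lieAlgebroid EM EG).prolongation 𝒢.src)
        (𝒢.prolongationIdent EG EG (TripleModel EM EG) 𝒢.src) ∧
      -- the map `Φ^β`
      (𝒢.star.IsLieGroupoidIso EG (TripleModel EM EG) (TripleModel EM EG)
          (𝒢.prolongation 𝒢.tgt) 𝒢.Phiβ ∧
        (𝒢.star.lieAlgebroid EG (TripleModel EM EG)).IsLieAlgebroidIso
          ((𝒢.prolongation 𝒢.tgt).lieAlgebroid EG (TripleModel EM EG))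
          (𝒢.star.algebroidMap (TripleModel EM EG) (TripleModel EM EG)
            (𝒢.prolongation 𝒢.tgt) 𝒢.Phiβ) ∧
        (𝒢.verticalSum EM EG (TripleModel EM EG)).IsLieAlgebroidIso
          ((𝒢.lieAlgebroid EM EG).prolongation 𝒢.tgt) (𝒢.formulaβ EG) ∧
        ∀ g, ∀ v ∈ (𝒢.star.lieAlgebroid EG (TripleModel EM EG)).fib g,
          𝒢.prolongationIdent EG EG (TripleModel EM EG) 𝒢.tgt g
            (𝒢.star.algebroidMap (TripleModel EM EG) (TripleModel EM EG)
              (𝒢.prolongation 𝒢.tgt) 𝒢.Phiβ g v) =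
          𝒢.formulaβ EG g (𝒢.starIdent EG (TripleModel EM EG) g v)) ∧
      -- the map `Φ^α`
      (𝒢.star.IsLieGroupoidIso EG (TripleModel EM EG) (TripleModel EM EG)
          (𝒢.prolongation 𝒢.src) 𝒢.Phiα ∧
        (𝒢.star.lieAlgebroid EG (TripleModel EM EG)).IsLieAlgebroidIso
          ((𝒢.prolongation 𝒢.src).lieAlgebroid EG (TripleModel EM EG))
          (𝒢.star.algebroidMap (TripleModel EM EG) (TripleModel EM EG)
            (𝒢.prolongation 𝒢.src) 𝒢.Phiα) ∧
        (𝒢.verticalSum EM EG (TripleModel EM EG)).IsLieAlgebroidIso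
          ((𝒢.lieAlgebroid EM EG).prolongation 𝒢.src) (𝒢.formulaα EG) ∧
        ∀ g, ∀ v ∈ (𝒢.star.lieAlgebroid EG (TripleModel EM EG)).fib g,
          𝒢.prolongationIdent EG EG (TripleModel EM EG) 𝒢.src g
            (𝒢.star.algebroidMap (TripleModel EM EG) (TripleModel EM EG)
              (𝒢.prolongation 𝒢.src) 𝒢.Phiα g v) =
          𝒢.formulaα EG g (𝒢.starIdent EG (TripleModel EM EG) g v)) := by
  refine ⟨h𝒢.isFibredTriple_star.exists_isEmbeddedTriple,
    (h𝒢.isFibredTriple_prolongation h𝒢.isSubmersion_tgt).exists_isEmbeddedTriple,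
    (h𝒢.isFibredTriple_prolongation h𝒢.isSubmersion_src).exists_isEmbeddedTriple, ?_⟩
  intro _ _ _ _ _ _ hS hβ hα
  have iS := h𝒢.isLieAlgebroidIso_starIdent hS
  have iβ := h𝒢.isLieAlgebroidIso_prolongationIdent h𝒢.isSubmersion_tgt hβ
  have iα := h𝒢.isLieAlgebroidIso_prolongationIdent h𝒢.isSubmersion_src hα
  have Φβ := h𝒢.isLieGroupoidIso_Phiβ hS hβ
  have Φα := h𝒢.isLieGroupoidIso_Phiα hS hα
  have fβ := h𝒢.prolongationIdent_algebroidMap_Phiβ hS hβ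
  have fα := h𝒢.prolongationIdent_algebroidMap_Phiα hS hα
  -- The square formed by the identifications, TΦ and the explicit formula commutes. Three of its
  -- sides are isomorphisms of Lie algebroids, hence so is the fourth.
  exact ⟨iS, iβ, iα,
    ⟨Φβ, Φβ.isLieAlgebroidIso,
      iS.of_comp (Φβ.isLieAlgebroidIso.trans iβ) fun g v hv => (fβ g v hv).symm, fβ⟩,
    ⟨Φα, Φα.isLieAlgebroidIso,
      iS.of_comp (Φα.isLieAlgebroidIso.trans iα) fun g v hv => (fα g v hv).symm, fα⟩⟩
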